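/- \textbf{Conventions.} Rings are associative and unital. A topological ring $\mathfrak S$ is \emph{left linear} if its open left ideals form a base of neighborhoods of zero; it is \emph{separated} (resp.\ \emph{complete}) if the canonical map $\mathfrak S\to\varprojlim_{\mathfrak I}\mathfrak S/\mathfrak I$, with $\mathfrak I$ ranging over the open left ideals, is injective (resp.\ surjective). A left module over a topological ring is \emph{discrete} if the annihilator of each of its elements is open. A left linear topology on a ring $S$ is a \emph{(left) Gabriel topology} if the class of discrete left $S$-modules is a torsion class, i.e.\ is closed under direct sums, epimorphic images and extensions. A two-sided ideal $J\subset S$ has the \emph{left Artin--Rees property} if for every finitely generated left $S$-module $L$ and every submodule $N\subseteq L$ there is an integer $m>0$ with $J^mL\cap N\subseteq JN$. For a complete, separated left linear topological ring $\mathfrak S$ and a set $X$, let $[[X]]\mathfrak S$ be the set of all formal linear combinations $\sum_{x\in X}xs_x$ whose family of coefficients $s_x\in\mathfrak S$ converges to zero (every open left ideal contains all but finitely many $s_x$). The functor $X\mapsto[[X]]\mathfrak S$ is a monad on the category of sets, with unit $x\mapsto 1\cdot x$ and with multiplication given by opening the parentheses; a \emph{right $\mathfrak S$-contramodule} is a module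 (algebra) over this monad, and $[[X]]\mathfrak S$ is the \emph{free} contramodule spanned by $X$. A contramodule is \emph{finitely generated projective} if it is a direct summand of $[[X]]\mathfrak S$ for some finite set $X$. For a right $\mathfrak S$-contramodule $\mathfrak C$ with contraaction $\pi\colon[[\mathfrak C]]\mathfrak S\to\mathfrak C$ and a discrete left $\mathfrak S$-module $L$, the \emph{contratensor product} $\mathfrak C\odot_{\mathfrak S}L$ is the quotient of $\mathfrak C\otimes_{\mathbb Z}L$ by the subgroup generated by all elements $\pi(\sum_c cs_c)\otimes b-\sum_c c\otimes s_cb$. The contramodule $\mathfrak C$ is \emph{flat} if $\mathfrak C\odot_{\mathfrak S}-$ is exact on the category of discrete left $\mathfrak S$-modules. Direct limits (indexed by directed posets) of contramodules are computed in the category of right $\mathfrak S$-contramodules. \textbf{Theorem.} (1) Let $\mathfrak S$ be a complete, separated left linear topological ring, let $S$ be a ring, and let $\sigma\colon S\to\mathfrak S$ be a ring homomorphism with dense image; endow $S$ with the topology induced by $\sigma$. Assume that $S$ is left noetherian, that the topology of $S$ is a (left) Gabriel topology, and that it has a countable base of neighborhoods of zero consisting of two-sided ideals having the left Artin--Rees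 property. Then: (C-GL1) the flat right $\mathfrak S$-contramodules are precisely the direct limits of projective right $\mathfrak S$-contramodules; (C-GL2) the direct limits of projective right $\mathfrak S$-contramodules are precisely the direct limits of finitely generated projective right $\mathfrak S$-contramodules. In other words, every flat right $\mathfrak S$-contramodule is a direct limit of finitely generated projective right $\mathfrak S$-contramodules. (2) Let $R$ be a ring, let $M$ be a right $R$-module, and let $\mathfrak S=\operatorname{End}(M_R)$ carry the finite topology, in which the annihilators of the finitely generated submodules of $M$ form a base of neighborhoods of zero. Let $S$ be a ring and $\sigma\colon S\to\mathfrak S$ a ring homomorphism with dense image such that $S$, with the topology induced by $\sigma$, satisfies the assumptions on $S$ in (1). Then $\varinjlim\operatorname{add}M=\varinjlim\operatorname{Add}M$, where $\operatorname{Add}M$ (resp.\ $\operatorname{add}M$) is the class of all direct summands of direct sums (resp.\ finite direct sums) of copies of $M$, and $\varinjlim\mathcal C$ denotes the class of all direct limits in the category of right $R$-modules, indexed by directed posets, of direct systems of modules from $\mathcal C$. -/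

import Mathlib

open CategoryTheory CategoryTheory.Limits Topology
open scoped TensorProduct

universe u

set_option linter.unusedSectionVars false
set_option linter.style.haveILetI false

namespace Contra

noncomputable section

/-! ### Complete, separated left linear topological rings -/

section Ring

variable (S : Type u) [Ring S] [TopologicalSpace S]

/-- The open left ideals of a topological ring. -/
abbrev OpenLeftIdeal : Type u := {I : Submodule S S // IsOpen (I : Set S)}

/-- The underlying set of the completion `lim S / I`, where `I` ranges over the open left ideals. -/
def Completion : Type u :=
  {x : ∀ I : OpenLeftIdeal S, S ⧸ I.1 //
    ∀ (I J : OpenLeftIdeal S) (h : I.1 ≤ J.1), Submodule.factor h (x I) = x J}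

/-- The completion map `S → lim S / I`. -/
def completionMap (s : S) : Completion S :=
  ⟨fun I => I.1.mkQ s, fun _ _ _ => rfl⟩

/-- A left linear topological ring is complete if its completion map is surjective and separated
if its completion map is injective. -/
class IsCompleteSeparated : Prop where
  separated : Function.Injective (completionMap S)
  complete : Function.Surjective (completionMap S)

variable {S}

/-- Convergence to zero of a family of elements: for every open left ideal `I`, all but finitely
many members of the family belong to `I`. -/
def IsZeroConvergent {X : Type*} (s : X → S) : Prop :=
  ∀ I : OpenLeftIdeal S, {x | s x ∉ I.1}.Finite

variable (S) in
/-- The group `[[X]]S` of infinite formal linear combinations `∑ x s_x` whose family of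
coefficients converges to zero. -/
def ZeroFamilies (X : Type u) : AddSubgroup (X → S) where
  carrier := {s | IsZeroConvergent s}
  zero_mem' I := by simp
  add_mem' {s t} hs ht I := by
    refine ((hs I).union (ht I)).subset fun x hx => ?_
    by_contra h
    simp only [Set.mem_union, Set.mem_ofPred_eq, not_or, not_not] at h
    exact hx (I.1.add_mem h.1 h.2)
  neg_mem' {s} hs I := by simpa using hs I

theorem IsZeroConvergent.comp_injective {X Y : Type*} {s : X → S} (hs : IsZeroConvergent s)
    {g : Y → X} (hg : Function.Injective g) : IsZeroConvergent (fun y => s (g y)) := fun I =>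
  (hs I).preimage hg.injOn

theorem IsZeroConvergent.mul_left {X : Type*} {s : X → S} (hs : IsZeroConvergent s)
    (c : X → S) : IsZeroConvergent (fun x => c x * s x) := fun I =>
  (hs I).subset fun _ hx h => hx (I.1.smul_mem _ h)

variable [IsCompleteSeparated S]

theorem eq_of_sub_mem {a b : S} (h : ∀ I : OpenLeftIdeal S, a - b ∈ I.1) : a = b := by
  apply IsCompleteSeparated.separated
  apply Subtype.ext
  funext I
  exact (Submodule.Quotient.eq I.1).2 (h I)

variable [IsTopologicalRing S] [IsLinearTopology S S]

theorem exists_openLeftIdeal {U : Set S} (hU : U ∈ 𝓝 (0 : S)) :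
    ∃ I : OpenLeftIdeal S, (I.1 : Set S) ⊆ U := by
  obtain ⟨I, hI, h⟩ := (IsLinearTopology.hasBasis_open_submodule S).mem_iff.1 hU
  exact ⟨⟨I, hI⟩, h⟩

theorem OpenLeftIdeal.mem_nhds (I : OpenLeftIdeal S) : (I.1 : Set S) ∈ 𝓝 (0 : S) :=
  I.2.mem_nhds I.1.zero_mem

theorem t2Space_of_separated : T2Space S := by
  apply IsTopologicalAddGroup.t2Space_of_zero_sep
  intro x hx
  by_contra! h
  exact hx (eq_of_sub_mem fun I => by simpa using h _ I.mem_nhds)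

attribute [local instance] t2Space_of_separated

/-- Zero-convergent families are summable. -/
theorem IsZeroConvergent.summable {X : Type*} {s : X → S} (hs : IsZeroConvergent s) :
    Summable s := by
  classical
  let F : OpenLeftIdeal S → Finset X := fun I => (hs I).toFinset
  have hF : ∀ (I : OpenLeftIdeal S) (A B : Finset X), F I ⊆ A → F I ⊆ B →
      ∑ x ∈ A, s x - ∑ x ∈ B, s x ∈ I.1 := by
    intro I A B hA hB
    have key : ∀ A : Finset X, F I ⊆ A → ∑ x ∈ A, s x - ∑ x ∈ F I, s x ∈ I.1 := by
      intro A hA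
      rw [← Finset.sum_sdiff hA, add_sub_cancel_right]
      refine I.1.sum_mem fun x hx => ?_
      have := (Finset.mem_sdiff.1 hx).2
      simpa [F] using this
    simpa using I.1.sub_mem (key A hA) (key B hB)
  obtain ⟨a, ha⟩ := IsCompleteSeparated.complete (S := S)
    ⟨fun I => I.1.mkQ (∑ x ∈ F I, s x), by
      intro I J h
      refine (Submodule.Quotient.eq J.1).2 (hF J _ _ ?_ subset_rfl)
      intro x hx
      have hx' : s x ∉ J.1 := by simpa [F] using hx
      have : s x ∉ I.1 := fun h' => hx' (h h')
      simpa [F] using this⟩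
  refine ⟨a, ?_⟩
  have ha' : ∀ I : OpenLeftIdeal S, a - ∑ x ∈ F I, s x ∈ I.1 := fun I =>
    (Submodule.Quotient.eq I.1).1 (congrFun (congrArg Subtype.val ha) I)
  rw [HasSum, SummationFilter.unconditional_filter, ← tendsto_sub_nhds_zero_iff]
  intro U hU
  obtain ⟨I, hI⟩ := exists_openLeftIdeal hU
  rw [Filter.mem_map]
  filter_upwards [Filter.eventually_ge_atTop (F I)] with A hA
  apply hI
  have := I.1.sub_mem (hF I A (F I) hA subset_rfl) (ha' I)
  simpa using this

theorem tsum_mem {X : Type*} {s : X → S} (I : OpenLeftIdeal S) (h : ∀ x, s x ∈ I.1) :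
    ∑' x, s x ∈ I.1 := by
  have hc : IsClosed (I.1 : Set S) := AddSubgroup.isClosed_of_isOpen I.1.toAddSubgroup I.2
  by_cases hs : Summable s
  · exact hc.mem_of_tendsto hs.hasSum (Filter.Eventually.of_forall fun A => I.1.sum_mem fun x _ => h x)
  · rw [tsum_eq_zero_of_not_summable hs]
    exact I.1.zero_mem

/-- Summation along the fibres of a map of index sets. -/
theorem tsum_fiber_mul {Z W : Type*} {T : Z → S} (hT : IsZeroConvergent T) (g : Z → W)
    (c : W → S) :
    ∑' w, c w * ∑' z : {z // g z = w}, T z = ∑' z, c (g z) * T z := by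
  have h1 : ∀ w, Summable fun z : {z // g z = w} => T z := fun w =>
    (hT.comp_injective Subtype.val_injective).summable
  have h2 : IsZeroConvergent fun z => c (g z) * T z := hT.mul_left _
  rw [← (Equiv.sigmaFiberEquiv g).tsum_eq (fun z => c (g z) * T z),
    Summable.tsum_sigma']
  · refine tsum_congr fun w => ?_
    rw [← (h1 w).tsum_mul_left]
    refine tsum_congr fun z => ?_
    obtain ⟨z, rfl⟩ := z
    rfl
  · exact fun w => (h2.comp_injective (g := fun z : {z // g z = w} => z.1)
      Subtype.val_injective).summable
  · exact (h2.comp_injective (Equiv.sigmaFiberEquiv g).injective).summable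

theorem eventually_mul_mem (I : OpenLeftIdeal S) (t : S) :
    ∃ J : OpenLeftIdeal S, ∀ r ∈ J.1, r * t ∈ I.1 := by
  have : (fun r : S => r * t) ⁻¹' (I.1 : Set S) ∈ 𝓝 (0 : S) := by
    apply (continuous_mul_const t).continuousAt
    simpa using I.mem_nhds
  obtain ⟨J, hJ⟩ := exists_openLeftIdeal this
  exact ⟨J, fun r hr => hJ hr⟩

/-- The double family `z_x t_z` converges to zero. -/
theorem isZeroConvergent_double {X Z : Type*} {T : Z → S} (hT : IsZeroConvergent T)
    {c : Z → X → S} (hc : ∀ z, IsZeroConvergent (c z)) :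
    IsZeroConvergent (fun p : Z × X => c p.1 p.2 * T p.1) := by
  intro I
  choose J hJ using fun z => eventually_mul_mem I (T z)
  refine ((hT I).biUnion (t := fun z => (fun x => (z, x)) '' {x | c z x ∉ (J z).1})
    fun z _ => (hc z (J z)).image _).subset ?_
  rintro ⟨z, x⟩ h
  simp only [Set.mem_ofPred_eq] at h
  simp only [Set.mem_iUnion]
  refine ⟨z, fun hz => h (I.1.smul_mem _ hz), x, fun hx => h (hJ z _ hx), rfl⟩

theorem tsum_double_comm {X Z : Type*} {T : Z → S} (hT : IsZeroConvergent T)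
    {c : Z → X → S} (hc : ∀ z, IsZeroConvergent (c z)) :
    ∑' x, ∑' z, c z x * T z = ∑' z, (∑' x, c z x) * T z := by
  have h := isZeroConvergent_double hT hc
  rw [Summable.tsum_comm' (f := fun z x => c z x * T z) h.summable
    (fun z => (h.comp_injective (Prod.mk_right_injective z)).summable)
    (fun x => (hT.mul_left _).summable)]
  exact tsum_congr fun z => (hc z).summable.tsum_mul_right _

/-! ### The monad `X ↦ [[X]]S` -/

/-- The map `[[f]]S : [[X]]S → [[Y]]S` induced by a map of sets `f : X → Y`. -/
def zeroMap {X Y : Type u} (f : X → Y) : ZeroFamilies S X →+ ZeroFamilies S Y where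
  toFun s := ⟨fun y => ∑' x : {x // f x = y}, s.1 x, fun I => by
    refine ((s.2 I).image f).subset fun y hy => ?_
    by_contra h
    refine hy (tsum_mem I fun x => ?_)
    by_contra hx
    exact h ⟨x, hx, x.2⟩⟩
  map_zero' := Subtype.ext (funext fun y => by simp)
  map_add' s t := Subtype.ext (funext fun y =>
    Summable.tsum_add (s.2.comp_injective Subtype.val_injective).summable
      (t.2.comp_injective Subtype.val_injective).summable)

open Classical in
/-- The "point measure" map `ε_X : X → [[X]]S`. -/
def zeroUnit {X : Type u} (x : X) : ZeroFamilies S X :=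
  ⟨Pi.single x 1, fun I => (Set.finite_singleton x).subset fun y hy => by
    by_contra h
    refine hy ?_
    rw [Pi.single_eq_of_ne h]
    exact I.1.zero_mem⟩

theorem zeroUnit_self {X : Type u} (x : X) : (zeroUnit (S := S) x).1 x = 1 := by
  simp [zeroUnit]

theorem zeroUnit_of_ne {X : Type u} {x y : X} (h : y ≠ x) : (zeroUnit (S := S) x).1 y = 0 := by
  classical
  simp [zeroUnit, Pi.single_eq_of_ne h]

/-- The "opening of parentheses" map `φ_X : [[[[X]]S]]S → [[X]]S`. -/
def zeroJoin {X : Type u} : ZeroFamilies S (ZeroFamilies S X) →+ ZeroFamilies S X where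
  toFun T := ⟨fun x => ∑' z : ZeroFamilies S X, z.1 x * T.1 z, fun I => by
    refine ((isZeroConvergent_double T.2 (c := fun z => z.1) (fun z => z.2) I).image
      Prod.snd).subset fun x hx => ?_
    by_contra h
    refine hx (tsum_mem I fun z => ?_)
    by_contra hz
    exact h ⟨(z, x), hz, rfl⟩⟩
  map_zero' := Subtype.ext (funext fun y => by simp)
  map_add' s t := Subtype.ext (funext fun y => by
    change ∑' z : ZeroFamilies S X, z.1 y * (s.1 z + t.1 z) = _
    simp only [mul_add]
    exact Summable.tsum_add (s.2.mul_left _).summable (t.2.mul_left _).summable)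

theorem zeroMap_id {X : Type u} (s : ZeroFamilies S X) : zeroMap id s = s := by
  apply Subtype.ext
  funext y
  change ∑' x : {x // id x = y}, s.1 x = s.1 y
  have : Unique {x // id x = y} := ⟨⟨⟨y, rfl⟩⟩, fun x => Subtype.ext x.2⟩
  rw [tsum_eq_single (⟨y, rfl⟩ : {x // id x = y}) (fun b hb => absurd (Subsingleton.elim _ _) hb)]

theorem zeroMap_comp {X Y Z : Type u} (f : X → Y) (g : Y → Z) (s : ZeroFamilies S X) :
    zeroMap (g ∘ f) s = zeroMap g (zeroMap f s) := by
  classical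
  apply Subtype.ext
  funext z
  have h1 := tsum_fiber_mul s.2 f (fun y => if g y = z then 1 else 0)
  have h2 := tsum_fiber_mul s.2 (g ∘ f) (fun y => if y = z then 1 else 0)
  have h3 := tsum_fiber_mul (zeroMap f s).2 g (fun y => if y = z then 1 else 0)
  simp only [ite_mul, one_mul, zero_mul, tsum_ite_eq] at h1 h2 h3
  change ∑' x : {x // (g ∘ f) x = z}, s.1 x = ∑' y : {y // g y = z}, (zeroMap f s).1 y
  rw [h2, h3]
  exact h1.symm

theorem zeroMap_unit {X Y : Type u} (f : X → Y) (x : X) :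
    zeroMap f (zeroUnit (S := S) x) = zeroUnit (f x) := by
  classical
  apply Subtype.ext
  funext y
  have h := tsum_fiber_mul (zeroUnit (S := S) x).2 f (fun z => if z = y then 1 else 0)
  simp only [ite_mul, one_mul, zero_mul, tsum_ite_eq] at h
  change ∑' x' : {x' // f x' = y}, (zeroUnit (S := S) x).1 x' = _
  rw [h, tsum_eq_single x]
  · simp only [zeroUnit, Pi.single_eq_same, Pi.single_apply]
    congr 1
    exact propext eq_comm
  · intro b hb
    simp [zeroUnit_of_ne hb]

theorem zeroJoin_unit {X : Type u} (s : ZeroFamilies S X) : zeroJoin (zeroUnit s) = s := by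
  apply Subtype.ext
  funext x
  change ∑' z : ZeroFamilies S X, z.1 x * (zeroUnit (S := S) s).1 z = s.1 x
  rw [tsum_eq_single s]
  · simp [zeroUnit_self]
  · intro b hb
    simp [zeroUnit_of_ne hb]

theorem zeroJoin_map_apply {X Y : Type u} (g : Y → ZeroFamilies S X) (s : ZeroFamilies S Y)
    (x : X) : (zeroJoin (zeroMap g s)).1 x = ∑' y, (g y).1 x * s.1 y :=
  tsum_fiber_mul s.2 g (fun z => z.1 x)

theorem zeroJoin_map_unit {X : Type u} (s : ZeroFamilies S X) :
    zeroJoin (zeroMap zeroUnit s) = s := by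
  apply Subtype.ext
  funext x
  rw [zeroJoin_map_apply, tsum_eq_single x]
  · simp [zeroUnit_self]
  · intro b hb
    simp [zeroUnit_of_ne hb.symm]

theorem zeroJoin_naturality {X Y : Type u} (f : X → Y)
    (T : ZeroFamilies S (ZeroFamilies S X)) :
    zeroJoin (zeroMap (zeroMap f) T) = zeroMap f (zeroJoin T) := by
  apply Subtype.ext
  funext y
  rw [zeroJoin_map_apply]
  exact (tsum_double_comm T.2 (c := fun z (x : {x // f x = y}) => z.1 x.1)
    (fun z => z.2.comp_injective Subtype.val_injective)).symm

theorem zeroJoin_assoc {X : Type u}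
    (T : ZeroFamilies S (ZeroFamilies S (ZeroFamilies S X))) :
    zeroJoin (zeroMap zeroJoin T) = zeroJoin (zeroJoin T) := by
  apply Subtype.ext
  funext x
  rw [zeroJoin_map_apply]
  have h := tsum_double_comm T.2 (c := fun w (z : ZeroFamilies S X) => z.1 x * w.1 z)
    (fun w => w.2.mul_left _)
  refine h.symm.trans (tsum_congr fun z => ?_)
  change ∑' w : ZeroFamilies S (ZeroFamilies S X), z.1 x * w.1 z * T.1 w =
    z.1 x * ∑' w : ZeroFamilies S (ZeroFamilies S X), w.1 z * T.1 w
  rw [← (T.2.mul_left _).summable.tsum_mul_left]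
  exact tsum_congr fun w => mul_assoc _ _ _

variable (S) in
/-- The monad `X ↦ [[X]]S` on the category of sets. -/
def contraMonad : Monad (Type u) where
  obj X := ZeroFamilies S X
  map f := ↾(zeroMap f)
  map_id X := by refine ConcreteCategory.hom_ext _ _ fun s => ?_; exact zeroMap_id s
  map_comp f g := by refine ConcreteCategory.hom_ext _ _ fun s => ?_; exact zeroMap_comp f g s
  η := { app X := ↾zeroUnit
         naturality X Y f := by
           refine ConcreteCategory.hom_ext _ _ fun x => ?_; exact (zeroMap_unit (S := S) f x).symm }
  μ := { app X := ↾zeroJoin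
         naturality X Y f := by
           refine ConcreteCategory.hom_ext _ _ fun T => ?_; exact zeroJoin_naturality f T }
  assoc X := by refine ConcreteCategory.hom_ext _ _ fun T => ?_; exact zeroJoin_assoc T
  left_unit X := by refine ConcreteCategory.hom_ext _ _ fun s => ?_; exact zeroJoin_unit s
  right_unit X := by refine ConcreteCategory.hom_ext _ _ fun s => ?_; exact zeroJoin_map_unit s

/-! ### Right contramodules -/

variable (S) in
/-- The category of right `S`-contramodules: modules over the monad `X ↦ [[X]]S`. -/
abbrev Contramodule : Type (u + 1) := (contraMonad S).Algebra

variable (S) in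
/-- The free right `S`-contramodule `[[X]]S` spanned by a set `X`. -/
abbrev freeContramodule (X : Type u) : Contramodule S := (contraMonad S).free.obj X

/-- The contraaction map `π : [[C]]S → C`. -/
def Contramodule.act (C : Contramodule S) (s : ZeroFamilies S C.A) : C.A :=
  (C.a : (contraMonad S).obj C.A ⟶ C.A) s

theorem Contramodule.act_unit (C : Contramodule S) (c : C.A) : C.act (zeroUnit c) = c :=
  ConcreteCategory.congr_hom C.unit c

theorem Contramodule.act_join (C : Contramodule S) (T : ZeroFamilies S (ZeroFamilies S C.A)) :
    C.act (zeroJoin T) = C.act (zeroMap C.act T) :=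
  ConcreteCategory.congr_hom C.assoc T

/-! The addition of a contramodule is `c + d = π (1 c + 1 d)`, and likewise for the other
operations. -/

section AddGroup

variable (C : Contramodule S)

local instance : Zero C.A := ⟨C.act 0⟩
local instance : Add C.A := ⟨fun c d => C.act (zeroUnit c + zeroUnit d)⟩
local instance : Neg C.A := ⟨fun c => C.act (-zeroUnit c)⟩
local instance : Sub C.A := ⟨fun c d => C.act (zeroUnit c - zeroUnit d)⟩
local instance : SMul ℕ C.A := ⟨fun n c => C.act (n • zeroUnit c)⟩
local instance : SMul ℤ C.A := ⟨fun n c => C.act (n • zeroUnit c)⟩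

/-- The underlying abelian group of a contramodule. -/
instance Contramodule.addCommGroup : AddCommGroup C.A :=
  Function.Surjective.addCommGroup C.act (fun c => ⟨zeroUnit c, C.act_unit c⟩) rfl
    (fun s t => by
      have h := C.act_join (zeroUnit s + zeroUnit t)
      rwa [map_add, map_add, zeroJoin_unit, zeroJoin_unit, zeroMap_unit, zeroMap_unit] at h)
    (fun s => by
      have h := C.act_join (-zeroUnit s)
      rwa [map_neg, map_neg, zeroJoin_unit, zeroMap_unit] at h)
    (fun s t => by
      have h := C.act_join (zeroUnit s - zeroUnit t)
      rwa [map_sub, map_sub, zeroJoin_unit, zeroJoin_unit, zeroMap_unit, zeroMap_unit] at h)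
    (fun s n => by
      have h := C.act_join (n • zeroUnit s)
      rwa [map_nsmul, map_nsmul, zeroJoin_unit, zeroMap_unit] at h)
    (fun s n => by
      have h := C.act_join (n • zeroUnit s)
      rwa [map_zsmul, map_zsmul, zeroJoin_unit, zeroMap_unit] at h)

end AddGroup

end Ring

/-! ### Discrete modules and the contratensor product -/

section Discrete

/-- A left module over a topological ring is discrete if the annihilator of each of its elements
is an open left ideal. -/
class IsDiscreteModule (S : Type*) [Ring S] [TopologicalSpace S] (M : Type*) [AddCommGroup M]
    [Module S M] : Prop where
  isOpen_annihilator : ∀ b : M, IsOpen (Ideal.torsionOf S M b : Set S)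

variable {S : Type u} [Ring S] [TopologicalSpace S] [IsCompleteSeparated S] [IsTopologicalRing S]
  [IsLinearTopology S S]

/-- The value `∑ c ⊗ s_c b` of the map `t : [[C]]S ⊗ M → C ⊗ M` on `(∑ c s_c) ⊗ b`; only finitely
many summands are nonzero when `M` is discrete. -/
def contratensorSum (C : Contramodule S) (M : Type u) [AddCommGroup M] [Module S M]
    (s : ZeroFamilies S C.A) (b : M) : C.A ⊗[ℤ] M :=
  ∑ᶠ c : C.A, c ⊗ₜ[ℤ] (s.1 c • b)

/-- The image of the difference of the two maps `t, π ⊗ M : [[C]]S ⊗ M → C ⊗ M`, which is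
generated by the images of the pure tensors. -/
def contratensorRel (C : Contramodule S) (M : Type u) [AddCommGroup M] [Module S M] :
    AddSubgroup (C.A ⊗[ℤ] M) :=
  AddSubgroup.closure
    {x | ∃ (s : ZeroFamilies S C.A) (b : M), x = contratensorSum C M s b - C.act s ⊗ₜ[ℤ] b}

/-- The contratensor product of a right contramodule and a discrete left module. -/
abbrev Contratensor (C : Contramodule S) (M : Type u) [AddCommGroup M] [Module S M] : Type u :=
  (C.A ⊗[ℤ] M) ⧸ contratensorRel C M

theorem finite_smul_ne_zero (C : Contramodule S) (M : Type u) [AddCommGroup M] [Module S M]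
    [IsDiscreteModule S M] (s : ZeroFamilies S C.A) (b : M) : {c | s.1 c • b ≠ 0}.Finite :=
  s.2 ⟨Ideal.torsionOf S M b, IsDiscreteModule.isOpen_annihilator b⟩

/-- The map of contratensor products induced by a homomorphism of discrete left modules. -/
def contratensorMap (C : Contramodule S) {M N : Type u} [AddCommGroup M] [Module S M]
    [IsDiscreteModule S M] [AddCommGroup N] [Module S N] (f : M →ₗ[S] N) :
    Contratensor C M →+ Contratensor C N :=
  QuotientAddGroup.map _ _ (TensorProduct.map LinearMap.id f.toAddMonoidHom.toIntLinearMap :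
    C.A ⊗[ℤ] M →ₗ[ℤ] C.A ⊗[ℤ] N).toAddMonoidHom (by
      rw [contratensorRel, AddSubgroup.closure_le]
      rintro _ ⟨s, b, rfl⟩
      refine AddSubgroup.subset_closure ⟨s, f b, ?_⟩
      rw [map_sub, contratensorSum, AddMonoidHom.map_finsum]
      · simp [contratensorSum]
      · refine (finite_smul_ne_zero C M s b).subset fun c hc h => hc ?_
        simp [h])

/-- A right contramodule is flat if its contratensor product functor is exact on the category of
discrete left modules. -/
def IsFlat (C : Contramodule S) : Prop :=
  ∀ (K L N : Type u) [AddCommGroup K] [AddCommGroup L] [AddCommGroup N]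
    [Module S K] [Module S L] [Module S N]
    [IsDiscreteModule S K] [IsDiscreteModule S L] [IsDiscreteModule S N]
    (f : K →ₗ[S] L) (g : L →ₗ[S] N),
    Function.Injective f → Function.Exact f g → Function.Surjective g →
    Function.Injective (contratensorMap C f) ∧
      Function.Exact (contratensorMap C f) (contratensorMap C g) ∧
      Function.Surjective (contratensorMap C g)

/-- The finitely generated projective contramodules: direct summands of free contramodules
spanned by finite sets. -/
def IsFGProjective (C : Contramodule S) : Prop :=
  ∃ X : Type u, Finite X ∧ Nonempty (Retract C (freeContramodule S X))

end Discrete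

/-! ### Direct limits -/

/-- The class of all objects of `B` which are direct limits, computed in `B`, of direct systems of
objects from the class `P` indexed by directed posets. -/
def DirectLimits {B : Type (u + 1)} [Category.{u} B] (P : B → Prop) (X : B) : Prop :=
  ∃ (I : Type u) (_ : PartialOrder I) (_ : IsDirectedOrder I) (_ : Nonempty I) (D : I ⥤ B)
    (c : Cocone D), (∀ i, P (D.obj i)) ∧ Nonempty (IsColimit c) ∧ Nonempty (c.pt ≅ X)

/-- All flat contramodules are direct limits of projective contramodules, and conversely. -/
def CGL1 (S : Type u) [Ring S] [TopologicalSpace S] [IsCompleteSeparated S]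
    [IsTopologicalRing S] [IsLinearTopology S S] : Prop :=
  ∀ F : Contramodule S, IsFlat F ↔ DirectLimits (fun P : Contramodule S => Projective P) F

/-- The direct limits of projective contramodules coincide with the direct limits of finitely
generated projective contramodules. -/
def CGL2 (S : Type u) [Ring S] [TopologicalSpace S] [IsCompleteSeparated S]
    [IsTopologicalRing S] [IsLinearTopology S S] : Prop :=
  ∀ F : Contramodule S, DirectLimits (fun P : Contramodule S => Projective P) F ↔
    DirectLimits (fun P : Contramodule S => IsFGProjective P) F

/-! ### Gabriel topologies and the Artin–Rees property -/

/-- A class of modules is a torsion class if it is closed under direct sums, epimorphic images,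
and extensions. -/
structure IsTorsionClass {A : Type (u + 1)} [Category.{u} A] [Abelian A]
    (T : ObjectProperty A) : Prop where
  directSums : ∀ J : Type u, T.IsClosedUnderColimitsOfShape (Discrete J)
  quotients : T.IsClosedUnderQuotients
  extensions : T.IsClosedUnderExtensions

/-- A left linear topology on `S` is a (left) Gabriel topology if the discrete left `S`-modules
form a torsion class. -/
def IsGabriel (S : Type u) [Ring S] [TopologicalSpace S] : Prop :=
  IsTorsionClass fun M : ModuleCat.{u} S => IsDiscreteModule S M

/-- The left Artin–Rees property of a two-sided ideal. -/
def HasArtinRees {S : Type u} [Ring S] (J : Ideal S) : Prop :=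
  ∀ (M : Type u) [AddCommGroup M] [Module S M] [Module.Finite S M] (N : Submodule S M),
    ∃ m : ℕ, 0 < m ∧ J ^ m • (⊤ : Submodule S M) ⊓ N ≤ J • N

/-- The topology of `S` has a countable base of neighborhoods of zero consisting of two-sided
ideals having the left Artin–Rees property. -/
def HasCountableArtinReesBase (S : Type u) [Ring S] [TopologicalSpace S] : Prop :=
  ∃ B : Set (Ideal S), B.Countable ∧ (∀ J ∈ B, J.IsTwoSided ∧ HasArtinRees J) ∧
    (𝓝 (0 : S)).HasBasis (fun J : Ideal S => J ∈ B) (fun J => (J : Set S))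

/-! ### The classes `add M`, `Add M` and the finite topology -/

section Modules

variable (R : Type u) [Ring R] (M : Type u) [AddCommGroup M] [Module Rᵐᵒᵖ M]

/-- `Add M`: the direct summands of direct sums of copies of the right `R`-module `M`. -/
def IsAdd (N : ModuleCat.{u} Rᵐᵒᵖ) : Prop :=
  ∃ X : Type u, Nonempty (Retract N (ModuleCat.of Rᵐᵒᵖ (X →₀ M)))

/-- `add M`: the direct summands of finite direct sums of copies of the right `R`-module `M`. -/
def IsFinAdd (N : ModuleCat.{u} Rᵐᵒᵖ) : Prop :=
  ∃ X : Type u, Finite X ∧ Nonempty (Retract N (ModuleCat.of Rᵐᵒᵖ (X →₀ M)))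

/-- The finite topology on the endomorphism ring of a right module, i.e. the topology of pointwise
convergence for the discrete topology on `M`. -/
@[reducible]
def finiteTopology : TopologicalSpace (Module.End Rᵐᵒᵖ M) :=
  TopologicalSpace.induced (fun f (x : M) => f x) (@Pi.topologicalSpace M (fun _ => M) fun _ => ⊥)

/-- The annihilators of finitely generated submodules of `M` form a base of neighborhoods of zero
in the finite topology. -/
theorem finiteTopology_hasBasis :
    (@nhds _ (finiteTopology R M) (0 : Module.End Rᵐᵒᵖ M)).HasBasis
      (fun N : Submodule Rᵐᵒᵖ M => N.FG) (fun N => {f | ∀ x ∈ N, f x = 0}) := by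
  letI : TopologicalSpace M := ⊥
  haveI : DiscreteTopology M := ⟨rfl⟩
  letI := finiteTopology R M
  have h : 𝓝 (0 : Module.End Rᵐᵒᵖ M) =
      Filter.comap (fun (f : Module.End Rᵐᵒᵖ M) (x : M) => f x) (𝓝 fun _ => 0) :=
    nhds_induced _ _
  rw [h, nhds_pi, Filter.hasBasis_iff]
  intro U
  simp only [nhds_discrete, Filter.mem_comap, Filter.mem_pi]
  constructor
  · rintro ⟨t, ⟨F, hF, V, hV, hVt⟩, ht⟩
    refine ⟨Submodule.span _ F, ⟨hF.toFinset, by simp⟩, fun f hf => ht (hVt fun x hx => ?_)⟩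
    change f x ∈ V x
    rw [hf x (Submodule.subset_span hx)]
    exact hV x
  · rintro ⟨N, ⟨F, rfl⟩, hU⟩
    refine ⟨(F : Set M).pi fun _ => {0}, ⟨F, F.finite_toSet, fun _ => {0}, fun _ => by simp,
      subset_rfl⟩, fun f hf => hU fun x hx => ?_⟩
    have : Submodule.span Rᵐᵒᵖ (F : Set M) ≤ LinearMap.ker f :=
      Submodule.span_le.2 fun y hy => by simpa using hf y hy
    exact this hx

end Modules

end

end Contra

/-! Write `T` for the complete ring and `S` for its dense left noetherian subring. The main point is
that a flat right `T`-contramodule `F` is flat as a right `S`-module; a Govorov–Lazard argument then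
presents `F` as a direct limit of finitely generated free contramodules.

Flatness over `S` is checked by the equational criterion. Let `x` be a row in `F` with `x C = 0`,
and let the rows of `B` generate the left syzygies of `C`. Flatness against modules over the
quotients of `T` by open two-sided ideals, together with the Artin–Rees property for the image of
`C`, shows that `x` agrees with some `w B` up to a small error (`flat_exists_approx`). The
Artin–Rees property for the syzygy module makes `w` small when `x` is small, so the corrections form
a convergent series (`flat_exists_of_forall_exists`). The remaining error lies in the intersection
of all `F J_k`. The same approximation combined with a contramodule Nakayama lemma shows that this
intersection vanishes (`flat_separated`). The Gabriel condition makes products of open ideals open,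
which turns the algebraic Artin–Rees property into a topological one.

Nakayama also shows that additive `S`-linear maps between contramodules commute with infinite sums
(`map_act_of_map_smul`), so restriction to `S` is fully faithful. Hence `F` corepresents `C ↦
Hom_S(F, C)`, while the free contramodule of rank `n` corepresents `C ↦ C^n`. The category of finite
rows in `F` is filtered by flatness, and its diagram of free contramodules has colimit `F`.

Conversely, direct limits of projectives are flat: contratensoring a free contramodule with a
discrete module gives a direct sum, and the contratensor product is a left adjoint, while directed
colimits of abelian groups are exact.

For part (2), put `H = Hom_R(M, -)`, with values in right `S`-modules. A map from `M` to a direct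
sum of copies of `M` is a zero-convergent family of endomorphisms, so `H` sends such sums to flat
modules and is fully faithful on maps out of them. A direct limit `N` of objects of `Add M`
therefore corepresents `Y ↦ Hom_S(F, H Y)` for the flat module `F = colim H(D_i)`, and the same
Govorov–Lazard argument presents `N` as a direct limit of the modules `M^n`. -/

namespace Contra

/-! ### Equational flatness and an abstract Govorov–Lazard theorem. -/

section Lazard

open MulOpposite

variable {S : Type u} [Ring S]

/-- The product of a row of elements of a right module with a matrix over the ring. -/
def rowMul {F : Type*} [AddCommGroup F] [Module Sᵐᵒᵖ F] {m n : Type*} [Fintype m]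
    (x : m → F) (C : Matrix m n S) : n → F :=
  fun j => ∑ i, op (C i j) • x i

section RowMul

variable {F G : Type*} [AddCommGroup F] [Module Sᵐᵒᵖ F] [AddCommGroup G] [Module Sᵐᵒᵖ G]
  {l m n : Type*} [Fintype l] [Fintype m]

theorem rowMul_apply (x : m → F) (C : Matrix m n S) (j : n) :
    rowMul x C j = ∑ i, op (C i j) • x i := rfl

theorem rowMul_rowMul (x : l → F) (B : Matrix l m S) (C : Matrix m n S) :
    rowMul (rowMul x B) C = rowMul x (B * C) := by
  funext j
  simp only [rowMul_apply, Finset.smul_sum, Matrix.mul_apply, Finset.op_sum, Finset.sum_smul,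
    smul_smul, op_mul]
  exact Finset.sum_comm

theorem rowMul_one [DecidableEq m] (x : m → F) : rowMul x (1 : Matrix m m S) = x := by
  funext j
  rw [rowMul_apply, Finset.sum_eq_single j] <;> simp +contextual

theorem rowMul_zero (x : m → F) : rowMul x (0 : Matrix m n S) = 0 := by
  funext j
  simp [rowMul_apply]

theorem zero_rowMul (C : Matrix m n S) : rowMul (0 : m → F) C = 0 := by
  funext j
  simp [rowMul_apply]

theorem rowMul_sub (x : m → F) (B C : Matrix m n S) :
    rowMul x (B - C) = rowMul x B - rowMul x C := by
  funext j
  simp [rowMul_apply, sub_smul]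

theorem sub_rowMul (x y : m → F) (C : Matrix m n S) :
    rowMul (x - y) C = rowMul x C - rowMul y C := by
  funext j
  simp [rowMul_apply, smul_sub]

theorem add_rowMul (x y : m → F) (C : Matrix m n S) :
    rowMul (x + y) C = rowMul x C + rowMul y C := by
  funext j
  simp [rowMul_apply, Finset.sum_add_distrib]

theorem map_rowMul (f : F →ₗ[Sᵐᵒᵖ] G) (x : m → F) (C : Matrix m n S) :
    (fun j => f (rowMul x C j)) = rowMul (fun i => f (x i)) C := by
  funext j
  simp [rowMul_apply]

/-- The matrix that selects the entries of a row along a map of index sets. -/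
def selectMatrix (S : Type u) [Ring S] [DecidableEq m] (g : n → m) : Matrix m n S :=
  fun i j => if i = g j then 1 else 0

theorem rowMul_selectMatrix [DecidableEq m] (x : m → F) (g : n → m) :
    rowMul x (selectMatrix S g) = fun j => x (g j) := by
  funext j
  rw [rowMul_apply, Finset.sum_eq_single (g j)] <;> simp +contextual [selectMatrix]

end RowMul

variable (S) in
/-- The equational criterion of flatness for a right module. -/
def IsEquationallyFlat (F : Type*) [AddCommGroup F] [Module Sᵐᵒᵖ F] : Prop :=
  ∀ (m n : ℕ) (C : Matrix (Fin m) (Fin n) S) (x : Fin m → F), rowMul x C = 0 →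
    ∃ (q : ℕ) (B : Matrix (Fin q) (Fin m) S) (w : Fin q → F), B * C = 0 ∧ x = rowMul w B

theorem IsEquationallyFlat.of_retract {F G : Type*} [AddCommGroup F] [Module Sᵐᵒᵖ F]
    [AddCommGroup G] [Module Sᵐᵒᵖ G] (hG : IsEquationallyFlat S G) (i : F →ₗ[Sᵐᵒᵖ] G)
    (r : G →ₗ[Sᵐᵒᵖ] F) (h : ∀ x, r (i x) = x) : IsEquationallyFlat S F := by
  intro m n C x hx
  obtain ⟨q, B, w, hB, hw⟩ := hG m n C (fun k => i (x k)) (by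
    rw [← map_rowMul, hx]
    funext j
    simp)
  refine ⟨q, B, fun k => r (w k), hB, ?_⟩
  rw [← map_rowMul, ← hw]
  simp [h]

/-- The rows of elements of a right module, as the objects of a category. -/
structure RowCat (S : Type u) [Ring S] (F : Type u) where
  /-- The length of the row. -/
  length : ℕ
  /-- The entries of the row. -/
  row : Fin length → F

/-- The morphisms of rows are the matrices that express one row through another. -/
@[ext]
structure RowCat.Hom {F : Type u} [AddCommGroup F] [Module Sᵐᵒᵖ F] (a b : RowCat S F) where
  /-- The matrix. -/
  matrix : Matrix (Fin b.length) (Fin a.length) S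
  row_eq : a.row = rowMul b.row matrix

instance RowCat.category (F : Type u) [AddCommGroup F] [Module Sᵐᵒᵖ F] :
    SmallCategory (RowCat S F) where
  Hom a b := RowCat.Hom a b
  id a := ⟨1, (rowMul_one _).symm⟩
  comp {a b c} f g := ⟨g.1 * f.1, by rw [← rowMul_rowMul, ← g.2, ← f.2]⟩
  id_comp f := RowCat.Hom.ext (Matrix.mul_one _)
  comp_id f := RowCat.Hom.ext (Matrix.one_mul _)
  assoc f g h := RowCat.Hom.ext (Matrix.mul_assoc _ _ _).symm

variable {F : Type u} [AddCommGroup F] [Module Sᵐᵒᵖ F]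

/-- Two rows are dominated by their concatenation. Two parallel matrices differ by a relation on the
target row, and flatness factors that row through a matrix killing the relation. This is the only
use of flatness in the Govorov–Lazard argument. -/
theorem RowCat.isFiltered (hF : IsEquationallyFlat S F) : IsFiltered (RowCat S F) where
  nonempty := ⟨⟨0, Fin.elim0⟩⟩
  cocone_objs a b := by
    refine ⟨⟨a.length + b.length, Fin.append a.row b.row⟩,
      ⟨selectMatrix S (Fin.castAdd _), ?_⟩, ⟨selectMatrix S (Fin.natAdd _), ?_⟩, trivial⟩ <;>
    · rw [rowMul_selectMatrix]
      simp
  cocone_maps a b f g := by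
    obtain ⟨q, B, w, hB, hw⟩ := hF _ _ (f.1 - g.1) b.row (by
      rw [rowMul_sub, ← f.2, ← g.2, sub_self])
    refine ⟨⟨q, w⟩, ⟨B, hw⟩, RowCat.Hom.ext ?_⟩
    rw [Matrix.mul_sub, sub_eq_zero] at hB
    exact hB

section Corepresented

variable {B : Type (u + 1)} [Category.{u} B] (H : B ⥤ ModuleCat.{u} Sᵐᵒᵖ) (K : ℕ → B)
  (e : ∀ n Y, (K n ⟶ Y) ≃ (Fin n → H.obj Y))
  (he : ∀ (n : ℕ) (Y Z : B) (f : K n ⟶ Y) (g : Y ⟶ Z) (i : Fin n),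
    e n Z (f ≫ g) i = H.map g (e n Y f i))

include he

theorem corepresented_symm_comp {n : ℕ} {Y Z : B} (y : Fin n → H.obj Y) (g : Y ⟶ Z) :
    (e n Y).symm y ≫ g = (e n Z).symm fun i => H.map g (y i) := by
  apply (e n Z).injective
  funext i
  simp [he]

/-- A Yoneda computation: since `K n` corepresents `n`-tuples in `H`, a matrix acting on tuples is
induced by one morphism between the objects `K`. Only this corepresentability is used, so the
argument serves both contramodules and right `R`-modules. -/
theorem corepresented_symm_rowMul {m n : ℕ} {Y : B} (y : Fin m → H.obj Y)
    (C : Matrix (Fin m) (Fin n) S) :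
    (e n Y).symm (rowMul y C) =
      (e n _).symm (rowMul (e m _ (𝟙 (K m))) C) ≫ (e m Y).symm y := by
  rw [corepresented_symm_comp H K e he]
  congr 1
  have := map_rowMul (H.map ((e m Y).symm y)).hom (e m _ (𝟙 (K m))) C
  refine Eq.trans ?_ this.symm
  congr 1
  funext i
  have := he m _ _ (𝟙 (K m)) ((e m Y).symm y) i
  simpa using this

/-- Cocones with vertex `Y` over the diagram of rows are linear maps to `H Y`: rows of length one
give the map of sets, and compatibility with suitable matrices forces linearity. -/
theorem exists_linearMap_of_rows {Y : B} (t : ∀ a : RowCat S F, K a.length ⟶ Y)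
    (ht : ∀ {a b : RowCat S F} (f : RowCat.Hom a b),
      (e _ _).symm (rowMul (e _ _ (𝟙 (K b.length))) f.matrix) ≫ t b = t a) :
    ∃ u : F →ₗ[Sᵐᵒᵖ] H.obj Y, ∀ a : RowCat S F, t a = (e _ _).symm fun i => u (a.row i) := by
  have key : ∀ {a b : RowCat S F} (f : RowCat.Hom a b),
      e _ _ (t a) = rowMul (e _ _ (t b)) f.matrix := by
    intro a b f
    have := corepresented_symm_rowMul H K e he (e _ _ (t b)) f.matrix
    rw [Equiv.symm_apply_apply, ht] at this
    exact (Equiv.eq_symm_apply _).1 this.symm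
  let v : ∀ a : RowCat S F, Fin a.length → H.obj Y := fun a => e _ _ (t a)
  have hv : ∀ {a b : RowCat S F} (f : RowCat.Hom a b), v a = rowMul (v b) f.matrix := key
  -- A selection matrix maps a row of length one into any row containing its entry, so each
  -- component of the cocone depends only on the element of `F` at that place.
  have hsel : ∀ (a : RowCat S F) (i : Fin a.length), v a i = v ⟨1, fun _ => a.row i⟩ 0 := by
    intro a i
    have h := hv (a := ⟨1, fun _ => a.row i⟩) (b := a) ⟨selectMatrix S (fun _ => i), by
      rw [rowMul_selectMatrix]⟩
    rw [h, rowMul_selectMatrix]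
  refine ⟨{ toFun := fun x => v ⟨1, fun _ => x⟩ 0, map_add' := ?_, map_smul' := ?_ }, ?_⟩
  · intro x y
    -- The sum is the product of the row `(x, y)` with a column of ones.
    have h := hv (a := ⟨1, fun _ => x + y⟩) (b := ⟨2, ![x, y]⟩) ⟨fun _ _ => 1, by
      funext j
      simp [rowMul, Fin.sum_univ_two]⟩
    have h0 := hsel ⟨2, ![x, y]⟩ 0
    have h1 := hsel ⟨2, ![x, y]⟩ 1
    rw [h, rowMul_apply]
    simp only [op_one, one_smul]
    exact (Fin.sum_univ_two _).trans (congrArg₂ (· + ·) h0 h1)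
  · intro r x
    have h := hv (a := ⟨1, fun _ => r • x⟩) (b := ⟨1, fun _ => x⟩) ⟨fun _ _ => r.unop, by
      funext j
      simp [rowMul]⟩
    rw [h, rowMul_apply]
    exact Fin.sum_univ_one _
  · intro a
    rw [Equiv.eq_symm_apply]
    funext i
    exact hsel a i

variable (F) in
/-- The diagram of the objects `K n` indexed by the rows of a right module. -/
def rowDiagram : RowCat S F ⥤ B where
  obj a := K a.length
  map {a b} f := (e _ _).symm (rowMul (e _ _ (𝟙 (K b.length))) (RowCat.Hom.matrix f))
  map_id a := by
    change (e _ _).symm (rowMul _ 1) = _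
    rw [rowMul_one, Equiv.symm_apply_apply]
  map_comp {a b c} f g := by
    change (e _ _).symm (rowMul _ (g.1 * f.1)) = _
    rw [← rowMul_rowMul, corepresented_symm_rowMul H K e he]

theorem corepresented_row_comp {Y : B} (u : F →ₗ[Sᵐᵒᵖ] H.obj Y) {a b : RowCat S F}
    (f : RowCat.Hom a b) :
    (e _ _).symm (rowMul (e _ _ (𝟙 (K b.length))) f.matrix) ≫ ((e _ _).symm fun i => u (b.row i)) =
      (e a.length Y).symm fun i => u (a.row i) := by
  have h := corepresented_symm_rowMul H K e he (fun i => u (b.row i)) f.matrix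
  rw [← map_rowMul u, ← f.row_eq] at h
  exact h.symm

/-- The cocone over the diagram of rows given by a linear map. -/
def rowCocone {Y : B} (u : F →ₗ[Sᵐᵒᵖ] H.obj Y) : Cocone (rowDiagram F H K e he) where
  pt := Y
  ι :=
  { app a := (e a.length Y).symm fun i => u (a.row i)
    naturality {_ _} f :=
      (corepresented_row_comp H K e he u f).trans (Category.comp_id _).symm }

/-- A Govorov–Lazard theorem: an object that represents the linear maps out of a flat right module
is a direct limit of the objects representing the free modules. -/
theorem directLimits_of_isEquationallyFlat (hF : IsEquationallyFlat S F) {N : B}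
    (u : F →ₗ[Sᵐᵒᵖ] H.obj N)
    (hu : ∀ (Y : B) (g : F →ₗ[Sᵐᵒᵖ] H.obj Y), ∃! h : N ⟶ Y, ∀ x, H.map h (u x) = g x)
    {P : B → Prop} (hP : ∀ n, P (K n)) : DirectLimits P N := by
  have := RowCat.isFiltered hF
  -- Direct limits are indexed by directed posets; a final functor from such a poset replaces the
  -- filtered category of rows.
  obtain ⟨I, _, _, _, φ, _⟩ := IsFiltered.exists_directed (RowCat S F)
  refine ⟨I, inferInstance, inferInstance, inferInstance, φ ⋙ rowDiagram F H K e he,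
    (rowCocone H K e he u).whisker φ, fun i => hP _, ⟨?_⟩, ⟨Iso.refl _⟩⟩
  refine (Functor.Final.isColimitWhiskerEquiv φ _).symm ?_
  -- Cocones are linear maps `F → H Y`, and these are morphisms `N ⟶ Y` by `hu`.
  have hex : ∀ (Y : B) (t : ∀ a : RowCat S F, K a.length ⟶ Y)
      (_ : ∀ {a b : RowCat S F} (f : RowCat.Hom a b),
        (e _ _).symm (rowMul (e _ _ (𝟙 (K b.length))) f.matrix) ≫ t b = t a),
      ∃! h : N ⟶ Y, ∀ a : RowCat S F, ((e a.length N).symm fun i => u (a.row i)) ≫ h = t a := by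
    intro Y t ht
    obtain ⟨g, hg⟩ := exists_linearMap_of_rows H K e he t ht
    obtain ⟨h, hh, huniq⟩ := hu Y g
    refine ⟨h, fun a => ?_, fun h' hh' => huniq h' fun x => ?_⟩
    · rw [corepresented_symm_comp H K e he, hg]
      simp only [hh]
    · have h1 := hh' ⟨1, fun _ => x⟩
      rw [corepresented_symm_comp H K e he, hg] at h1
      exact congrFun ((e 1 Y).symm.injective h1) 0
  have hex' := fun s : Cocone (rowDiagram F H K e he) => hex s.pt (fun a => s.ι.app a)
    fun f => s.w f
  exact
    { desc := fun s => (hex' s).choose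
      fac := fun s a => (hex' s).choose_spec.1 a
      uniq := fun s m hm => (hex' s).choose_spec.2 m hm }

end Corepresented

end Lazard

/-! ### Infinite sums in contramodules and the calculus of free contramodules. -/

noncomputable section Sums

open MulOpposite

attribute [local instance] t2Space_of_separated

variable {T : Type u} [Ring T] [TopologicalSpace T] [IsCompleteSeparated T]
  [IsTopologicalRing T] [IsLinearTopology T T]

theorem zeroMap_apply {X Y : Type u} (f : X → Y) (s : ZeroFamilies T X) (y : Y)
    [DecidablePred fun x => f x = y] :
    (zeroMap f s).1 y = ∑' x, if f x = y then s.1 x else 0 := by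
  classical
  have h := tsum_fiber_mul s.2 f (fun w => if w = y then 1 else 0)
  simp only [ite_mul, one_mul, zero_mul, tsum_ite_eq] at h
  refine Eq.trans h ?_
  congr!

theorem zeroMap_mk_apply {ι X : Type u} [DecidableEq ι] (i j : ι) (x : X)
    (s : ZeroFamilies T X) : (zeroMap (Prod.mk i) s).1 (j, x) = if i = j then s.1 x else 0 := by
  classical
  rw [zeroMap_apply, tsum_eq_single x]
  · simp
  · intro y hy
    simp [hy]

theorem zeroMap_apply_mem {X Y : Type u} (f : X → Y) (s : ZeroFamilies T X)
    (I : OpenLeftIdeal T) (h : ∀ x, s.1 x ∈ I.1) (y : Y) : (zeroMap f s).1 y ∈ I.1 :=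
  tsum_mem I fun _ => h _

/-- The substitution of zero-convergent families into a zero-convergent family. -/
def zeroBind {X Y : Type u} (t : X → ZeroFamilies T Y) (s : ZeroFamilies T X) :
    ZeroFamilies T Y :=
  zeroJoin (zeroMap t s)

theorem zeroBind_apply {X Y : Type u} (t : X → ZeroFamilies T Y) (s : ZeroFamilies T X) (y : Y) :
    (zeroBind t s).1 y = ∑' x, (t x).1 y * s.1 x :=
  zeroJoin_map_apply t s y

theorem zeroBind_add {X Y : Type u} (t t' : X → ZeroFamilies T Y) (s : ZeroFamilies T X) :
    zeroBind (fun x => t x + t' x) s = zeroBind t s + zeroBind t' s := by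
  apply Subtype.ext
  funext y
  change _ = (zeroBind t s).1 y + (zeroBind t' s).1 y
  simp only [zeroBind_apply]
  rw [← Summable.tsum_add (s.2.mul_left _).summable (s.2.mul_left _).summable]
  exact tsum_congr fun x => add_mul _ _ _

theorem zeroBind_unit {X Y : Type u} (c : X → Y) (s : ZeroFamilies T X) :
    zeroBind (fun x => zeroUnit (c x)) s = zeroMap c s := by
  rw [zeroBind]
  exact (congrArg zeroJoin (zeroMap_comp c zeroUnit s)).trans (zeroJoin_map_unit _)

/-- The one-element family. -/
def zeroConst (r : T) : ZeroFamilies T PUnit.{u + 1} := ⟨fun _ => r, fun _ => Set.toFinite _⟩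

/-- The right multiplication of a zero-convergent family by an element of the ring. -/
def zeroMulRight {X : Type u} (s : ZeroFamilies T X) (r : T) : ZeroFamilies T X :=
  zeroBind (fun _ : PUnit => s) (zeroConst r)

theorem zeroMulRight_apply {X : Type u} (s : ZeroFamilies T X) (r : T) (x : X) :
    (zeroMulRight s r).1 x = s.1 x * r := by
  rw [zeroMulRight, zeroBind_apply, tsum_fintype]
  simp [zeroConst]

/-- The family with one nonzero member. -/
def zeroSingle {X : Type u} (x : X) (r : T) : ZeroFamilies T X :=
  zeroMulRight (zeroUnit x) r

theorem zeroSingle_self {X : Type u} (x : X) (r : T) : (zeroSingle x r).1 x = r := by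
  rw [zeroSingle, zeroMulRight_apply, zeroUnit_self, one_mul]

theorem zeroSingle_of_ne {X : Type u} {x y : X} (r : T) (h : y ≠ x) :
    (zeroSingle x r).1 y = 0 := by
  rw [zeroSingle, zeroMulRight_apply, zeroUnit_of_ne h, zero_mul]

theorem zeroFamilies_sum_apply {ι : Type*} {Y : Type u} (A : Finset ι)
    (s : ι → ZeroFamilies T Y) (y : Y) : (∑ i ∈ A, s i).1 y = ∑ i ∈ A, (s i).1 y := by
  rw [AddSubgroup.val_finsetSum, Finset.sum_apply]

theorem isZeroConvergent_prod {X : Type u} (s : ℕ → ZeroFamilies T X)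
    (h : ∀ I : OpenLeftIdeal T, ∃ n, ∀ i, n ≤ i → ∀ x, (s i).1 x ∈ I.1) :
    IsZeroConvergent fun p : ℕ × X => (s p.1).1 p.2 := by
  intro I
  obtain ⟨n, hn⟩ := h I
  refine ((Finset.range n).finite_toSet.biUnion (t := fun i => Prod.mk i '' {x | (s i).1 x ∉ I.1})
    fun i _ => ((s i).2 I).image _).subset ?_
  rintro ⟨i, x⟩ hx
  simp only [Set.mem_iUnion]
  refine ⟨i, ?_, x, hx, rfl⟩
  by_contra hi
  exact hx (hn i (by simpa using hi) x)

namespace Contramodule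

variable (C : Contramodule T)

theorem act_add (s t : ZeroFamilies T C.A) : C.act (s + t) = C.act s + C.act t := by
  have h := C.act_join (zeroUnit s + zeroUnit t)
  rw [map_add, map_add, zeroJoin_unit, zeroJoin_unit, zeroMap_unit, zeroMap_unit] at h
  exact h

/-- The contraaction map as a group homomorphism. -/
def actHom : ZeroFamilies T C.A →+ C.A := AddMonoidHom.mk' C.act C.act_add

/-- The sum `∑ c_x s_x` of a family of elements of a contramodule with a zero-convergent family of
coefficients. -/
def sum {X : Type u} (c : X → C.A) : ZeroFamilies T X →+ C.A :=
  C.actHom.comp (zeroMap c)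

theorem sum_apply {X : Type u} (c : X → C.A) (s : ZeroFamilies T X) :
    C.sum c s = C.act (zeroMap c s) := rfl

theorem sum_id (s : ZeroFamilies T C.A) : C.sum id s = C.act s := by
  rw [sum_apply, zeroMap_id]

theorem sum_unit {X : Type u} (c : X → C.A) (x : X) : C.sum c (zeroUnit x) = c x := by
  rw [sum_apply, zeroMap_unit, act_unit]

theorem sum_map {X Y : Type u} (c : Y → C.A) (g : X → Y) (s : ZeroFamilies T X) :
    C.sum c (zeroMap g s) = C.sum (fun x => c (g x)) s := by
  rw [sum_apply, ← zeroMap_comp]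
  rfl

/-- The associativity axiom of the contraaction, transported to indexed families: nested infinite
sums may be opened. -/
theorem sum_sum {X Y : Type u} (c : Y → C.A) (t : X → ZeroFamilies T Y) (s : ZeroFamilies T X) :
    C.sum (fun x => C.sum c (t x)) s = C.sum c (zeroBind t s) := by
  have h := C.act_join (zeroMap (zeroMap c) (zeroMap t s))
  rw [zeroJoin_naturality, ← zeroMap_comp, ← zeroMap_comp] at h
  exact h.symm

theorem sum_add {X : Type u} (c d : X → C.A) (s : ZeroFamilies T X) :
    C.sum (fun x => c x + d x) s = C.sum c s + C.sum d s := by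
  have h : ∀ x, c x + d x = C.sum id (zeroUnit (c x) + zeroUnit (d x)) := fun x => by
    rw [map_add, sum_unit, sum_unit]
    rfl
  simp only [h]
  rw [sum_sum, zeroBind_add, zeroBind_unit, zeroBind_unit, map_add, sum_map, sum_map]
  rfl

/-- Scalars act through one-term sums, so multiplicativity is `sum_sum` for families over a point.
-/
instance module : Module Tᵐᵒᵖ C.A where
  smul r c := C.sum (fun _ : PUnit => c) (zeroConst r.unop)
  one_smul c := by
    refine Eq.trans ?_ (C.sum_unit (fun _ : PUnit => c) PUnit.unit)
    change C.sum _ _ = C.sum _ _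
    congr 1
    apply Subtype.ext
    funext x
    exact (zeroUnit_self x).symm
  mul_smul r r' c := by
    change C.sum _ _ = C.sum (fun _ => C.sum _ _) _
    rw [sum_sum]
    congr 1
    apply Subtype.ext
    funext x
    rw [zeroBind_apply, tsum_fintype]
    simp [zeroConst]
  smul_zero r := by
    have h := C.sum_add (fun _ : PUnit => 0) (fun _ => 0) (zeroConst r.unop)
    simp only [add_zero] at h
    exact left_eq_add.1 h
  smul_add r c d := C.sum_add _ _ _
  add_smul r r' c := by
    change C.sum _ _ = C.sum _ _ + C.sum _ _
    rw [← map_add]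
    rfl
  zero_smul c := by
    change C.sum _ _ = _
    exact map_zero (C.sum fun _ : PUnit => c)

theorem smul_def (r : Tᵐᵒᵖ) (c : C.A) : r • c = C.sum (fun _ : PUnit => c) (zeroConst r.unop) :=
  rfl

theorem smul_sum {X : Type u} (c : X → C.A) (s : ZeroFamilies T X) (r : T) :
    op r • C.sum c s = C.sum c (zeroMulRight s r) := by
  rw [smul_def, sum_sum]
  rfl

theorem sum_single {X : Type u} (c : X → C.A) (x : X) (r : T) :
    C.sum c (zeroSingle x r) = op r • c x := by
  rw [zeroSingle, ← smul_sum, sum_unit]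

variable {C} {D E : Contramodule T}

theorem hom_act (f : C ⟶ D) (s : ZeroFamilies T C.A) :
    f.f (C.act s) = D.act (zeroMap f.f s) :=
  (ConcreteCategory.congr_hom f.h s).symm

theorem hom_sum (f : C ⟶ D) {X : Type u} (c : X → C.A) (s : ZeroFamilies T X) :
    f.f (C.sum c s) = D.sum (fun x => f.f (c x)) s := by
  rw [sum_apply, hom_act, ← zeroMap_comp]
  rfl

/-- A homomorphism of contramodules as a linear map. -/
def homLinear (f : C ⟶ D) : C.A →ₗ[Tᵐᵒᵖ] D.A where
  toFun := f.f
  map_add' c d := by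
    change f.f (C.act _) = D.act _
    rw [hom_act, map_add, zeroMap_unit, zeroMap_unit]
  map_smul' r c := hom_sum f _ _

theorem homLinear_apply (f : C ⟶ D) (c : C.A) : homLinear f c = f.f c := rfl

/-- The homomorphism of contramodules given by a map that commutes with the contraactions. -/
def homMk (f : C.A → D.A) (h : ∀ s, f (C.act s) = D.act (zeroMap f s)) : C ⟶ D where
  f := ↾f
  h := by refine ConcreteCategory.hom_ext _ _ fun s => ?_; exact (h s).symm

theorem hom_ext {f g : C ⟶ D} (h : ∀ c, f.f c = g.f c) : f = g :=
  Monad.Algebra.Hom.ext (ConcreteCategory.hom_ext _ _ h)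

/-- The homomorphism from a free contramodule given by a family of elements. -/
def freeLift {X : Type u} (c : X → C.A) : freeContramodule T X ⟶ C :=
  homMk (C := freeContramodule T X) (fun s : ZeroFamilies T X => C.sum c s) fun z => by
    have h := C.sum_sum c (fun s : ZeroFamilies T X => s) z
    refine Eq.trans (congrArg (C.sum c) ?_) h.symm
    exact congrArg zeroJoin (zeroMap_id z).symm

/-- The identification of the group of zero-convergent families with the free contramodule. -/
def freeEquiv (X : Type u) : ZeroFamilies T X ≃+ (freeContramodule T X).A where
  toFun s := s
  invFun s := s
  left_inv _ := rfl
  right_inv _ := rfl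
  -- Addition in the contramodule is defined through its contraaction, here `zeroJoin`, and must be
  -- compared with the pointwise addition of families.
  map_add' s t := by
    have h := (freeContramodule T X).act_add (zeroUnit s) (zeroUnit t)
    have h' := (freeContramodule T X).act_unit
    refine Eq.trans ?_ (h.trans (congrArg₂ (· + ·) (h' s) (h' t)))
    refine Eq.trans ?_ (map_add (zeroJoin (S := T) (X := X)) (zeroUnit s) (zeroUnit t)).symm
    rw [zeroJoin_unit, zeroJoin_unit]

theorem free_sum_unit {X : Type u} (s : ZeroFamilies T X) :
    (freeContramodule T X).sum (fun x => freeEquiv X (zeroUnit x)) s = freeEquiv X s :=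
  zeroJoin_map_unit s

end Contramodule

end Sums

/-! ### Ideal filtrations, convergent series and the Nakayama lemma. -/

noncomputable section Filtration

open MulOpposite

attribute [local instance] t2Space_of_separated

/-- A base of neighborhoods of zero of a complete ring consisting of a decreasing sequence of
two-sided ideals whose preimages in a dense noetherian subring have the Artin–Rees property. -/
structure ArtinReesFiltration {S T : Type u} [Ring S] [Ring T] [TopologicalSpace T]
    (σ : S →+* T) where
  /-- The ideals. -/
  ideal : ℕ → OpenLeftIdeal T
  -- The whole ring at index `0` lets successive approximation start from an arbitrary element.
  zero : (ideal 0).1 = ⊤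
  antitone : ∀ {m n}, m ≤ n → (ideal n).1 ≤ (ideal m).1
  mul_mem : ∀ {n} {s : T}, s ∈ (ideal n).1 → ∀ r, s * r ∈ (ideal n).1
  basis : ∀ I : OpenLeftIdeal T, ∃ n, (ideal n).1 ≤ I.1
  dense : ∀ (t : T) n, ∃ s : S, t - σ s ∈ (ideal n).1
  noetherian : IsNoetherianRing S
  -- The next two fields are the topological forms of the Gabriel and Artin–Rees conditions:
  -- products of members of the base are open, and the Artin–Rees power is replaced by a member of
  -- the base.
  exists_le_smul : ∀ i j, ∃ k, (ideal k).1.comap σ.toSemilinearMap ≤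
    ((ideal i).1.comap σ.toSemilinearMap : Ideal S) • (ideal j).1.comap σ.toSemilinearMap
  artinRees : ∀ k (M : Type u) [AddCommGroup M] [Module S M] [Module.Finite S M]
    (N : Submodule S M), ∃ l,
      ((ideal l).1.comap σ.toSemilinearMap : Ideal S) • (⊤ : Submodule S M) ⊓ N ≤
        ((ideal k).1.comap σ.toSemilinearMap : Ideal S) • N

namespace ArtinReesFiltration

section Basic

variable {S T : Type u} [Ring S] [Ring T] [TopologicalSpace T] {σ : S →+* T}
  (Φ : ArtinReesFiltration σ)

/-- The preimages of the ideals in the dense subring. -/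
def base (n : ℕ) : Ideal S := (Φ.ideal n).1.comap σ.toSemilinearMap

theorem mem_base {n : ℕ} {s : S} : s ∈ Φ.base n ↔ σ s ∈ (Φ.ideal n).1 := Iff.rfl

theorem base_antitone {m n : ℕ} (h : m ≤ n) : Φ.base n ≤ Φ.base m := fun _ hx => Φ.antitone h hx

theorem mul_mem_base {n : ℕ} {s : S} (hs : s ∈ Φ.base n) (r : S) : s * r ∈ Φ.base n := by
  rw [mem_base, map_mul]
  exact Φ.mul_mem hs _

theorem mem_base_zero (s : S) : s ∈ Φ.base 0 := by
  rw [mem_base, Φ.zero]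
  trivial

theorem exists_base_le_smul (i j : ℕ) : ∃ k, Φ.base k ≤ Φ.base i • Φ.base j :=
  Φ.exists_le_smul i j

/-- The elements of the product of an ideal of the base with a finitely generated submodule. -/
theorem exists_sum_of_mem_smul_span {n : ℕ} {M : Type*} [AddCommGroup M] [Module S M] {r : ℕ}
    (a : Fin r → M) {x : M} (hx : x ∈ Φ.base n • Submodule.span S (Set.range a)) :
    ∃ b : Fin r → S, (∀ j, b j ∈ Φ.base n) ∧ x = ∑ j, b j • a j := by
  induction hx using Submodule.smul_induction_on' with
  | smul s hs y hy =>
    obtain ⟨c, rfl⟩ := (Submodule.mem_span_range_iff_exists_fun S).1 hy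
    exact ⟨fun j => s * c j, fun j => Φ.mul_mem_base hs _, by
      simp [Finset.smul_sum, smul_smul]⟩
  | add x hx y hy ihx ihy =>
    obtain ⟨b, hb, rfl⟩ := ihx
    obtain ⟨c, hc, rfl⟩ := ihy
    exact ⟨fun j => b j + c j, fun j => add_mem (hb j) (hc j), by
      simp [add_smul, Finset.sum_add_distrib]⟩

theorem exists_generators (n : ℕ) :
    ∃ (r : ℕ) (a : Fin r → S), Submodule.span S (Set.range a) = Φ.base n := by
  have := Φ.noetherian
  exact Submodule.fg_iff_exists_fin_generating_family.1 (IsNoetherian.noetherian (Φ.base n))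

end Basic

end ArtinReesFiltration

variable {T : Type u} [Ring T] [TopologicalSpace T] [IsCompleteSeparated T]
  [IsTopologicalRing T] [IsLinearTopology T T]

namespace Contramodule

variable (C : Contramodule T) {D : Contramodule T}

/-- The subgroup of sums with coefficients in an open left ideal. -/
def mulIdeal (I : OpenLeftIdeal T) : AddSubgroup C.A where
  carrier := {x | ∃ s : ZeroFamilies T C.A, (∀ c, s.1 c ∈ I.1) ∧ C.sum id s = x}
  zero_mem' := ⟨0, fun _ => I.1.zero_mem, map_zero _⟩
  add_mem' := by
    rintro _ _ ⟨s, hs, rfl⟩ ⟨t, ht, rfl⟩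
    exact ⟨s + t, fun c => I.1.add_mem (hs c) (ht c), map_add _ _ _⟩
  neg_mem' := by
    rintro _ ⟨s, hs, rfl⟩
    exact ⟨-s, fun c => I.1.neg_mem (hs c), map_neg _ _⟩

variable {I : OpenLeftIdeal T}

theorem sum_mem_mulIdeal {X : Type u} (c : X → C.A) (s : ZeroFamilies T X)
    (h : ∀ x, s.1 x ∈ I.1) : C.sum c s ∈ C.mulIdeal I :=
  ⟨zeroMap c s, zeroMap_apply_mem c s I h, by rw [sum_map]; rfl⟩

theorem mulIdeal_mono {I J : OpenLeftIdeal T} (h : I.1 ≤ J.1) : C.mulIdeal I ≤ C.mulIdeal J := by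
  rintro _ ⟨s, hs, rfl⟩
  exact ⟨s, fun c => h (hs c), rfl⟩

theorem smul_mem_mulIdeal_of_mem (c : C.A) {r : T} (hr : r ∈ I.1) : op r • c ∈ C.mulIdeal I :=
  C.sum_mem_mulIdeal _ _ fun _ => hr

variable {C} in
theorem hom_mem_mulIdeal (f : C ⟶ D) {x : C.A} (hx : x ∈ C.mulIdeal I) :
    f.f x ∈ D.mulIdeal I := by
  obtain ⟨s, hs, rfl⟩ := hx
  rw [hom_sum]
  exact D.sum_mem_mulIdeal _ _ hs

theorem apply_mem_of_mem_mulIdeal {X : Type u} {s : ZeroFamilies T X}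
    (h : freeEquiv X s ∈ (freeContramodule T X).mulIdeal I) (x : X) : s.1 x ∈ I.1 := by
  obtain ⟨z, hz, h⟩ := h
  rw [sum_id] at h
  have h' : zeroJoin z = s := h
  rw [← h']
  exact tsum_mem I fun y => I.1.smul_mem _ (hz y)

theorem freeEquiv_mem_mulIdeal {X : Type u} {s : ZeroFamilies T X} (h : ∀ x, s.1 x ∈ I.1) :
    freeEquiv X s ∈ (freeContramodule T X).mulIdeal I := by
  rw [← free_sum_unit]
  exact sum_mem_mulIdeal _ _ _ h

section

variable {S : Type u} [Ring S] {σ : S →+* T} (Φ : ArtinReesFiltration σ)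

theorem smul_mem_mulIdeal {n : ℕ} {x : C.A} (hx : x ∈ C.mulIdeal (Φ.ideal n)) (r : T) :
    op r • x ∈ C.mulIdeal (Φ.ideal n) := by
  obtain ⟨s, hs, rfl⟩ := hx
  rw [smul_sum]
  refine C.sum_mem_mulIdeal _ _ fun c => ?_
  rw [zeroMulRight_apply]
  exact Φ.mul_mem (hs c) r

theorem mem_mulIdeal_zero (x : C.A) : x ∈ C.mulIdeal (Φ.ideal 0) := by
  rw [← C.sum_unit (fun x => x) x]
  refine C.sum_mem_mulIdeal _ _ fun _ => ?_
  rw [Φ.zero]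
  trivial

/-- Series whose terms tend to zero have sums. -/
theorem exists_sub_sum_mem_mulIdeal (k : ℕ) (w : ℕ → C.A)
    (hw : ∀ i, w i ∈ C.mulIdeal (Φ.ideal (k + i))) :
    ∃ y : C.A, ∀ n, y - ∑ i ∈ Finset.range n, w i ∈ C.mulIdeal (Φ.ideal (k + n)) := by
  choose s hs hsw using hw
  -- The contramodule need not be separated, so the sum cannot be defined by its partial sums.
  -- Instead the coefficients of all terms are collected into one zero-convergent family, to which
  -- the contraaction applies; deleting the first `n` terms leaves coefficients in `Φ.ideal (k +
  -- n)`.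
  let v : ZeroFamilies T (ULift.{u} ℕ × C.A) := ⟨fun p => (s p.1.down).1 p.2, by
    have h : IsZeroConvergent fun p : ℕ × C.A => (s p.1).1 p.2 :=
      isZeroConvergent_prod s fun I => by
        obtain ⟨n, hn⟩ := Φ.basis I
        exact ⟨n, fun i hi x => hn (Φ.antitone (by omega) (hs i x))⟩
    exact h.comp_injective (g := fun p : ULift.{u} ℕ × C.A => (p.1.down, p.2))
      fun p q hpq => by
        simp only [Prod.mk.injEq] at hpq
        exact Prod.ext (ULift.ext _ _ hpq.1) hpq.2⟩
  refine ⟨C.sum Prod.snd v, fun n => ?_⟩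
  have h : C.sum Prod.snd v - ∑ i ∈ Finset.range n, w i =
      C.sum Prod.snd (v - ∑ i ∈ Finset.range n, zeroMap (Prod.mk (ULift.up i)) (s i)) := by
    rw [map_sub, map_sum]
    congr 1
    refine Finset.sum_congr rfl fun i _ => ?_
    rw [sum_map, ← hsw i]
    rfl
  rw [h]
  refine C.sum_mem_mulIdeal _ _ ?_
  rintro ⟨⟨j⟩, c⟩
  have h2 : (v - ∑ i ∈ Finset.range n, zeroMap (Prod.mk (ULift.up i)) (s i)).1 (ULift.up j, c) =
      (s j).1 c - ∑ i ∈ Finset.range n, if i = j then (s i).1 c else 0 := by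
    refine Eq.trans (congrArg (fun z => (s j).1 c - z) (zeroFamilies_sum_apply _ _ _)) ?_
    simp only [zeroMap_mk_apply, ULift.up_inj]
  rw [h2, Finset.sum_ite_eq']
  split_ifs with hj
  · rw [sub_self]
    exact Submodule.zero_mem _
  · rw [sub_zero]
    have hj : n ≤ j := by simpa using hj
    exact Φ.antitone (by omega) (hs j c)

/-- A Nakayama lemma: a subset of a contramodule all of whose elements are sums of elements of the
subset with coefficients in arbitrarily small ideals is zero. -/
theorem eq_zero_of_forall_exists_sum (G : Set C.A)
    (hG : ∀ g ∈ G, ∀ n, ∃ t : ZeroFamilies T G,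
      (∀ x, t.1 x ∈ (Φ.ideal n).1) ∧ g = C.sum (fun x : G => (x : C.A)) t)
    {d : C.A} (hd : d ∈ G) : d = 0 := by
  classical
  choose A hA hAsum using fun (g : G) (n : ℕ) => hG g.1 g.2 n
  -- Starting from `d`, the expansion of each element of `G` with coefficients in the `n`-th ideal
  -- is substituted at the `n`-th stage.
  let v : ℕ → ZeroFamilies T G :=
    fun n => Nat.rec (zeroUnit ⟨d, hd⟩) (fun n v => zeroBind (fun g => A g n) v) n
  have hv : ∀ n, v (n + 1) = zeroBind (fun g => A g n) (v n) := fun _ => rfl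
  have hv_mem : ∀ n x, (v (n + 1)).1 x ∈ (Φ.ideal n).1 := by
    intro n x
    rw [hv, zeroBind_apply]
    exact tsum_mem _ fun g => Φ.mul_mem (hA g n x) _
  let V : ZeroFamilies T (ℕ × G) := ⟨fun p => (v p.1).1 p.2, isZeroConvergent_prod v fun I => by
    obtain ⟨n, hn⟩ := Φ.basis I
    refine ⟨n + 1, fun i hi x => hn ?_⟩
    obtain ⟨j, rfl⟩ : ∃ j, i = j + 1 := ⟨i - 1, by omega⟩
    exact Φ.antitone (by omega) (hv_mem j x)⟩
  -- One substitution, recorded as a shift from level `n` to level `n + 1`.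
  let t : ℕ × G → ZeroFamilies T (ℕ × G) := fun p =>
    zeroMap (fun g => (p.1 + 1, g)) (A p.2 p.1)
  have ht : ∀ p j h, (t p).1 (j, h) = if p.1 + 1 = j then (A p.2 p.1).1 h else 0 := by
    intro p j h
    rw [zeroMap_apply, tsum_eq_single h]
    · simp
    · intro y hy
      simp [hy]
  -- An infinite swindle: `V` contains every stage at once, so shifting it by one level removes only
  -- the initial term `d`.
  have hVt : V = zeroUnit (0, ⟨d, hd⟩) + zeroBind t V := by
    apply Subtype.ext
    funext ⟨j, h⟩
    change (v j).1 h = (zeroUnit (0, ⟨d, hd⟩) : ZeroFamilies T (ℕ × G)).1 (j, h) +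
      (zeroBind t V).1 (j, h)
    rw [zeroBind_apply]
    simp only [ht]
    cases j with
    | zero =>
      simp only [Nat.add_eq_zero_iff, one_ne_zero, and_false, if_false, zero_mul, tsum_zero,
        add_zero]
      change (zeroUnit ⟨d, hd⟩ : ZeroFamilies T G).1 h = _
      simp [zeroUnit, Pi.single_apply]
    | succ n =>
      rw [zeroUnit_of_ne (by simp), zero_add, hv, zeroBind_apply]
      rw [← (Prod.mk_right_injective n : Function.Injective (Prod.mk n : G → ℕ × G)).tsum_eq]
      · refine tsum_congr fun g => ?_
        simp [V]
      · rintro ⟨m, g⟩ hm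
        by_cases hmn : m = n
        · exact ⟨g, by rw [hmn]⟩
        · simp [hmn] at hm
  let c : ℕ × G → C.A := fun p => p.2
  have hc : ∀ p, C.sum c (t p) = c p := by
    intro p
    rw [sum_map]
    exact (hAsum p.2 p.1).symm
  -- Each substitution preserves the value, so the shifted family has the same sum as `V`, and the
  -- initial term must vanish.
  have h1 : C.sum c (zeroBind t V) = C.sum c V := by
    rw [← sum_sum]
    simp only [hc]
  have h2 := congrArg (C.sum c) hVt
  rw [map_add, h1, sum_unit] at h2
  exact right_eq_add.1 h2

/-- The Nakayama lemma for finite sums with coefficients in the dense subring. -/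
theorem eq_zero_of_forall_exists_finset_sum (G : Set C.A)
    (hG : ∀ g ∈ G, ∀ n, ∃ (r : ℕ) (a : Fin r → S) (y : Fin r → C.A),
      (∀ j, a j ∈ Φ.base n) ∧ (∀ j, y j ∈ G) ∧ g = ∑ j, op (σ (a j)) • y j)
    {d : C.A} (hd : d ∈ G) : d = 0 := by
  refine C.eq_zero_of_forall_exists_sum Φ G (fun g hg n => ?_) hd
  obtain ⟨r, a, y, ha, hy, rfl⟩ := hG g hg n
  refine ⟨∑ j, zeroSingle ⟨y j, hy j⟩ (σ (a j)), fun x => ?_, ?_⟩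
  · rw [zeroFamilies_sum_apply]
    refine sum_mem fun j _ => ?_
    by_cases hx : x = ⟨y j, hy j⟩
    · rw [hx, zeroSingle_self]
      exact ha j
    · rw [zeroSingle_of_ne _ hx]
      exact Submodule.zero_mem _
  · simp only [map_sum, sum_single]

/-- Approximation of a sum by a finite sum with coefficients in the dense subring. -/
theorem exists_finset_approx {X : Type u} (s : ZeroFamilies T X) (n : ℕ) :
    ∃ (A : Finset X) (a : X → S), (∀ x, s.1 x - σ (a x) ∈ (Φ.ideal n).1) ∧
      ∀ (C : Contramodule T) (c : X → C.A),
        C.sum c s - ∑ x ∈ A, op (σ (a x)) • c x ∈ C.mulIdeal (Φ.ideal n) := by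
  classical
  choose a ha using fun x => Φ.dense (s.1 x) n
  refine ⟨(s.2 (Φ.ideal n)).toFinset, a, ha, fun C c => ?_⟩
  simp only [← C.sum_single c]
  rw [← map_sum, ← map_sub]
  refine C.sum_mem_mulIdeal _ _ fun x => ?_
  have h : (s - ∑ y ∈ (s.2 (Φ.ideal n)).toFinset, zeroSingle y (σ (a y))).1 x =
      s.1 x - ∑ y ∈ (s.2 (Φ.ideal n)).toFinset, if y = x then σ (a y) else 0 := by
    refine Eq.trans (congrArg (fun z => s.1 x - z) (zeroFamilies_sum_apply _ _ _)) ?_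
    congr 1
    refine Finset.sum_congr rfl fun y _ => ?_
    split_ifs with hyx
    · rw [hyx, zeroSingle_self]
    · exact zeroSingle_of_ne _ (Ne.symm hyx)
  rw [h, Finset.sum_ite_eq']
  split_ifs with hx
  · exact ha x
  · simpa using hx

/-- Approximating the coefficients by elements of `S` makes the sum finite; each approximated
coefficient lies in the product of two ideals and so is a combination of the generators `a` with
coefficients in `Φ.base i`. -/
theorem exists_sub_sum_smul_mem {l i k : ℕ} (hk : Φ.base k ≤ Φ.base i • Φ.base l) {r : ℕ}
    {a : Fin r → S} (ha : Submodule.span S (Set.range a) = Φ.base l) (k' : ℕ) {x : C.A}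
    (hx : x ∈ C.mulIdeal (Φ.ideal k)) :
    ∃ y : Fin r → C.A, (∀ j, y j ∈ C.mulIdeal (Φ.ideal i)) ∧
      x - ∑ j, op (σ (a j)) • y j ∈ C.mulIdeal (Φ.ideal k') := by
  obtain ⟨s, hs, rfl⟩ := hx
  obtain ⟨A, u, hu, h⟩ := exists_finset_approx Φ s (max k k')
  have hmem : ∀ x, u x ∈ Φ.base i • Submodule.span S (Set.range a) := by
    intro x
    rw [ha]
    refine hk (Φ.mem_base.2 ?_)
    have := (Φ.ideal k).1.sub_mem (hs x) (Φ.antitone (le_max_left k k') (hu x))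
    simpa using this
  choose b hb hbu using fun x => Φ.exists_sum_of_mem_smul_span a (hmem x)
  refine ⟨fun j => ∑ x ∈ A, op (σ (b x j)) • x, fun j => sum_mem fun x _ =>
    C.smul_mem_mulIdeal_of_mem _ (hb x j), ?_⟩
  have h2 : ∑ j, op (σ (a j)) • ∑ x ∈ A, op (σ (b x j)) • x = ∑ x ∈ A, op (σ (u x)) • id x := by
    simp only [Finset.smul_sum, smul_smul, ← op_mul, ← map_mul]
    rw [Finset.sum_comm]
    refine Finset.sum_congr rfl fun x _ => ?_
    rw [hbu x, map_sum, Finset.op_sum, Finset.sum_smul]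
    rfl
  rw [h2]
  exact C.mulIdeal_mono (Φ.antitone (le_max_right k k')) (h C id)

theorem free_eq_zero_of_forall_mem {X : Type u} {x : (freeContramodule T X).A}
    (h : ∀ n, x ∈ (freeContramodule T X).mulIdeal (Φ.ideal n)) : x = 0 := by
  obtain ⟨s, rfl⟩ := (freeEquiv X).surjective x
  suffices s = 0 by rw [this, map_zero]
  apply Subtype.ext
  funext x
  refine eq_of_sub_mem fun I => ?_
  obtain ⟨n, hn⟩ := Φ.basis I
  have := hn (apply_mem_of_mem_mulIdeal (h n) x)
  rwa [← sub_zero (s.1 x)] at this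

/-- The approximate expressions are iterated on the error and their coefficients summed as
convergent series; the final equality uses that free contramodules are separated. The bound `k` is
independent of `X`. -/
theorem free_exists_eq_sum_smul {l : ℕ} {r : ℕ} {a : Fin r → S}
    (ha : Submodule.span S (Set.range a) = Φ.base l) (i : ℕ) :
    ∃ k, ∀ (X : Type u) (x : (freeContramodule T X).A),
      x ∈ (freeContramodule T X).mulIdeal (Φ.ideal k) →
      ∃ y : Fin r → (freeContramodule T X).A,
        (∀ j, y j ∈ (freeContramodule T X).mulIdeal (Φ.ideal i)) ∧
        x = ∑ j, op (σ (a j)) • y j := by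
  choose p hp using fun n => Φ.exists_base_le_smul n l
  -- The bound `n ≤ q n` makes the errors tend to zero.
  let q : ℕ → ℕ := fun n => max n (p n)
  have hq : ∀ n, Φ.base (q n) ≤ Φ.base n • Φ.base l := fun n =>
    (Φ.base_antitone (le_max_right _ _)).trans (hp n)
  refine ⟨q i, fun X x hx => ?_⟩
  let C := freeContramodule T X
  choose! y hy hyx using fun (n : ℕ) (x : C.A) (hx : x ∈ C.mulIdeal (Φ.ideal (q (i + n)))) =>
    C.exists_sub_sum_smul_mem Φ (hq (i + n)) ha (q (i + (n + 1))) hx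
  let z : ℕ → C.A := fun n =>
    Nat.rec x (fun n z => z - ∑ j, op (σ (a j)) • y n z j) n
  have hz : ∀ n, z (n + 1) = z n - ∑ j, op (σ (a j)) • y n (z n) j := fun _ => rfl
  have hz_mem : ∀ n, z n ∈ C.mulIdeal (Φ.ideal (q (i + n))) := by
    intro n
    induction n with
    | zero => exact hx
    | succ n ih => exact hyx n _ ih
  choose w hw using fun j => C.exists_sub_sum_mem_mulIdeal Φ i (fun n => y n (z n) j)
    fun n => hy n _ (hz_mem n) j
  refine ⟨w, fun j => by simpa using hw j 0, ?_⟩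
  rw [← sub_eq_zero]
  refine free_eq_zero_of_forall_mem Φ fun n => ?_
  have hzsum : ∀ n, z n = x - ∑ j, op (σ (a j)) • ∑ m ∈ Finset.range n, y m (z m) j := by
    intro n
    induction n with
    | zero =>
      change x = _
      simp
    | succ n ih =>
      rw [hz]
      simp only [Finset.sum_range_succ, smul_add, Finset.sum_add_distrib]
      rw [← sub_sub, ← ih]
  have h : x - ∑ j, op (σ (a j)) • w j =
      z n - ∑ j, op (σ (a j)) • (w j - ∑ m ∈ Finset.range n, y m (z m) j) := by
    rw [hzsum n]
    simp only [smul_sub, Finset.sum_sub_distrib]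
    abel
  change x - ∑ j, op (σ (a j)) • w j ∈ C.mulIdeal _
  rw [h]
  refine sub_mem (C.mulIdeal_mono (Φ.antitone ?_) (hz_mem n)) (sum_mem fun j _ =>
    C.smul_mem_mulIdeal Φ (C.mulIdeal_mono (Φ.antitone ?_) (hw j n)) _)
  · exact (Nat.le_add_left n i).trans (le_max_left _ _)
  · omega

/-- An arbitrary contramodule need not be separated, but a small element lifts to a small element of
the free contramodule on its underlying set, where the expression exists and can be pushed forward.
-/
theorem exists_eq_sum_smul {l : ℕ} {r : ℕ} {a : Fin r → S}
    (ha : Submodule.span S (Set.range a) = Φ.base l) (i : ℕ) :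
    ∃ k, ∀ (C : Contramodule T) (x : C.A), x ∈ C.mulIdeal (Φ.ideal k) →
      ∃ y : Fin r → C.A, (∀ j, y j ∈ C.mulIdeal (Φ.ideal i)) ∧ x = ∑ j, op (σ (a j)) • y j := by
  obtain ⟨k, hk⟩ := free_exists_eq_sum_smul Φ ha i
  refine ⟨k, fun C x hx => ?_⟩
  obtain ⟨s, hs, rfl⟩ := hx
  obtain ⟨y, hy, h⟩ := hk C.A (freeEquiv _ s) (freeEquiv_mem_mulIdeal hs)
  refine ⟨fun j => (freeLift id).f (y j), fun j => hom_mem_mulIdeal _ (hy j), ?_⟩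
  have h' := congrArg (homLinear (freeLift (C := C) id)) h
  simp only [map_sum, map_smul] at h'
  exact h'

/-- The coefficients outside a small ideal are finitely many and are approximated in `S`; the small
remainder is exactly a combination of the generators. The generators depend on `n` alone. A map
linear over `S` is thus controlled on a free contramodule by its values on the basis, up to
multiples of the `a j`. -/
theorem free_exists_decomposition (n : ℕ) : ∃ (r : ℕ) (a : Fin r → S), (∀ j, a j ∈ Φ.base n) ∧
    ∀ (X : Type u) (s : (freeContramodule T X).A), ∃ (A : Finset X) (u : X → S)
      (y : Fin r → (freeContramodule T X).A),
      s = ∑ x ∈ A, op (σ (u x)) • freeEquiv X (zeroUnit x) + ∑ j, op (σ (a j)) • y j := by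
  obtain ⟨r, a, ha⟩ := Φ.exists_generators n
  obtain ⟨k, hk⟩ := free_exists_eq_sum_smul Φ ha 0
  refine ⟨r, a, fun j => ha ▸ Submodule.subset_span ⟨j, rfl⟩, fun X s => ?_⟩
  obtain ⟨s, rfl⟩ := (freeEquiv X).surjective s
  obtain ⟨A, u, -, h⟩ := exists_finset_approx Φ s k
  obtain ⟨y, -, hy⟩ := hk X _ (h (freeContramodule T X) fun x => freeEquiv X (zeroUnit x))
  refine ⟨A, u, y, ?_⟩
  rw [← hy, free_sum_unit]
  abel

/-- Additive maps of contramodules that are linear over the dense subring are homomorphisms of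
contramodules. -/
theorem map_act_of_map_smul (Φ : ArtinReesFiltration σ) (f : C.A →+ D.A)
    (hf : ∀ (a : S) (x : C.A), f (op (σ a) • x) = op (σ a) • f x) (s : ZeroFamilies T C.A) :
    f (C.act s) = D.act (zeroMap f s) := by
  let P := freeContramodule T C.A
  -- The defect of commutation with infinite sums. It is `S`-linear and kills the basis, so by the
  -- decomposition its range satisfies the hypothesis of the Nakayama lemma.
  let g : P.A →+ D.A := f.comp (homLinear (freeLift (C := C) id)).toAddMonoidHom -
    (homLinear (freeLift (C := D) f)).toAddMonoidHom
  have hg_def : ∀ x : P.A, g x = f (homLinear (freeLift (C := C) id) x) -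
    homLinear (freeLift (C := D) f) x := fun _ => rfl
  have hg : ∀ (a : S) (x : P.A), g (op (σ a) • x) = op (σ a) • g x := by
    intro a x
    rw [hg_def, hg_def, (homLinear (freeLift (C := C) id)).map_smul, hf,
      (homLinear (freeLift (C := D) f)).map_smul, smul_sub]
  have hg_unit : ∀ c : C.A, g (freeEquiv _ (zeroUnit c)) = 0 := by
    intro c
    change f (C.sum id (zeroUnit c)) - D.sum f (zeroUnit c) = 0
    rw [sum_unit, sum_unit, id, sub_self]
  suffices ∀ x, g x = 0 by
    have h := this (freeEquiv _ s)
    change f (C.sum id s) - D.sum f s = 0 at h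
    rw [sub_eq_zero, sum_id] at h
    exact h
  intro x
  refine D.eq_zero_of_forall_exists_finset_sum Φ (Set.range g) ?_ ⟨x, rfl⟩
  rintro _ ⟨x, rfl⟩ n
  obtain ⟨r, a, ha, h⟩ := free_exists_decomposition Φ n
  obtain ⟨A, u, y, rfl⟩ := h _ x
  refine ⟨r, a, fun j => g (y j), ha, fun j => ⟨_, rfl⟩, ?_⟩
  simp only [map_add, map_sum, hg, hg_unit, smul_zero, Finset.sum_const_zero, zero_add]

end

end Contramodule

end Filtration

/-! ### Discrete modules and the contratensor product. -/

noncomputable section DiscreteModules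

open MulOpposite

section Instances

variable {T : Type*} [Ring T] [TopologicalSpace T]

theorem isDiscreteModule_of_forall_exists [IsTopologicalRing T] {M : Type*} [AddCommGroup M]
    [Module T M] (h : ∀ b : M, ∃ I : Ideal T, IsOpen (I : Set T) ∧ ∀ s ∈ I, s • b = 0) :
    IsDiscreteModule T M where
  isOpen_annihilator b := by
    obtain ⟨I, hI, h⟩ := h b
    exact AddSubgroup.isOpen_mono (H₁ := I.toAddSubgroup)
      (H₂ := (Ideal.torsionOf T M b).toAddSubgroup) (fun s hs => h s hs) hI

variable {M N : Type*} [AddCommGroup M] [Module T M] [IsDiscreteModule T M] [AddCommGroup N]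
  [Module T N]

theorem IsDiscreteModule.of_injective (f : N →ₗ[T] M) (hf : Function.Injective f) :
    IsDiscreteModule T N where
  isOpen_annihilator b := by
    convert isOpen_annihilator (S := T) (f b)
    ext s
    rw [Ideal.mem_torsionOf_iff, Ideal.mem_torsionOf_iff, ← map_smul, map_eq_zero_iff f hf]

instance IsDiscreteModule.submodule (p : Submodule T M) : IsDiscreteModule T p :=
  .of_injective p.subtype p.injective_subtype

variable [IsTopologicalRing T]

theorem IsDiscreteModule.of_surjective (f : M →ₗ[T] N) (hf : Function.Surjective f) :
    IsDiscreteModule T N :=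
  isDiscreteModule_of_forall_exists fun b => by
    obtain ⟨b, rfl⟩ := hf b
    exact ⟨Ideal.torsionOf T M b, isOpen_annihilator b, fun s hs => by
      rw [← map_smul, (Ideal.mem_torsionOf_iff _ _).1 hs, map_zero]⟩

instance IsDiscreteModule.quotient (p : Submodule T M) : IsDiscreteModule T (M ⧸ p) :=
  .of_surjective p.mkQ p.mkQ_surjective

instance IsDiscreteModule.pi {n : Type*} [Finite n] : IsDiscreteModule T (n → M) :=
  isDiscreteModule_of_forall_exists fun b => ⟨⨅ i, Ideal.torsionOf T M (b i), by
    rw [Submodule.coe_iInf]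
    exact isOpen_iInter_of_finite fun i => isOpen_annihilator (b i), fun s hs => by
      funext i
      exact (Ideal.mem_torsionOf_iff _ _).1 ((Submodule.mem_iInf _).1 hs i)⟩

end Instances

variable {T : Type u} [Ring T] [TopologicalSpace T] [IsCompleteSeparated T]
  [IsTopologicalRing T] [IsLinearTopology T T]

section Contratensor

variable (C : Contramodule T) (M : Type u) [AddCommGroup M] [Module T M]

/-- The biadditive map to the contratensor product. -/
def ctensor : C.A →+ M →+ Contratensor C M :=
  AddMonoidHom.mk' (fun c => AddMonoidHom.mk' (fun b => QuotientAddGroup.mk (c ⊗ₜ[ℤ] b))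
    fun b b' => by rw [TensorProduct.tmul_add]; rfl) fun c c' => by
      ext b
      exact congrArg QuotientAddGroup.mk (TensorProduct.add_tmul c c' b)

variable {C M}

theorem ctensor_induction {P : Contratensor C M → Prop} (zero : P 0)
    (add : ∀ x y, P x → P y → P (x + y)) (mk : ∀ c b, P (ctensor C M c b)) (x) : P x := by
  obtain ⟨x, rfl⟩ := QuotientAddGroup.mk_surjective x
  induction x using TensorProduct.induction_on with
  | zero => exact zero
  | tmul c b => exact mk c b
  | add x y hx hy => exact add _ _ hx hy

variable (C) in
theorem contratensorMap_ctensor [IsDiscreteModule T M] {N : Type u} [AddCommGroup N] [Module T N]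
    [IsDiscreteModule T N] (f : M →ₗ[T] N) (c : C.A) (b : M) :
    contratensorMap C f (ctensor C M c b) = ctensor C N c (f b) := rfl

variable [IsDiscreteModule T M]

theorem ctensor_act (s : ZeroFamilies T C.A) (b : M) :
    ctensor C M (C.act s) b = ∑ᶠ c, ctensor C M c (s.1 c • b) := by
  have h : (QuotientAddGroup.mk (contratensorSum C M s b) : Contratensor C M) =
      QuotientAddGroup.mk (C.act s ⊗ₜ[ℤ] b) := by
    rw [← sub_eq_zero, ← QuotientAddGroup.mk_sub]
    exact (QuotientAddGroup.eq_zero_iff _).2 (AddSubgroup.subset_closure ⟨s, b, rfl⟩)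
  refine h.symm.trans ?_
  rw [contratensorSum]
  refine AddMonoidHom.map_finsum (QuotientAddGroup.mk' (contratensorRel C M)) ?_
  refine (finite_smul_ne_zero C M s b).subset fun c hc h => hc ?_
  simp [h]

theorem ctensor_act_eq_sum (s : ZeroFamilies T C.A) (b : M) {A : Finset C.A}
    (hA : ∀ c, c ∉ A → s.1 c • b = 0) :
    ctensor C M (C.act s) b = ∑ c ∈ A, ctensor C M c (s.1 c • b) := by
  rw [ctensor_act]
  refine finsum_eq_sum_of_support_subset _ fun c hc => ?_
  by_contra h
  exact hc (by simp [hA c h])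

theorem ctensor_smul (c : C.A) (r : T) (b : M) :
    ctensor C M (op r • c) b = ctensor C M c (r • b) := by
  have h := C.sum_single id c r
  rw [id, C.sum_id] at h
  rw [← h, ctensor_act_eq_sum _ _ (A := {c}), Finset.sum_singleton, zeroSingle_self]
  intro d hd
  rw [zeroSingle_of_ne _ (by simpa using hd), zero_smul]

/-- The universal property of the contratensor product. -/
def contratensorLift {A : Type*} [AddCommGroup A] (f : C.A →+ M →+ A)
    (hf : ∀ s b, f (C.act s) b = ∑ᶠ c, f c (s.1 c • b)) : Contratensor C M →+ A :=
  QuotientAddGroup.lift (contratensorRel C M)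
    (TensorProduct.liftAddHom f fun r c b => by
      rw [map_zsmul, map_zsmul, AddMonoidHom.smul_apply]) (by
    rw [contratensorRel, AddSubgroup.closure_le]
    rintro _ ⟨s, b, rfl⟩
    rw [SetLike.mem_coe, AddMonoidHom.mem_ker, map_sub, contratensorSum,
      AddMonoidHom.map_finsum, sub_eq_zero]
    · simp [hf]
    · refine (finite_smul_ne_zero C M s b).subset fun c hc h => hc ?_
      simp [h])

theorem contratensor_hom_ext {A : Type*} [AddCommGroup A] {f g : Contratensor C M →+ A}
    (h : ∀ c b, f (ctensor C M c b) = g (ctensor C M c b)) (x) : f x = g x := by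
  induction x using ctensor_induction with
  | zero => rw [map_zero, map_zero]
  | add x y hx hy => rw [map_add, map_add, hx, hy]
  | mk c b => exact h c b

end Contratensor

instance (I : OpenLeftIdeal T) : IsDiscreteModule T (T ⧸ I.1) :=
  isDiscreteModule_of_forall_exists fun b => by
    obtain ⟨t, rfl⟩ := I.1.mkQ_surjective b
    obtain ⟨J, hJ⟩ := eventually_mul_mem I t
    refine ⟨J.1, J.2, fun s hs => ?_⟩
    rw [← map_smul]
    exact (Submodule.Quotient.mk_eq_zero _).2 (hJ s hs)

theorem IsFlat.injective {C : Contramodule T} (hC : IsFlat C) {M N : Type u} [AddCommGroup M]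
    [Module T M] [IsDiscreteModule T M] [AddCommGroup N] [Module T N] [IsDiscreteModule T N]
    (f : M →ₗ[T] N) (hf : Function.Injective f) : Function.Injective (contratensorMap C f) :=
  (hC M N (N ⧸ LinearMap.range f) f (LinearMap.range f).mkQ hf
    (LinearMap.exact_iff.2 (Submodule.ker_mkQ _)) (Submodule.mkQ_surjective _)).1

/-- Factoring `f` through its range separates the two exactness statements: the inclusion of the
range stays injective, and the kernel sequence onto the range stays exact. -/
theorem IsFlat.exists_ker {C : Contramodule T} (hC : IsFlat C) {M N : Type u} [AddCommGroup M]
    [Module T M] [IsDiscreteModule T M] [AddCommGroup N] [Module T N] [IsDiscreteModule T N]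
    (f : M →ₗ[T] N) {x : Contratensor C M} (hx : contratensorMap C f x = 0) :
    ∃ y : Contratensor C (LinearMap.ker f), contratensorMap C (LinearMap.ker f).subtype y = x := by
  obtain ⟨-, h, -⟩ := hC (LinearMap.ker f) M (LinearMap.range f) (LinearMap.ker f).subtype
    f.rangeRestrict (Submodule.injective_subtype _) (LinearMap.exact_iff.2 (by
      rw [LinearMap.ker_rangeRestrict, Submodule.range_subtype])) f.surjective_rangeRestrict
  refine (h x).1 (hC.injective (LinearMap.range f).subtype (Submodule.injective_subtype _) ?_)
  rw [map_zero, ← hx]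
  induction x using ctensor_induction with
  | zero => simp
  | add x y ihx ihy =>
    have := contratensor_hom_ext (f := (contratensorMap C (LinearMap.range f).subtype).comp
      (contratensorMap C f.rangeRestrict)) (g := contratensorMap C f) fun c b => rfl
    exact this _
  | mk c b => rfl

namespace Contramodule

variable (C : Contramodule T)

theorem sum_sub_finset_sum_mem {I : OpenLeftIdeal T} {X : Type u} (c : X → C.A)
    (s : ZeroFamilies T X) {A : Finset X} (hA : ∀ x, x ∉ A → s.1 x ∈ I.1) :
    C.sum c s - ∑ x ∈ A, op (s.1 x) • c x ∈ C.mulIdeal I := by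
  classical
  simp only [← C.sum_single c]
  rw [← map_sum, ← map_sub]
  refine C.sum_mem_mulIdeal _ _ fun x => ?_
  have h : (s - ∑ y ∈ A, zeroSingle y (s.1 y)).1 x =
      s.1 x - ∑ y ∈ A, if y = x then s.1 y else 0 := by
    refine Eq.trans (congrArg (fun z => s.1 x - z) (zeroFamilies_sum_apply _ _ _)) ?_
    congr 1
    refine Finset.sum_congr rfl fun y _ => ?_
    split_ifs with hyx
    · rw [hyx, zeroSingle_self]
    · exact zeroSingle_of_ne _ (Ne.symm hyx)
  rw [h, Finset.sum_ite_eq']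
  split_ifs with hx
  · rw [sub_self]
    exact Submodule.zero_mem _
  · simpa using hA x hx

/-- The evaluation map from the contratensor product with a cyclic discrete module. -/
def evalQuotient (I : OpenLeftIdeal T) : Contratensor C (T ⧸ I.1) →+ C.A ⧸ C.mulIdeal I :=
  contratensorLift
    (AddMonoidHom.mk' (fun c => (QuotientAddGroup.lift I.1.toAddSubgroup
      (AddMonoidHom.mk' (fun t => (QuotientAddGroup.mk (op t • c) : C.A ⧸ C.mulIdeal I))
        fun t t' => by rw [MulOpposite.op_add, add_smul]; rfl)
      fun t ht => (QuotientAddGroup.eq_zero_iff _).2 (C.smul_mem_mulIdeal_of_mem c ht) :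
        T ⧸ I.1 →+ C.A ⧸ C.mulIdeal I)) fun c c' => by
          refine AddMonoidHom.ext fun t => ?_
          obtain ⟨t, rfl⟩ := I.1.mkQ_surjective t
          exact congrArg QuotientAddGroup.mk (smul_add (op t) c c'))
    fun s b => by
      obtain ⟨t, rfl⟩ := I.1.mkQ_surjective b
      have hfin : {c | s.1 c * t ∉ I.1}.Finite := (zeroMulRight s t).2 I |>.subset fun c hc => by
        simpa [zeroMulRight_apply] using hc
      rw [finsum_eq_sum_of_support_subset (s := hfin.toFinset)]
      · have h := C.sum_sub_finset_sum_mem (I := I) id (zeroMulRight s t) (A := hfin.toFinset)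
          fun c hc => by
            simpa [zeroMulRight_apply] using hc
        rw [← smul_sum, sum_id] at h
        simp only [zeroMulRight_apply, id] at h
        have h2 := (QuotientAddGroup.eq_zero_iff _).2 h
        rw [QuotientAddGroup.mk_sub, sub_eq_zero] at h2
        refine h2.trans ?_
        exact map_sum (QuotientAddGroup.mk' (C.mulIdeal I)) _ _
      · intro c hc
        by_contra h
        refine hc ((QuotientAddGroup.eq_zero_iff _).2 (C.smul_mem_mulIdeal_of_mem c ?_))
        simpa using h

theorem evalQuotient_ctensor (I : OpenLeftIdeal T) (c : C.A) (t : T) :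
    C.evalQuotient I (ctensor C _ c (I.1.mkQ t)) = QuotientAddGroup.mk (op t • c) := rfl

end Contramodule

end DiscreteModules

/-! ### Flat contramodules are flat modules over the dense subring. -/

noncomputable section Flat

open MulOpposite

namespace ArtinReesFiltration

variable {S T : Type u} [Ring S] [Ring T] [TopologicalSpace T] {σ : S →+* T}
  (Φ : ArtinReesFiltration σ)

theorem exists_artinRees (k : ℕ) (M : Type u) [AddCommGroup M] [Module S M] [Module.Finite S M]
    (N : Submodule S M) : ∃ l, Φ.base l • (⊤ : Submodule S M) ⊓ N ≤ Φ.base k • N :=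
  Φ.artinRees k M N

theorem mem_smul_top_iff {n m : ℕ} (b : Fin m → S) :
    b ∈ Φ.base n • (⊤ : Submodule S (Fin m → S)) ↔ ∀ i, b i ∈ Φ.base n := by
  constructor
  · intro h
    induction h using Submodule.smul_induction_on' with
    | smul r hr x hx => exact fun i => Φ.mul_mem_base hr _
    | add x hx y hy ihx ihy => exact fun i => add_mem (ihx i) (ihy i)
  · intro h
    rw [pi_eq_sum_univ b]
    exact sum_mem fun i _ => Submodule.smul_mem_smul (h i) trivial

theorem base_zero_smul {M : Type*} [AddCommGroup M] [Module S M] (N : Submodule S M) :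
    N ≤ Φ.base 0 • N := fun x hx => by
  have := Submodule.smul_mem_smul (Φ.mem_base_zero 1) hx
  rwa [one_smul] at this

/-- Approximate solutions of a system of linear equations differ from exact solutions by small
vectors. -/
theorem exists_syzygy_approx {m n q : ℕ} (C : Matrix (Fin m) (Fin n) S) (B : Matrix (Fin q) (Fin m) S)
    (hB : Submodule.span S (Set.range B) = LinearMap.ker C.vecMulLinear) (i : ℕ) :
    ∃ l, (i = 0 → l = 0) ∧ ∀ k', ∃ k, k' ≤ k ∧ l ≤ k ∧ ∀ b : Fin m → S,
      (∀ a, b a ∈ Φ.base l) → (∀ c, C.vecMulLinear b c ∈ Φ.base k) →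
      ∃ (d : Fin q → S) (r : Fin m → S), (∀ j, d j ∈ Φ.base i) ∧ (∀ a, r a ∈ Φ.base k') ∧
        ∀ a, b a = ∑ j, d j * B j a + r a := by
  obtain ⟨l, hl0, hl⟩ : ∃ l, (i = 0 → l = 0) ∧ Φ.base l • (⊤ : Submodule S (Fin m → S)) ⊓
      LinearMap.ker C.vecMulLinear ≤ Φ.base i • LinearMap.ker C.vecMulLinear := by
    -- For `i = 0` no smallness of the coefficients is demanded, so none is required of the vector;
    -- this starts the later induction.
    rcases eq_or_ne i 0 with rfl | hi
    · exact ⟨0, fun _ => rfl, inf_le_right.trans (Φ.base_zero_smul _)⟩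
    · obtain ⟨l, hl⟩ := Φ.exists_artinRees i _ (LinearMap.ker C.vecMulLinear)
      exact ⟨l, fun h => absurd h hi, hl⟩
  refine ⟨l, hl0, fun k' => ?_⟩
  -- Artin–Rees for the image turns small `b C` into `r C` with `r` small. Taking the maximum with
  -- `l` keeps `b - r`, an exact syzygy, within reach of the first choice of `l`.
  obtain ⟨k, hk⟩ := Φ.exists_artinRees (max k' l) _ (LinearMap.range C.vecMulLinear)
  refine ⟨max k (max k' l), by omega, by omega, fun b hb hbC => ?_⟩
  have h1 := hk ⟨(Φ.mem_smul_top_iff _).2 fun c => Φ.base_antitone (le_max_left _ _) (hbC c),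
    LinearMap.mem_range_self _ b⟩
  rw [LinearMap.range_eq_map, ← Submodule.map_smul''] at h1
  obtain ⟨r, hr, hrb⟩ := h1
  rw [SetLike.mem_coe, mem_smul_top_iff] at hr
  have h2 := hl ⟨(Φ.mem_smul_top_iff (b - r)).2 fun a => sub_mem (hb a)
    (Φ.base_antitone (le_max_right _ _) (hr a)), by
      rw [SetLike.mem_coe, LinearMap.mem_ker, map_sub, hrb, sub_self]⟩
  rw [← hB] at h2
  obtain ⟨d, hd, hdb⟩ := Φ.exists_sum_of_mem_smul_span _ h2
  refine ⟨d, r, hd, fun a => Φ.base_antitone (le_max_left _ _) (hr a), fun a => ?_⟩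
  have := congrFun hdb a
  rw [Pi.sub_apply, sub_eq_iff_eq_add] at this
  rw [this]
  simp

end ArtinReesFiltration

variable {T : Type u} [Ring T] [TopologicalSpace T] [IsCompleteSeparated T]
  [IsTopologicalRing T] [IsLinearTopology T T] {S : Type u} [Ring S] {σ : S →+* T}

namespace Contramodule

variable (Φ : ArtinReesFiltration σ) {F : Contramodule T}

/-- Right multiplication on the quotient by a two-sided ideal of the base. -/
def quotientMulRight (n : ℕ) (r : T) : (T ⧸ (Φ.ideal n).1) →ₗ[T] T ⧸ (Φ.ideal n).1 :=
  (Φ.ideal n).1.mapQ _ (LinearMap.toSpanSingleton T T r) fun _ hs => Φ.mul_mem hs r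

theorem quotientMulRight_mkQ (n : ℕ) (r t : T) :
    quotientMulRight Φ n r ((Φ.ideal n).1.mkQ t) = (Φ.ideal n).1.mkQ (t * r) := rfl

/-- The map of powers of a cyclic discrete module given by a matrix. -/
def quotientMatrix (k : ℕ) {m n : ℕ} (C : Matrix (Fin m) (Fin n) S) :
    (Fin m → T ⧸ (Φ.ideal k).1) →ₗ[T] (Fin n → T ⧸ (Φ.ideal k).1) :=
  LinearMap.pi fun j => ∑ i, quotientMulRight Φ k (σ (C i j)) ∘ₗ LinearMap.proj i

theorem quotientMatrix_mkQ (k : ℕ) {m n : ℕ} (C : Matrix (Fin m) (Fin n) S) (t : Fin m → T)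
    (j : Fin n) : quotientMatrix Φ k C (fun i => (Φ.ideal k).1.mkQ (t i)) j =
      (Φ.ideal k).1.mkQ (∑ i, t i * σ (C i j)) := by
  simp [quotientMatrix, quotientMulRight_mkQ, -Submodule.mkQ_apply]

theorem quotientMatrix_single (k : ℕ) {m n : ℕ} (C : Matrix (Fin m) (Fin n) S) (i : Fin m) (t : T) :
    quotientMatrix Φ k C (Pi.single i ((Φ.ideal k).1.mkQ t)) =
      t • fun j => (Φ.ideal k).1.mkQ (σ (C i j)) := by
  have h : (Pi.single i ((Φ.ideal k).1.mkQ t) : Fin m → T ⧸ (Φ.ideal k).1) =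
      fun a => (Φ.ideal k).1.mkQ (if a = i then t else 0) := by
    funext a
    by_cases h : a = i
    · subst h
      simp
    · simp [h]
  funext j
  rw [h, quotientMatrix_mkQ]
  simp only [ite_mul, zero_mul, Finset.sum_ite_eq', Finset.mem_univ, if_true]
  exact map_smul _ t _

/-- A solution in a flat contramodule of a system of linear equations is approximated by linear
combinations of solutions in the ring. -/
theorem flat_exists_approx (hF : IsFlat F) {m n q : ℕ} (C : Matrix (Fin m) (Fin n) S)
    (B : Matrix (Fin q) (Fin m) S)
    (hB : Submodule.span S (Set.range B) = LinearMap.ker C.vecMulLinear) (i : ℕ) :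
    ∃ l, (i = 0 → l = 0) ∧ ∀ (k' : ℕ) (x : Fin m → F.A), (∀ a, x a ∈ F.mulIdeal (Φ.ideal l)) →
      rowMul x (C.map σ) = 0 →
      ∃ w : Fin q → F.A, (∀ j, w j ∈ F.mulIdeal (Φ.ideal i)) ∧
        ∀ a, x a - rowMul w (B.map σ) a ∈ F.mulIdeal (Φ.ideal k') := by
  obtain ⟨l, hl0, hl⟩ := Φ.exists_syzygy_approx C B hB i
  refine ⟨l, hl0, fun k' x hx hxC => ?_⟩
  obtain ⟨k, hkk', hlk, hk⟩ := hl k'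
  let I := Φ.ideal k
  let Q := T ⧸ I.1
  -- The matrix map is restricted to vectors with entries in the image of `Φ.ideal l`; kernel
  -- elements then inherit the smallness needed for small coefficients `w`.
  let L : Submodule T (Fin m → Q) := Submodule.pi Set.univ fun _ => (Φ.ideal l).1.map I.1.mkQ
  let f : L →ₗ[T] (Fin n → Q) := quotientMatrix Φ k C ∘ₗ L.subtype
  have hL : ∀ (b : Fin m) (t : T), t ∈ (Φ.ideal l).1 → Pi.single b (I.1.mkQ t) ∈ L := by
    intro b t ht a _
    by_cases h : a = b
    · subst h
      rw [Pi.single_eq_same]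
      exact ⟨t, ht, rfl⟩
    · rw [Pi.single_eq_of_ne h]
      exact Submodule.zero_mem _
  choose s hs hsx using hx
  let A : Fin m → Finset F.A := fun b => ((s b).2 I).toFinset
  have hA : ∀ b c, c ∉ A b → (s b).1 c ∈ I.1 := fun b c hc => by simpa [A] using hc
  let e : ∀ (b : Fin m) (c : F.A), L := fun b c => ⟨Pi.single b (I.1.mkQ ((s b).1 c)), hL b _ (hs b c)⟩
  -- A lift of the row `x`: each entry is expanded with coefficients in `Φ.ideal l`, and only the
  -- finitely many coefficients outside `I` contribute.
  let z : Contratensor F L := ∑ b, ∑ c ∈ A b, ctensor F L c (e b c)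
  let φ : Fin m → Fin n → Q := fun b j => I.1.mkQ (σ (C b j))
  have hz1 : ∀ b, ∑ c ∈ A b, contratensorMap F f (ctensor F L c (e b c)) =
      ctensor F (Fin n → Q) (x b) (φ b) := by
    intro b
    rw [← hsx b, sum_id, ctensor_act_eq_sum _ _ (A := A b)]
    · refine Finset.sum_congr rfl fun c _ => ?_
      rw [contratensorMap_ctensor]
      congr 1
      exact quotientMatrix_single Φ k C b _
    · intro c hc
      funext j
      change (s b).1 c • I.1.mkQ _ = 0
      rw [← map_smul]
      exact (Submodule.Quotient.mk_eq_zero _).2 (Φ.mul_mem (hA b c hc) _)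
  have hz : contratensorMap F f z = 0 := by
    simp only [z, map_sum, hz1]
    -- Moving the matrix entries across the tensor sign collects the image of `z` into the entries
    -- of `x C`, which vanish.
    have h1 : ∀ b, ctensor F (Fin n → Q) (x b) (φ b) =
        ∑ j, ctensor F (Fin n → Q) (op (σ (C b j)) • x b) (Pi.single j (I.1.mkQ 1)) := by
      intro b
      have h2 : φ b = ∑ j, σ (C b j) • (Pi.single j (I.1.mkQ 1) : Fin n → Q) := by
        funext a
        rw [Finset.sum_apply, Finset.sum_eq_single a]
        · rw [Pi.smul_apply, Pi.single_eq_same, ← map_smul, smul_eq_mul, mul_one]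
        · intro j _ hj
          rw [Pi.smul_apply, Pi.single_eq_of_ne hj.symm, smul_zero]
        · simp
      rw [h2, map_sum]
      exact Finset.sum_congr rfl fun j _ => (ctensor_smul _ _ _).symm
    simp only [h1]
    rw [Finset.sum_comm]
    refine Finset.sum_eq_zero fun j _ => ?_
    have h3 := congrFun hxC j
    rw [rowMul_apply] at h3
    have h4 := congrArg (fun y => ctensor F (Fin n → Q) y (Pi.single j (I.1.mkQ 1))) h3
    simpa using h4
  obtain ⟨κ, hκ⟩ := hF.exists_ker f hz
  -- Evaluation of the coordinates modulo `F.mulIdeal I`: it recovers `x` from `z`, and on tensors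
  -- with kernel elements it gives combinations of syzygies up to a small error.
  let ev : Fin m → Contratensor F L →+ F.A ⧸ F.mulIdeal I := fun a =>
    (F.evalQuotient I).comp (contratensorMap F (LinearMap.proj a ∘ₗ L.subtype))
  have hev : ∀ a (c : F.A) (y : L), ev a (ctensor F L c y) =
      F.evalQuotient I (ctensor F Q c (y.1 a)) := fun _ _ _ => rfl
  have hevz : ∀ a, ev a z = QuotientAddGroup.mk (x a) := by
    intro a
    simp only [z, map_sum, hev]
    rw [Finset.sum_eq_single a]
    · simp only [e, Pi.single_eq_same]
      have h1 := F.sum_sub_finset_sum_mem id (s a) (hA a)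
      have h2 := (QuotientAddGroup.eq_zero_iff _).2 h1
      rw [QuotientAddGroup.mk_sub, sub_eq_zero, hsx] at h2
      refine Eq.trans ?_ h2.symm
      exact (map_sum (QuotientAddGroup.mk' (F.mulIdeal I)) _ _).symm
    · intro b _ hb
      refine Finset.sum_eq_zero fun c _ => ?_
      simp only [e, Pi.single_eq_of_ne hb.symm, map_zero]
    · simp
  have hevκ : ∃ (w : Fin q → F.A) (y : Fin m → F.A), (∀ j, w j ∈ F.mulIdeal (Φ.ideal i)) ∧
      (∀ a, y a ∈ F.mulIdeal (Φ.ideal k')) ∧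
      ∀ a, ev a (contratensorMap F (LinearMap.ker f).subtype κ) =
        QuotientAddGroup.mk (rowMul w (B.map σ) a + y a) := by
    clear hκ
    induction κ using ctensor_induction with
    | zero =>
      refine ⟨0, 0, fun _ => zero_mem _, fun _ => zero_mem _, fun a => ?_⟩
      rw [map_zero, map_zero, zero_rowMul]
      simp
    | add κ κ' h h' =>
      obtain ⟨w, y, hw, hy, h⟩ := h
      obtain ⟨w', y', hw', hy', h'⟩ := h'
      refine ⟨w + w', y + y', fun j => add_mem (hw j) (hw' j), fun a => add_mem (hy a) (hy' a),
        fun a => ?_⟩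
      rw [map_add, map_add, h, h', add_rowMul, ← QuotientAddGroup.mk_add]
      simp only [Pi.add_apply]
      congr 1
      abel
    | mk c κ =>
      -- By density a kernel vector has representatives in `S`; they form an approximate syzygy, to
      -- which `exists_syzygy_approx` applies.
      have h1 : ∀ a, ∃ b : S, κ.1.1 a = I.1.mkQ (σ b) := by
        intro a
        obtain ⟨t, ht⟩ := I.1.mkQ_surjective (κ.1.1 a)
        obtain ⟨b, hb⟩ := Φ.dense t k
        exact ⟨b, ht.symm.trans ((Submodule.Quotient.eq _).2 hb)⟩
      choose b hb using h1
      have hbl : ∀ a, b a ∈ Φ.base l := by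
        intro a
        obtain ⟨t, ht, hta⟩ := κ.1.2 a trivial
        rw [hb] at hta
        have := Φ.antitone hlk ((Submodule.Quotient.eq _).1 hta)
        have := (Φ.ideal l).1.sub_mem ht this
        rwa [sub_sub_cancel] at this
      have hbC : ∀ j, C.vecMulLinear b j ∈ Φ.base k := by
        intro j
        have h2 := congrFun (LinearMap.mem_ker.1 κ.2) j
        have h3 : κ.1.1 = fun a => I.1.mkQ (σ (b a)) := funext hb
        have h4 : quotientMatrix Φ k C κ.1.1 j = 0 := h2
        rw [h3, quotientMatrix_mkQ] at h4
        have h5 := (Submodule.Quotient.mk_eq_zero _).1 h4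
        rw [Φ.mem_base]
        simpa [Matrix.vecMul, dotProduct] using h5
      obtain ⟨d, r, hd, hr, hbd⟩ := hk b hbl hbC
      refine ⟨fun j => op (σ (d j)) • c, fun a => op (σ (r a)) • c,
        fun j => F.smul_mem_mulIdeal_of_mem c (hd j),
        fun a => F.smul_mem_mulIdeal_of_mem c (hr a), fun a => ?_⟩
      rw [contratensorMap_ctensor, hev]
      change F.evalQuotient I (ctensor F Q c (κ.1.1 a)) = _
      rw [hb a, evalQuotient_ctensor, hbd]
      congr 1
      rw [rowMul_apply]
      simp only [Matrix.map_apply, smul_smul, ← op_mul, ← map_mul]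
      rw [map_add, MulOpposite.op_add, add_smul, map_sum, Finset.op_sum, Finset.sum_smul]
  obtain ⟨w, y, hw, hy, h⟩ := hevκ
  refine ⟨w, hw, fun a => ?_⟩
  have h1 := h a
  rw [hκ, hevz, ← sub_eq_zero, ← QuotientAddGroup.mk_sub, QuotientAddGroup.eq_zero_iff] at h1
  have h2 := add_mem (F.mulIdeal_mono (Φ.antitone hkk') h1) (hy a)
  have h3 : x a - rowMul w (B.map σ) a = x a - (rowMul w (B.map σ) a + y a) + y a := by abel
  rwa [h3]

theorem rowMul_mem_mulIdeal {m n k : ℕ} {x : Fin m → F.A}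
    (hx : ∀ a, x a ∈ F.mulIdeal (Φ.ideal k)) (C : Matrix (Fin m) (Fin n) T) (j : Fin n) :
    rowMul x C j ∈ F.mulIdeal (Φ.ideal k) :=
  sum_mem fun a _ => F.smul_mem_mulIdeal Φ (hx a) _

/-- Successive approximation. A remainder `z` has the same product with `C` as `x`; subtracting a
small `y` with that product gives an exact solution, approximated by some `w B`. Since `B C = 0`,
the new remainder `z - w B` keeps the product and is smaller. Exact solutions are the case `y = 0`;
the general hypothesis is needed for separatedness. -/
theorem flat_exists_of_forall_exists (hF : IsFlat F) {m n q : ℕ} (C : Matrix (Fin m) (Fin n) S)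
    (B : Matrix (Fin q) (Fin m) S)
    (hB : Submodule.span S (Set.range B) = LinearMap.ker C.vecMulLinear) (hBC : B * C = 0)
    (x : Fin m → F.A) (hx : ∀ k, ∃ y : Fin m → F.A, (∀ a, y a ∈ F.mulIdeal (Φ.ideal k)) ∧
      rowMul y (C.map σ) = rowMul x (C.map σ)) :
    ∃ w : Fin q → F.A, ∀ a k, x a - rowMul w (B.map σ) a ∈ F.mulIdeal (Φ.ideal k) := by
  have hBCσ : B.map σ * C.map σ = 0 := by
    rw [← Matrix.map_mul, hBC]
    simp
  choose l hl0 hl using fun i => flat_exists_approx Φ hF C B hB i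
  let p : ℕ → ℕ := fun i => max (l i) i
  have step : ∀ (i : ℕ) (z : Fin m → F.A), (∀ a, z a ∈ F.mulIdeal (Φ.ideal (p i))) ∧
      rowMul z (C.map σ) = rowMul x (C.map σ) →
      ∃ w : Fin q → F.A, (∀ j, w j ∈ F.mulIdeal (Φ.ideal i)) ∧
        ∀ a, z a - rowMul w (B.map σ) a ∈ F.mulIdeal (Φ.ideal (p (i + 1))) := by
    rintro i z ⟨hz, hzC⟩
    obtain ⟨y, hy, hyC⟩ := hx (max (p i) (p (i + 1)))
    obtain ⟨w, hw, hw'⟩ := hl i (p (i + 1)) (z - y) (fun a => sub_mem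
      (F.mulIdeal_mono (Φ.antitone (le_max_left _ _)) (hz a))
      (F.mulIdeal_mono (Φ.antitone ((le_max_left _ _).trans (le_max_left _ _))) (hy a)))
      (by rw [sub_rowMul, hzC, hyC, sub_self])
    refine ⟨w, hw, fun a => ?_⟩
    have := add_mem (hw' a) (F.mulIdeal_mono (Φ.antitone (le_max_right _ _)) (hy a))
    convert this using 1
    simp only [Pi.sub_apply]
    abel
  choose! w hw hw' using step
  let z : ℕ → Fin m → F.A := fun i =>
    Nat.rec x (fun i z => z - rowMul (w i z) (B.map σ)) i
  have hz_succ : ∀ i, z (i + 1) = z i - rowMul (w i (z i)) (B.map σ) := fun _ => rfl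
  have hz : ∀ i, (∀ a, z i a ∈ F.mulIdeal (Φ.ideal (p i))) ∧
      rowMul (z i) (C.map σ) = rowMul x (C.map σ) := by
    intro i
    induction i with
    | zero =>
      refine ⟨fun a => ?_, rfl⟩
      -- The first step carries no smallness condition, since the ideal of index `0` is the whole
      -- ring.
      have hp : p 0 = 0 := by simp [p, hl0]
      rw [hp]
      exact F.mem_mulIdeal_zero Φ _
    | succ i ih =>
      refine ⟨fun a => hw' i (z i) ih a, ?_⟩
      rw [hz_succ, sub_rowMul, ih.2, rowMul_rowMul, hBCσ, rowMul_zero, sub_zero]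
  -- The `i`-th correction lies in `F.mulIdeal (Φ.ideal i)`, so the corrections can be summed.
  choose W hW using fun j => F.exists_sub_sum_mem_mulIdeal Φ 0 (fun i => w i (z i) j) fun i => by
    rw [zero_add]
    exact hw i _ (hz i) j
  refine ⟨W, fun a k => ?_⟩
  have hzsum : ∀ i, z i = x - rowMul (fun j => ∑ r ∈ Finset.range i, w r (z r) j) (B.map σ) := by
    intro i
    induction i with
    | zero =>
      funext a
      simp [rowMul_apply, z]
    | succ i ih =>
      have h1 : (fun j => ∑ r ∈ Finset.range (i + 1), w r (z r) j) =
          (fun j => ∑ r ∈ Finset.range i, w r (z r) j) + w i (z i) := by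
        funext j
        exact Finset.sum_range_succ _ _
      rw [hz_succ, h1, add_rowMul, ← sub_sub, ← ih]
  have h2 : x a - rowMul W (B.map σ) a = z k a -
      rowMul (W - fun j => ∑ r ∈ Finset.range k, w r (z r) j) (B.map σ) a := by
    rw [sub_rowMul, hzsum k]
    simp only [Pi.sub_apply]
    abel
  rw [h2]
  refine sub_mem (F.mulIdeal_mono (Φ.antitone (le_max_right _ _)) ((hz k).1 a))
    (rowMul_mem_mulIdeal Φ (fun j => ?_) _ a)
  have := hW j k
  rwa [zero_add] at this

theorem _root_.Contra.ArtinReesFiltration.exists_syzygies (Φ : ArtinReesFiltration σ) {m n : ℕ}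
    (C : Matrix (Fin m) (Fin n) S) : ∃ (q : ℕ) (B : Matrix (Fin q) (Fin m) S),
      Submodule.span S (Set.range B) = LinearMap.ker C.vecMulLinear ∧ B * C = 0 := by
  have := Φ.noetherian
  obtain ⟨q, B, hB⟩ := Submodule.fg_iff_exists_fin_generating_family.1
    (IsNoetherian.noetherian (LinearMap.ker C.vecMulLinear))
  refine ⟨q, B, hB, ?_⟩
  funext i
  have : B i ∈ LinearMap.ker C.vecMulLinear := hB ▸ Submodule.subset_span ⟨i, rfl⟩
  exact LinearMap.mem_ker.1 this

/-- Flat contramodules are separated. -/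
theorem flat_separated (hF : IsFlat F) {x : F.A} (hx : ∀ k, x ∈ F.mulIdeal (Φ.ideal k)) :
    x = 0 := by
  refine F.eq_zero_of_forall_exists_finset_sum Φ {x | ∀ k, x ∈ F.mulIdeal (Φ.ideal k)} ?_ hx
  intro g hg n
  obtain ⟨r, a, ha⟩ := Φ.exists_generators n
  let C : Matrix (Fin r) (Fin 1) S := fun i _ => a i
  obtain ⟨q, B, hB, hBC⟩ := Φ.exists_syzygies C
  -- An element in every `F.mulIdeal (Φ.ideal k)` is a combination of the generators `a` with
  -- coefficients as small as desired.
  have h : ∀ k, ∃ y : Fin r → F.A, (∀ j, y j ∈ F.mulIdeal (Φ.ideal k)) ∧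
      rowMul y (C.map σ) = fun _ => g := by
    intro i
    obtain ⟨k, hk⟩ := exists_eq_sum_smul Φ ha i
    obtain ⟨y, hy, hgy⟩ := hk F g (hg k)
    exact ⟨y, hy, funext fun _ => hgy.symm⟩
  obtain ⟨y, -, hy⟩ := h 0
  -- Correcting one such expression by a syzygy leaves its value `g` unchanged and puts its
  -- coefficients into the intersection itself, as Nakayama requires.
  obtain ⟨w, hw⟩ := flat_exists_of_forall_exists Φ hF C B hB hBC y fun k => by rw [hy]; exact h k
  refine ⟨r, a, y - rowMul w (B.map σ), fun j => ha ▸ Submodule.subset_span ⟨j, rfl⟩, hw, ?_⟩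
  have h2 : rowMul (y - rowMul w (B.map σ)) (C.map σ) = fun _ => g := by
    rw [sub_rowMul, hy, rowMul_rowMul, ← Matrix.map_mul, hBC]
    funext j
    simp [rowMul_apply]
  exact (congrFun h2 0).symm

variable (σ) in
/-- The underlying right module of a contramodule over the dense subring. -/
def restrict (C : Contramodule T) : ModuleCat.{u} Sᵐᵒᵖ :=
  (ModuleCat.restrictScalars σ.op).obj (ModuleCat.of Tᵐᵒᵖ C.A)

/-- An exact solution is, entry by entry, a combination of syzygies up to an element of the
intersection of all `F.mulIdeal (Φ.ideal k)`, which is zero by `flat_separated`. -/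
theorem isEquationallyFlat_of_isFlat (Φ : ArtinReesFiltration σ) (hF : IsFlat F) :
    IsEquationallyFlat S (F.restrict σ) := by
  intro m n C x hx
  obtain ⟨q, B, hB, hBC⟩ := Φ.exists_syzygies C
  have hx' : rowMul (F := F.A) x (C.map σ) = 0 := hx
  obtain ⟨w, hw⟩ := flat_exists_of_forall_exists Φ hF C B hB hBC x fun k =>
    ⟨0, fun _ => zero_mem _, by rw [hx', zero_rowMul]⟩
  refine ⟨q, B, w, hBC, ?_⟩
  funext a
  have := flat_separated Φ hF (hw a)
  exact sub_eq_zero.1 this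

end Contramodule

end Flat

/-! ### Flatness of projective contramodules and of their direct limits. -/

noncomputable section FlatClass

open MulOpposite

attribute [local instance] t2Space_of_separated

variable {T : Type u} [Ring T] [TopologicalSpace T] [IsCompleteSeparated T]
  [IsTopologicalRing T] [IsLinearTopology T T]

section ZeroSmul

variable {M : Type u} [AddCommGroup M] [Module T M] [IsDiscreteModule T M] {X Y : Type u}

/-- The tail of the sum lies in the annihilator of `b`, an open left ideal and hence closed under
infinite sums. -/
theorem tsum_smul_eq_sum {z : X → T} (hz : IsZeroConvergent z) (b : M) {A : Finset X}
    (hA : ∀ x, x ∉ A → z x • b = 0) : (∑' x, z x) • b = ∑ x ∈ A, z x • b := by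
  rw [← (IsZeroConvergent.summable hz).sum_add_tsum_compl (s := A), add_smul, Finset.sum_smul]
  have h : ∑' x : ((A : Set X)ᶜ : Set X), z x ∈ Ideal.torsionOf T M b :=
    tsum_mem ⟨_, IsDiscreteModule.isOpen_annihilator b⟩ fun x => hA x x.2
  rw [(Ideal.mem_torsionOf_iff _ _).1 h, add_zero]

/-- The finitely supported family `s_x b` given by a zero-convergent family `s_x` and an element
`b` of a discrete module. -/
def zeroSmul (s : ZeroFamilies T X) : M →+ (X →₀ M) :=
  AddMonoidHom.mk' (fun b => Finsupp.ofSupportFinite (fun x => s.1 x • b)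
    (s.2 ⟨Ideal.torsionOf T M b, IsDiscreteModule.isOpen_annihilator b⟩)) fun b b' => by
      ext x
      exact smul_add _ _ _

theorem zeroSmul_apply (s : ZeroFamilies T X) (b : M) (x : X) : zeroSmul s b x = s.1 x • b := rfl

theorem zeroSmul_unit (x : X) (b : M) : zeroSmul (zeroUnit (S := T) x) b = Finsupp.single x b := by
  ext y
  rw [zeroSmul_apply]
  by_cases h : y = x
  · rw [h, zeroUnit_self, one_smul, Finsupp.single_eq_same]
  · rw [zeroUnit_of_ne h, zero_smul, Finsupp.single_eq_of_ne h]

theorem zeroSmul_add (s t : ZeroFamilies T X) (b : M) :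
    zeroSmul (s + t) b = zeroSmul s b + zeroSmul t b := by
  ext x
  exact add_smul _ _ _

theorem liftAddHom_zeroSmul {A : Type*} [AddCommGroup A] (f : X → M →+ A) (s : ZeroFamilies T X)
    (b : M) : Finsupp.liftAddHom f (zeroSmul s b) = ∑ᶠ x, f x (s.1 x • b) := by
  rw [finsum_eq_sum_of_support_subset (s := (zeroSmul s b).support)]
  · rfl
  · intro x hx
    rw [Finset.mem_coe, Finsupp.mem_support_iff, zeroSmul_apply]
    intro h
    exact hx (by simp [h])

theorem zeroSmul_bind (t : X → ZeroFamilies T Y) (s : ZeroFamilies T X) (b : M) :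
    zeroSmul (zeroBind t s) b = Finsupp.liftAddHom (fun x => zeroSmul (t x)) (zeroSmul s b) := by
  ext y
  rw [zeroSmul_apply, zeroBind_apply,
    tsum_smul_eq_sum (s.2.mul_left _) b (A := (zeroSmul s b).support)]
  · rw [Finsupp.liftAddHom_apply, Finsupp.sum, Finsupp.finsetSum_apply]
    exact Finset.sum_congr rfl fun x _ => mul_smul _ _ _
  · intro x hx
    rw [Finsupp.notMem_support_iff, zeroSmul_apply] at hx
    rw [mul_smul, hx, smul_zero]

theorem zeroSmul_map (f : X → Y) (s : ZeroFamilies T X) (b : M) :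
    zeroSmul (zeroMap f s) b = Finsupp.mapDomain f (zeroSmul s b) := by
  rw [← zeroBind_unit, zeroSmul_bind, Finsupp.mapDomain, Finsupp.liftAddHom_apply]
  exact Finsupp.sum_congr fun x _ => zeroSmul_unit _ _

theorem liftAddHom_mapDomain {A : Type*} [AddCommGroup A] (g : Y → M →+ A) (f : X → Y)
    (v : X →₀ M) : Finsupp.liftAddHom g (Finsupp.mapDomain f v) =
      Finsupp.liftAddHom (fun x => g (f x)) v := by
  rw [Finsupp.liftAddHom_apply, Finsupp.liftAddHom_apply, Finsupp.sum_mapDomain_index_addMonoidHom]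

theorem ctensor_act_eq_lift (C : Contramodule T) (s : ZeroFamilies T C.A) (b : M) :
    ctensor C M (C.act s) b = Finsupp.liftAddHom (ctensor C M) (zeroSmul s b) := by
  rw [ctensor_act, liftAddHom_zeroSmul]

theorem ctensor_sum (C : Contramodule T) (c : X → C.A) (s : ZeroFamilies T X) (b : M) :
    ctensor C M (C.sum c s) b = Finsupp.liftAddHom (fun x => ctensor C M (c x)) (zeroSmul s b) := by
  rw [Contramodule.sum_apply, ctensor_act_eq_lift, zeroSmul_map, liftAddHom_mapDomain]

end ZeroSmul

section RightExact

variable (C : Contramodule T) {K L N : Type u} [AddCommGroup K] [AddCommGroup L] [AddCommGroup N]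
  [Module T K] [Module T L] [Module T N] [IsDiscreteModule T K] [IsDiscreteModule T L]
  [IsDiscreteModule T N]

theorem contratensorMap_surjective (g : L →ₗ[T] N) (hg : Function.Surjective g) :
    Function.Surjective (contratensorMap C g) := by
  intro x
  induction x using ctensor_induction with
  | zero => exact ⟨0, map_zero _⟩
  | add x y hx hy =>
    obtain ⟨x, rfl⟩ := hx
    obtain ⟨y, rfl⟩ := hy
    exact ⟨x + y, map_add _ _ _⟩
  | mk c b =>
    obtain ⟨b, rfl⟩ := hg b
    exact ⟨ctensor C L c b, rfl⟩

/-- Right exactness: a set-theoretic section of `g` induces a map from the contratensor product with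
`N` to the cokernel of the first map; it is well defined because different lifts differ by elements
from `K`. -/
theorem contratensorMap_exact (f : K →ₗ[T] L) (g : L →ₗ[T] N) (hfg : Function.Exact f g)
    (hg : Function.Surjective g) :
    Function.Exact (contratensorMap C f) (contratensorMap C g) := by
  have hgf : ∀ x, contratensorMap C g (contratensorMap C f x) = 0 :=
    contratensor_hom_ext (f := (contratensorMap C g).comp (contratensorMap C f)) (g := 0)
      fun c b => by
        change ctensor C N c (g (f b)) = 0
        rw [hfg.apply_apply_eq_zero, map_zero]
  let R := (contratensorMap C f).range
  choose σ hσ using hg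
  have hker : ∀ b : L, g b = 0 → ∀ c, (QuotientAddGroup.mk (ctensor C L c b) :
      Contratensor C L ⧸ R) = 0 := by
    intro b hb c
    obtain ⟨b, rfl⟩ := (hfg b).1 hb
    exact (QuotientAddGroup.eq_zero_iff _).2 ⟨ctensor C K c b, rfl⟩
  have hker' : ∀ b b' : L, g b = g b' → ∀ c, (QuotientAddGroup.mk (ctensor C L c b) :
      Contratensor C L ⧸ R) = QuotientAddGroup.mk (ctensor C L c b') := by
    intro b b' h c
    rw [← sub_eq_zero, ← QuotientAddGroup.mk_sub, ← map_sub]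
    exact hker _ (by rw [map_sub, h, sub_self]) c
  let φ : C.A →+ N →+ Contratensor C L ⧸ R := AddMonoidHom.mk' (fun c => AddMonoidHom.mk'
    (fun n => QuotientAddGroup.mk (ctensor C L c (σ n))) fun n n' => by
      rw [← QuotientAddGroup.mk_add, ← map_add]
      exact hker' _ _ (by rw [map_add, hσ, hσ, hσ]) c) fun c c' => by
        ext n
        change QuotientAddGroup.mk (ctensor C L (c + c') (σ n)) = _
        rw [map_add]
        rfl
  have hφ : ∀ c b, φ c (g b) = QuotientAddGroup.mk (ctensor C L c b) := fun c b =>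
    hker' _ _ (hσ _) c
  let ψ : Contratensor C N →+ Contratensor C L ⧸ R := contratensorLift φ fun s n => by
    obtain ⟨b, rfl⟩ : ∃ b, g b = n := ⟨σ n, hσ n⟩
    rw [hφ, ctensor_act]
    simp only [← map_smul, hφ]
    refine AddMonoidHom.map_finsum (QuotientAddGroup.mk' R) ?_
    refine (finite_smul_ne_zero C L s b).subset fun c hc h => hc ?_
    simp [h]
  have hψ : ∀ x, ψ (contratensorMap C g x) = QuotientAddGroup.mk x :=
    contratensor_hom_ext (f := ψ.comp (contratensorMap C g)) (g := QuotientAddGroup.mk' R) hφ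
  intro x
  constructor
  · intro hx
    have := hψ x
    rw [hx, map_zero] at this
    exact (QuotientAddGroup.eq_zero_iff x).1 this.symm
  · rintro ⟨x, rfl⟩
    exact hgf x

/-- A contramodule is flat if its contratensor product functor preserves injective maps. -/
theorem isFlat_of_injective (h : ∀ (K L : Type u) [AddCommGroup K] [AddCommGroup L] [Module T K]
    [Module T L] [IsDiscreteModule T K] [IsDiscreteModule T L] (f : K →ₗ[T] L),
    Function.Injective f → Function.Injective (contratensorMap C f)) : IsFlat C := by
  intro K L N _ _ _ _ _ _ _ _ _ f g hf hfg hg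
  exact ⟨h K L f hf, contratensorMap_exact C f g hfg hg, contratensorMap_surjective C g hg⟩

end RightExact

section Functoriality

variable {C D E : Contramodule T} (M : Type u) [AddCommGroup M] [Module T M] [IsDiscreteModule T M]

/-- The map of contratensor products induced by a homomorphism of contramodules. -/
def contratensorMapLeft (f : C ⟶ D) : Contratensor C M →+ Contratensor D M :=
  contratensorLift ((ctensor D M).comp (Contramodule.homLinear f).toAddMonoidHom) fun s b => by
    change ctensor D M (f.f (C.act s)) b = ∑ᶠ c, ctensor D M (f.f c) _
    rw [Contramodule.hom_act, ← Contramodule.sum_apply, ctensor_sum, liftAddHom_zeroSmul]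

theorem contratensorMap_left_comm {N : Type u} [AddCommGroup N] [Module T N]
    [IsDiscreteModule T N] (f : C ⟶ D) (φ : M →ₗ[T] N) (x : Contratensor C M) :
    contratensorMap D φ (contratensorMapLeft M f x) =
      contratensorMapLeft N f (contratensorMap C φ x) :=
  contratensor_hom_ext (f := (contratensorMap D φ).comp (contratensorMapLeft M f))
    (g := (contratensorMapLeft N f).comp (contratensorMap C φ)) (fun _ _ => rfl) x

/-- The functor of contratensor product with a discrete module. -/
def contratensorFunctor : Contramodule T ⥤ AddCommGrpCat.{u} where
  obj C := AddCommGrpCat.of (Contratensor C M)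
  map f := AddCommGrpCat.ofHom (contratensorMapLeft M f)
  map_id C := by
    refine ConcreteCategory.hom_ext _ _ fun x => ?_
    exact contratensor_hom_ext (f := contratensorMapLeft M (𝟙 C)) (g := .id _) (fun _ _ => rfl) x
  map_comp {C D E} f g := by
    refine ConcreteCategory.hom_ext _ _ fun x => ?_
    exact contratensor_hom_ext (f := contratensorMapLeft M (f ≫ g))
      (g := (contratensorMapLeft M g).comp (contratensorMapLeft M f)) (fun _ _ => rfl) x

end Functoriality

theorem IsFlat.of_retract {C D : Contramodule T} (h : Retract C D) (hD : IsFlat D) : IsFlat C := by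
  refine isFlat_of_injective C fun K L _ _ _ _ _ _ f hf => ?_
  have hr : ∀ x : Contratensor C K, contratensorMapLeft K h.r (contratensorMapLeft K h.i x) = x :=
    contratensor_hom_ext (f := (contratensorMapLeft K h.r).comp (contratensorMapLeft K h.i))
      (g := .id _) fun c b => by
        change ctensor C K ((h.i ≫ h.r).f c) b = _
        rw [h.retract]
        rfl
  refine Function.Injective.of_comp (f := contratensorMapLeft L h.i) ?_
  have : (contratensorMapLeft L h.i ∘ contratensorMap C f) =
      contratensorMap D f ∘ contratensorMapLeft K h.i :=
    funext fun x => (contratensorMap_left_comm K h.i f x).symm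
  rw [this]
  exact (hD.injective f hf).comp (Function.LeftInverse.injective hr)

section Free

variable (X : Type u) (M : Type u) [AddCommGroup M] [Module T M] [IsDiscreteModule T M]

/-- The contratensor product with a free contramodule is a direct sum. -/
def freeContratensor : Contratensor (freeContramodule T X) M →+ (X →₀ M) :=
  contratensorLift (AddMonoidHom.mk' (fun s => zeroSmul ((Contramodule.freeEquiv X).symm s))
    fun s t => by
      ext1 b
      rw [map_add]
      exact zeroSmul_add _ _ b) fun s b => by
        refine Eq.trans ?_ (liftAddHom_zeroSmul (fun y => zeroSmul y) s b)
        refine Eq.trans ?_ (zeroSmul_bind (fun y => y) s b)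
        exact congrArg (fun z => zeroSmul (zeroJoin z) b) (zeroMap_id s).symm

theorem freeContratensor_injective : Function.Injective (freeContratensor (T := T) X M) := by
  let β : (X →₀ M) →+ Contratensor (freeContramodule T X) M := Finsupp.liftAddHom fun x =>
    ctensor _ M (Contramodule.freeEquiv X (zeroUnit x))
  have h : ∀ x, β (freeContratensor X M x) = x :=
    contratensor_hom_ext (f := β.comp (freeContratensor X M)) (g := .id _) fun s b => by
      obtain ⟨s, rfl⟩ := (Contramodule.freeEquiv X).surjective s
      refine (ctensor_sum (freeContramodule T X)
        (fun x => Contramodule.freeEquiv X (zeroUnit x)) s b).symm.trans ?_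
      rw [Contramodule.free_sum_unit]
      rfl
  exact Function.LeftInverse.injective h

/-- Contratensoring with the free contramodule amounts to forming `X →₀ M`, on which a map of
modules acts componentwise. -/
theorem isFlat_free : IsFlat (freeContramodule T X) := by
  refine isFlat_of_injective _ fun K L _ _ _ _ _ _ f hf => ?_
  refine Function.Injective.of_comp (f := freeContratensor X L) ?_
  have h : ∀ x, freeContratensor X L (contratensorMap (freeContramodule T X) f x) =
      Finsupp.mapRange.addMonoidHom f.toAddMonoidHom (freeContratensor X K x) :=
    contratensor_hom_ext (f := (freeContratensor X L).comp (contratensorMap _ f))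
      (g := (Finsupp.mapRange.addMonoidHom f.toAddMonoidHom).comp (freeContratensor X K))
      fun s b => by
        ext x
        exact (map_smul f _ b).symm
  have h' : (freeContratensor X L ∘ contratensorMap (freeContramodule T X) f) =
      Finsupp.mapRange.addMonoidHom f.toAddMonoidHom ∘ freeContratensor X K := funext h
  rw [h']
  exact (Finsupp.mapRange_injective _ (map_zero _) hf).comp (freeContratensor_injective X K)

end Free

namespace Contramodule

/-- The contramodule with a given contraaction. -/
def ofAct (A : Type u) (act : ZeroFamilies T A → A) (unit : ∀ a, act (zeroUnit a) = a)
    (join : ∀ z, act (zeroJoin z) = act (zeroMap act z)) : Contramodule T where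
  A := A
  a := ↾act
  unit := by refine ConcreteCategory.hom_ext _ _ fun q => ?_; exact unit q
  assoc := by refine ConcreteCategory.hom_ext _ _ fun z => ?_; exact join z

theorem sum_zero (C : Contramodule T) {X : Type u} (s : ZeroFamilies T X) :
    C.sum (fun _ : X => 0) s = 0 := by
  have h := C.sum_add (fun _ : X => 0) (fun _ => 0) s
  simp only [add_zero] at h
  exact left_eq_add.1 h

section Cokernel

variable {C D : Contramodule T} (f : C ⟶ D)

/-- The underlying set of the cokernel of a homomorphism of contramodules. -/
abbrev Cokernel : Type u := D.A ⧸ (homLinear f).toAddMonoidHom.range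

/-- The image of a homomorphism is closed under infinite sums. The contraaction on the cokernel is
therefore independent of representatives. -/
theorem mk_sum_eq_mk_sum {X : Type u} {c d : X → D.A}
    (h : ∀ x, (QuotientAddGroup.mk (c x) : Cokernel f) = QuotientAddGroup.mk (d x))
    (s : ZeroFamilies T X) :
    (QuotientAddGroup.mk (D.sum c s) : Cokernel f) = QuotientAddGroup.mk (D.sum d s) := by
  have h' : ∀ x, ∃ e, f.f e = -d x + c x := fun x => QuotientAddGroup.eq.1 (h x).symm
  choose e he using h'
  refine Eq.symm (QuotientAddGroup.eq.2 ⟨C.sum e s, ?_⟩)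
  have h1 : c = fun x => d x + (-d x + c x) := by
    funext x
    abel
  change f.f _ = _
  rw [h1, sum_add, hom_sum]
  simp only [he]
  abel_nf

/-- The contraaction on the cokernel. -/
def cokernelAct (s : ZeroFamilies T (Cokernel f)) : Cokernel f :=
  QuotientAddGroup.mk (D.sum Quotient.out s)

theorem cokernelAct_map (s : ZeroFamilies T D.A) :
    cokernelAct f (zeroMap QuotientAddGroup.mk s) = QuotientAddGroup.mk (D.act s) := by
  rw [cokernelAct, sum_map, ← sum_id]
  exact mk_sum_eq_mk_sum f (fun t => Quotient.out_eq _) s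

/-- The cokernel of a homomorphism of contramodules. -/
def cokernel : Contramodule T :=
  ofAct (Cokernel f) (cokernelAct f)
    (fun q => by
      rw [cokernelAct, sum_unit]
      exact Quotient.out_eq q)
    (fun z => by
      have h1 := D.sum_sum Quotient.out (fun t : ZeroFamilies T (Cokernel f) => t) z
      have h2 : zeroBind (fun t : ZeroFamilies T (Cokernel f) => t) z = zeroJoin z :=
        congrArg zeroJoin (zeroMap_id z)
      rw [h2] at h1
      rw [cokernelAct, ← h1, cokernelAct, sum_map]
      exact mk_sum_eq_mk_sum f (fun t => (Quotient.out_eq _).symm) z)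

/-- The projection to the cokernel. -/
def cokernelMk : D ⟶ cokernel f :=
  homMk (D := cokernel f) (fun d => (QuotientAddGroup.mk d : Cokernel f)) fun s =>
    (cokernelAct_map f s).symm

/-- An epimorphism forces the projection to its cokernel to coincide with zero. Surjectivity is what
yields projectivity of free contramodules. -/
theorem surjective_of_epi [Epi f] : Function.Surjective f.f := by
  let z : D ⟶ cokernel f := homMk (fun _ => 0) fun s => by
    rw [← sum_apply, sum_zero]
  have h : cokernelMk f = z := by
    rw [← cancel_epi f]
    refine hom_ext fun c => ?_
    change (QuotientAddGroup.mk (f.f c) : Cokernel f) = (0 : (cokernel f).A)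
    refine Eq.trans ?_ (map_zero (homLinear (cokernelMk f)))
    exact QuotientAddGroup.eq.2 ⟨-c, by simp; rfl⟩
  intro d
  have h1 : (homLinear (cokernelMk f)) d = (homLinear (cokernelMk f)) 0 := by
    rw [map_zero, homLinear_apply, h]
    rfl
  obtain ⟨c, hc⟩ := QuotientAddGroup.eq.1 h1.symm
  refine ⟨c, ?_⟩
  rw [neg_zero, zero_add] at hc
  exact hc

theorem epi_of_surjective (h : Function.Surjective f.f) : Epi f where
  left_cancellation g g' hg := hom_ext fun d => by
    obtain ⟨c, rfl⟩ := h d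
    exact congrArg (fun k : C ⟶ _ => k.f c) hg

end Cokernel

theorem free_hom_ext {X : Type u} {C : Contramodule T} {f g : freeContramodule T X ⟶ C}
    (h : ∀ x, f.f (freeEquiv X (zeroUnit x)) = g.f (freeEquiv X (zeroUnit x))) : f = g := by
  refine hom_ext fun s => ?_
  obtain ⟨s, rfl⟩ := (freeEquiv X).surjective s
  rw [← free_sum_unit, hom_sum, hom_sum]
  simp only [h]

theorem freeLift_unit {X : Type u} {C : Contramodule T} (c : X → C.A) (x : X) :
    (freeLift c).f (freeEquiv X (zeroUnit x)) = c x :=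
  C.sum_unit c x

theorem projective_free (X : Type u) : Projective (freeContramodule T X) where
  factors {E D} f e _ := by
    choose p hp using surjective_of_epi e
    refine ⟨freeLift fun x => p (f.f (freeEquiv X (zeroUnit x))), free_hom_ext fun x => ?_⟩
    change e.f ((freeLift _).f _) = _
    rw [freeLift_unit, hp]

theorem exists_retract_of_projective (P : Contramodule T) [Projective P] :
    Nonempty (Retract P (freeContramodule T P.A)) := by
  have : Epi (freeLift (C := P) id) := epi_of_surjective _ fun c =>
    ⟨freeEquiv _ (zeroUnit c), freeLift_unit id c⟩
  exact ⟨⟨Projective.factorThru (𝟙 P) (freeLift id), freeLift id, Projective.factorThru_comp _ _⟩⟩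

theorem isFlat_of_projective (P : Contramodule T) [Projective P] : IsFlat P := by
  obtain ⟨h⟩ := P.exists_retract_of_projective
  exact IsFlat.of_retract h (isFlat_free _)

theorem projective_of_isFGProjective {P : Contramodule T} (h : IsFGProjective P) :
    Projective P := by
  obtain ⟨X, -, ⟨h⟩⟩ := h
  have := projective_free (T := T) X
  exact h.projective

end Contramodule

section Colimit

variable (M : Type u) [AddCommGroup M] [Module T M] [IsDiscreteModule T M]

variable (T) in
/-- The contraaction on the group of homomorphisms from a discrete module to an abelian group. -/
def homAct (A : Type u) [AddCommGroup A] (s : ZeroFamilies T (M →+ A)) : M →+ A :=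
  (Finsupp.liftAddHom id).comp (zeroSmul s)

theorem homAct_apply {A : Type u} [AddCommGroup A] (s : ZeroFamilies T (M →+ A)) (b : M) :
    homAct T M A s b = Finsupp.liftAddHom id (zeroSmul s b) := rfl

theorem homAct_map_apply {X A : Type u} [AddCommGroup A] (g : X → M →+ A) (s : ZeroFamilies T X)
    (b : M) : homAct T M A (zeroMap g s) b = Finsupp.liftAddHom g (zeroSmul s b) := by
  rw [homAct_apply, zeroSmul_map, liftAddHom_mapDomain]
  rfl

theorem homAct_unit {A : Type u} [AddCommGroup A] (f : M →+ A) :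
    homAct T M A (zeroUnit f) = f := by
  refine AddMonoidHom.ext fun b => ?_
  rw [homAct_apply, zeroSmul_unit]
  simp

variable (T) in
/-- The contramodule of homomorphisms from a discrete module to an abelian group. -/
def homContramodule (A : Type u) [AddCommGroup A] : Contramodule T :=
  Contramodule.ofAct (M →+ A) (homAct T M A) (homAct_unit M) fun z => by
    refine AddMonoidHom.ext fun b => ?_
    rw [homAct_map_apply, homAct_apply]
    have h1 := zeroSmul_bind (fun t : ZeroFamilies T (M →+ A) => t) z b
    have h2 : zeroBind (fun t : ZeroFamilies T (M →+ A) => t) z = zeroJoin z :=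
      congrArg zeroJoin (zeroMap_id z)
    rw [h2] at h1
    rw [h1, ← AddMonoidHom.comp_apply, Finsupp.comp_liftAddHom]
    rfl

theorem homAct_add {A : Type u} [AddCommGroup A] (s t : ZeroFamilies T (M →+ A)) :
    homAct T M A (s + t) = homAct T M A s + homAct T M A t := by
  refine AddMonoidHom.ext fun b => ?_
  rw [AddMonoidHom.add_apply, homAct_apply, homAct_apply, homAct_apply, zeroSmul_add, map_add]

/-- The identity map is an isomorphism of groups. -/
def homContramoduleEquiv (A : Type u) [AddCommGroup A] :
    (homContramodule T M A).A ≃+ (M →+ A) where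
  toFun f := f
  invFun f := f
  left_inv _ := rfl
  right_inv _ := rfl
  map_add' f g := (homAct_add M (zeroUnit (f : M →+ A)) (zeroUnit (g : M →+ A))).trans
    (congrArg₂ (· + ·) (homAct_unit M f) (homAct_unit M g))

variable {C : Contramodule T} {A : Type u} [AddCommGroup A]

variable {M} in
theorem homContramodule_hom_ext {f g : C ⟶ homContramodule T M A}
    (h : ∀ c b, homContramoduleEquiv M A (f.f c) b = homContramoduleEquiv M A (g.f c) b) : f = g :=
  Contramodule.hom_ext fun c => (homContramoduleEquiv M A).injective (AddMonoidHom.ext (h c))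

/-- The adjunction between the contratensor product and the contramodule of homomorphisms. -/
def contratensorCurry (f : Contratensor C M →+ A) : C ⟶ homContramodule T M A :=
  Contramodule.homMk (D := homContramodule T M A) (fun c => f.comp (ctensor C M c)) fun s => by
    refine AddMonoidHom.ext fun b => Eq.trans ?_ (homAct_map_apply M _ s b).symm
    rw [AddMonoidHom.comp_apply, ctensor_act_eq_lift, ← AddMonoidHom.comp_apply,
      Finsupp.comp_liftAddHom]

/-- The adjunction between the contratensor product and the contramodule of homomorphisms. -/
def contratensorUncurry (f : C ⟶ homContramodule T M A) : Contratensor C M →+ A :=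
  contratensorLift ((homContramoduleEquiv M A).toAddMonoidHom.comp
    (Contramodule.homLinear f).toAddMonoidHom) fun s b => by
      refine Eq.trans ?_ (liftAddHom_zeroSmul (fun c => homContramoduleEquiv M A (f.f c)) s b)
      rw [← homAct_map_apply]
      exact DFunLike.congr_fun (congrArg (homContramoduleEquiv M A)
        (Contramodule.hom_act f s)) b

/-- The cocone corresponding to a cocone of contratensor products. -/
def contratensorCurryCocone {I : Type u} [SmallCategory I] {D : I ⥤ Contramodule T}
    (s : Cocone (D ⋙ contratensorFunctor M)) : Cocone D where
  pt := homContramodule T M s.pt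
  ι :=
  { app i := contratensorCurry M (s.ι.app i).hom
    naturality i _ f := homContramodule_hom_ext fun d b =>
      ConcreteCategory.congr_hom (s.w f) (ctensor (D.obj i) M d b) }

/-- The contratensor product preserves colimits. -/
def contratensorIsColimit {I : Type u} [SmallCategory I] {D : I ⥤ Contramodule T} {c : Cocone D}
    (hc : IsColimit c) : IsColimit ((contratensorFunctor M).mapCocone c) where
  desc s := AddCommGrpCat.ofHom (contratensorUncurry M (hc.desc (contratensorCurryCocone M s)))
  fac s i := by
    refine ConcreteCategory.hom_ext _ _ fun x => ?_
    refine contratensor_hom_ext (f := (contratensorUncurry M _).comp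
      (contratensorMapLeft M (c.ι.app i))) (g := (s.ι.app i).hom) (fun d b => ?_) x
    exact congrArg (fun k : D.obj i ⟶ homContramodule T M s.pt =>
      homContramoduleEquiv M s.pt (k.f d) b) (hc.fac (contratensorCurryCocone M s) i)
  uniq s m hm := by
    have h : contratensorCurry (C := c.pt) M m.hom = hc.desc (contratensorCurryCocone M s) :=
      hc.uniq (contratensorCurryCocone M s) _ fun i => homContramodule_hom_ext fun d b =>
        ConcreteCategory.congr_hom (hm i) (ctensor (D.obj i) M d b)
    refine ConcreteCategory.hom_ext _ _ fun x => ?_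
    refine contratensor_hom_ext (f := m.hom) (g := contratensorUncurry M _) (fun d b => ?_) x
    exact congrArg (fun k : c.pt ⟶ homContramodule T M s.pt =>
      homContramoduleEquiv M s.pt (k.f d) b) h

variable {I : Type u} [PartialOrder I] [IsDirectedOrder I] [Nonempty I] {D : I ⥤ Contramodule T}
  {c : Cocone D} (hc : IsColimit c)
include hc

theorem contratensor_exists_rep (x : Contratensor c.pt M) :
    ∃ (i : I) (y : Contratensor (D.obj i) M), contratensorMapLeft M (c.ι.app i) y = x := by
  obtain ⟨i, y, h⟩ := Concrete.isColimit_exists_rep _ (contratensorIsColimit M hc) x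
  exact ⟨i, y, h⟩

theorem contratensor_eq_zero {i : I} {y : Contratensor (D.obj i) M}
    (h : contratensorMapLeft M (c.ι.app i) y = 0) :
    ∃ (j : I) (g : i ⟶ j), contratensorMapLeft M (D.map g) y = 0 := by
  obtain ⟨j, g, g', h⟩ := (Concrete.isColimit_rep_eq_iff_exists _
    (contratensorIsColimit M hc) y (0 : Contratensor (D.obj i) M)).1
      (h.trans (map_zero (contratensorMapLeft M (c.ι.app i))).symm)
  exact ⟨j, g, h.trans (map_zero (contratensorMapLeft M (D.map g')))⟩

/-- The contratensor product commutes with colimits in the contramodule, so an element of a kernel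
comes from one stage and vanishes at a later one. -/
theorem isFlat_of_isColimit (hD : ∀ i, IsFlat (D.obj i)) : IsFlat c.pt := by
  refine isFlat_of_injective _ fun K L _ _ _ _ _ _ f hf => ?_
  rw [injective_iff_map_eq_zero]
  intro x hx
  obtain ⟨i, y, rfl⟩ := contratensor_exists_rep K hc x
  rw [contratensorMap_left_comm] at hx
  obtain ⟨j, g, h⟩ := contratensor_eq_zero L hc hx
  rw [← contratensorMap_left_comm] at h
  have h3 := (injective_iff_map_eq_zero _).1 ((hD j).injective f hf) _ h
  have h4 : contratensorMapLeft K (c.ι.app i) y =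
      contratensorMapLeft K (c.ι.app j) (contratensorMapLeft K (D.map g) y) :=
    (ConcreteCategory.congr_hom (((contratensorFunctor K).mapCocone c).w g) y).symm
  rw [h4, h3, map_zero]

omit hc in
/-- Direct limits of flat contramodules are flat. -/
theorem isFlat_of_directLimits {P : Contramodule T → Prop} (hP : ∀ C, P C → IsFlat C)
    {F : Contramodule T} (hF : DirectLimits P F) : IsFlat F := by
  obtain ⟨I, _, _, _, D, c, hD, ⟨hc⟩, ⟨e⟩⟩ := hF
  exact IsFlat.of_retract ⟨e.inv, e.hom, e.inv_hom_id⟩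
    (isFlat_of_isColimit hc fun i => hP _ (hD i))

end Colimit

end FlatClass

/-! ### Products of open ideals in a Gabriel topology. -/

noncomputable section Gabriel

theorem isOpen_of_mem_nhds {S : Type*} [Ring S] [TopologicalSpace S] [IsTopologicalRing S]
    {I : Ideal S} (h : (I : Set S) ∈ 𝓝 0) : IsOpen (I : Set S) :=
  AddSubgroup.isOpen_of_mem_nhds I.toAddSubgroup h

theorem isTopologicalRing_of_isInducing {S T : Type*} [Ring S] [TopologicalSpace S] [Ring T]
    [TopologicalSpace T] [IsTopologicalRing T] {σ : S →+* T} (hσ : IsInducing σ) :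
    IsTopologicalRing S :=
  { hσ.topologicalAddGroup σ, hσ.continuousMul σ with }

variable {S : Type u} [Ring S] [TopologicalSpace S] [IsTopologicalRing S]

/-- The quotient by `I • K` extends the discrete module given by `K` by the image of `K`, each of
whose elements is killed by `I`. Closure under extensions makes it discrete, and the annihilator of
the class of `1` is `I • K`. -/
theorem IsGabriel.smul_mem_nhds (hS : IsGabriel S) {I K : Ideal S} (hI : (I : Set S) ∈ 𝓝 0)
    (hK : (K : Set S) ∈ 𝓝 0) : ((I • K : Ideal S) : Set S) ∈ 𝓝 0 := by
  let L : Submodule S S := I • K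
  let N : Submodule S (S ⧸ L) := Submodule.map L.mkQ K
  have hN : IsDiscreteModule S N := isDiscreteModule_of_forall_exists fun b =>
    ⟨I, isOpen_of_mem_nhds hI, fun s hs => by
      obtain ⟨b, hb⟩ := b
      obtain ⟨k, hk, rfl⟩ := Submodule.mem_map.1 hb
      apply Subtype.ext
      exact (Submodule.Quotient.mk_eq_zero L).2 (Submodule.smul_mem_smul hs hk)⟩
  have hQ : IsDiscreteModule S ((S ⧸ L) ⧸ N) := isDiscreteModule_of_forall_exists fun b => by
    obtain ⟨b, rfl⟩ := N.mkQ_surjective b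
    obtain ⟨b, rfl⟩ := L.mkQ_surjective b
    refine ⟨Submodule.comap (LinearMap.toSpanSingleton S S b) K,
      (isOpen_of_mem_nhds hK).preimage (continuous_mul_const b), fun s hs => ?_⟩
    rw [← map_smul, ← map_smul]
    exact (Submodule.Quotient.mk_eq_zero N).2 (Submodule.mem_map_of_mem hs)
  have hM : IsDiscreteModule S (S ⧸ L) := by
    let E : ShortComplex (ModuleCat.{u} S) :=
      { f := ModuleCat.ofHom N.subtype
        g := ModuleCat.ofHom N.mkQ
        zero := by
          ext x
          exact (Submodule.Quotient.mk_eq_zero N).2 x.2 }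
    have hE : E.ShortExact := ModuleCat.shortComplex_shortExact E
      (LinearMap.exact_subtype_mkQ N) N.injective_subtype N.mkQ_surjective
    have := hS.extensions
    exact ObjectProperty.prop_X₂_of_shortExact
      (fun M : ModuleCat.{u} S => IsDiscreteModule S M) hE hN hQ
  have h := IsDiscreteModule.isOpen_annihilator (S := S) (L.mkQ 1)
  refine Filter.mem_of_superset (h.mem_nhds (Submodule.zero_mem _)) fun s hs => ?_
  have h' : L.mkQ (s • 1) = 0 := hs
  rw [smul_eq_mul, mul_one] at h'
  exact (Submodule.Quotient.mk_eq_zero L).1 h'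

theorem IsGabriel.pow_mem_nhds (hS : IsGabriel S) {J : Ideal S} (hJ : (J : Set S) ∈ 𝓝 0) (m : ℕ) :
    ((J ^ m : Ideal S) : Set S) ∈ 𝓝 0 := by
  induction m with
  | zero =>
    rw [Submodule.pow_zero, Ideal.one_eq_top]
    exact Filter.univ_mem
  | succ m ih =>
    refine Filter.mem_of_superset (hS.smul_mem_nhds ih hJ) ?_
    have : J ^ m • J ≤ J ^ (m + 1) := by
      rcases m.eq_zero_or_pos with rfl | hm
      · rw [zero_add, Submodule.pow_one]
        exact Submodule.smul_le_right
      · rw [Submodule.pow_succ]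
        exact Submodule.smul_le.2 fun r hr n hn => Submodule.mul_mem_mul hr hn
    exact this

end Gabriel

/-! ### Construction of the filtration by closures of ideals. -/

noncomputable section Filtration

variable {S T : Type u} [Ring S] [TopologicalSpace S] [Ring T] [TopologicalSpace T]
  [IsTopologicalRing T] [IsLinearTopology T T] {σ : S →+* T}

theorem mem_closure_iff_sub_mem [IsCompleteSeparated T] {A : Set T} {t : T} :
    t ∈ closure A ↔ ∀ I : OpenLeftIdeal T, ∃ a ∈ A, t - a ∈ I.1 := by
  constructor
  · intro h I
    have hU : (fun a => t - a) ⁻¹' (I.1 : Set T) ∈ 𝓝 t := by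
      apply (continuous_const.sub continuous_id).continuousAt
      simpa using I.mem_nhds
    obtain ⟨a, ha, haA⟩ := mem_closure_iff_nhds.1 h _ hU
    exact ⟨a, haA, ha⟩
  · intro h
    refine mem_closure_iff_nhds.2 fun U hU => ?_
    have hU' : (fun a => t - a) ⁻¹' U ∈ 𝓝 (0 : T) := by
      apply (continuous_const.sub continuous_id).continuousAt
      simpa using hU
    obtain ⟨I, hI⟩ := exists_openLeftIdeal hU'
    obtain ⟨a, haA, ha⟩ := h I
    exact ⟨a, by simpa using hI ha, haA⟩

/-- The closure of the image of a left ideal under a dense homomorphism of rings. -/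
def closureIdeal (hd : DenseRange σ) (J : Ideal S) : Ideal T where
  carrier := closure (σ '' J)
  zero_mem' := subset_closure ⟨0, J.zero_mem, map_zero σ⟩
  add_mem' hx hy := map_mem_closure₂ continuous_add hx hy (by
    rintro _ ⟨a, ha, rfl⟩ _ ⟨b, hb, rfl⟩
    exact ⟨a + b, J.add_mem ha hb, map_add σ a b⟩)
  smul_mem' r x hx := map_mem_closure₂ continuous_mul (hd r) hx (by
    rintro _ ⟨a, rfl⟩ _ ⟨b, hb, rfl⟩
    exact ⟨a * b, J.mul_mem_left a hb, map_mul σ a b⟩)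

theorem mul_mem_closureIdeal (hd : DenseRange σ) {J : Ideal S} (hJ : J.IsTwoSided) {x : T}
    (hx : x ∈ closureIdeal hd J) (r : T) : x * r ∈ closureIdeal hd J :=
  map_mem_closure₂ continuous_mul hx (hd r) (by
    rintro _ ⟨b, hb, rfl⟩ _ ⟨a, rfl⟩
    exact ⟨b * a, J.mul_mem_right a hb, map_mul σ b a⟩)

variable [IsCompleteSeparated T]

theorem exists_comap_le (hσ : IsInducing σ) {J : Ideal S} (hJ : (J : Set S) ∈ 𝓝 0) :
    ∃ I : OpenLeftIdeal T, ∀ s, σ s ∈ I.1 → s ∈ J := by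
  rw [hσ.nhds_eq_comap, map_zero] at hJ
  obtain ⟨U, hU, h⟩ := hJ
  obtain ⟨I, hI⟩ := exists_openLeftIdeal hU
  exact ⟨I, fun s hs => h (hI hs)⟩

/-- An ideal open in the induced topology contains the preimage of a neighborhood of zero, so
passing to the closure adds no elements of `S`. -/
theorem map_mem_closureIdeal_iff (hσ : IsInducing σ) (hd : DenseRange σ) {J : Ideal S}
    (hJ : (J : Set S) ∈ 𝓝 0) {s : S} : σ s ∈ closureIdeal hd J ↔ s ∈ J := by
  refine ⟨fun h => ?_, fun h => subset_closure ⟨s, h, rfl⟩⟩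
  obtain ⟨I, hI⟩ := exists_comap_le hσ hJ
  obtain ⟨_, ⟨j, hj, rfl⟩, h⟩ := mem_closure_iff_sub_mem.1 h I
  rw [← map_sub] at h
  simpa using J.add_mem (hI _ h) hj

theorem isOpen_closureIdeal (hσ : IsInducing σ) (hd : DenseRange σ) {J : Ideal S}
    (hJ : (J : Set S) ∈ 𝓝 0) : IsOpen (closureIdeal hd J : Set T) := by
  obtain ⟨I, hI⟩ := exists_comap_le hσ hJ
  refine isOpen_of_mem_nhds (Filter.mem_of_superset I.mem_nhds fun t ht => ?_)
  refine mem_closure_iff_sub_mem.2 fun K => ?_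
  obtain ⟨_, ⟨s, rfl⟩, hs⟩ := mem_closure_iff_sub_mem.1 (hd t) ⟨I.1 ⊓ K.1, I.2.inter K.2⟩
  exact ⟨σ s, ⟨s, hI s (by simpa using I.1.sub_mem ht hs.1), rfl⟩, hs.2⟩

theorem nonempty_artinReesFiltration (hσ : IsInducing σ) (hd : DenseRange σ)
    (hn : IsNoetherianRing S) (hG : IsGabriel S) (hB : HasCountableArtinReesBase S) :
    Nonempty (ArtinReesFiltration σ) := by
  have := isTopologicalRing_of_isInducing hσ
  obtain ⟨B, hBc, hB, hbasis⟩ := hB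
  have : (𝓝 (0 : S)).IsCountablyGenerated :=
    Filter.HasCountableBasis.isCountablyGenerated ⟨hbasis, hBc⟩
  obtain ⟨x, hxB, hx⟩ := hbasis.exists_antitone_subbasis
  -- The sequence is shifted by one to place the whole ring at index `0`.
  let J : ℕ → Ideal S := fun n => n.casesOn ⊤ x
  have hJanti : ∀ {m n}, m ≤ n → J n ≤ J m := by
    rintro (_ | m) (_ | n) h
    · exact le_rfl
    · exact le_top
    · omega
    · exact hx.antitone (by omega : m ≤ n)
  have hJnhds : ∀ n, (SetLike.coe (J n)) ∈ 𝓝 (0 : S) := by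
    rintro (_ | n)
    · exact Filter.univ_mem
    · exact hx.mem n
  have hJbasis : ∀ U ∈ 𝓝 (0 : S), ∃ n, SetLike.coe (J n) ⊆ U := fun U hU => by
    obtain ⟨n, hn⟩ := hx.mem_iff.1 hU
    exact ⟨n + 1, hn⟩
  have hJ2 : ∀ n, (J n).IsTwoSided := by
    rintro (_ | n)
    · exact inferInstanceAs (⊤ : Ideal S).IsTwoSided
    · exact (hB _ (hxB n)).1
  have hJAR : ∀ n, HasArtinRees (J n) := by
    rintro (_ | n)
    · intro M _ _ _ N
      refine ⟨1, one_pos, inf_le_right.trans fun y hy => ?_⟩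
      rw [← one_smul S y]
      exact Submodule.smul_mem_smul (show (1 : S) ∈ (⊤ : Ideal S) from trivial) hy
    · exact (hB _ (hxB n)).2
  let Ĵ : ℕ → OpenLeftIdeal T := fun n =>
    ⟨closureIdeal hd (J n), isOpen_closureIdeal hσ hd (hJnhds n)⟩
  have hcomap : ∀ n, (Ĵ n).1.comap σ.toSemilinearMap = J n := fun n =>
    Submodule.ext fun s => map_mem_closureIdeal_iff hσ hd (hJnhds n)
  exact ⟨{
    ideal := Ĵ
    zero := by
      refine top_unique fun t _ => ?_
      exact closure_mono (by rintro _ ⟨s, rfl⟩; exact ⟨s, trivial, rfl⟩) (hd t)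
    antitone := fun h => closure_mono (Set.image_mono (hJanti h))
    mul_mem := fun {n} _ h r => mul_mem_closureIdeal hd (hJ2 n) h r
    basis := fun I => by
      obtain ⟨n, hn⟩ := hJbasis (σ ⁻¹' (I.1 : Set T))
        (hσ.continuous.continuousAt (by rw [map_zero]; exact I.mem_nhds))
      -- Open left ideals are closed, so they contain the closure of any ideal whose image they
      -- contain.
      refine ⟨n, closure_minimal (Set.image_subset_iff.2 hn) ?_⟩
      exact AddSubgroup.isClosed_of_isOpen I.1.toAddSubgroup I.2
    dense := fun t n => by
      obtain ⟨_, ⟨s, rfl⟩, h⟩ := mem_closure_iff_sub_mem.1 (hd t) (Ĵ n)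
      exact ⟨s, h⟩
    noetherian := hn
    exists_le_smul := fun i j => by
      obtain ⟨k, hk⟩ := hJbasis _ (hG.smul_mem_nhds (hJnhds i) (hJnhds j))
      refine ⟨k, ?_⟩
      rw [hcomap, hcomap, hcomap]
      exact hk
    -- The power supplied by Artin–Rees is open by the Gabriel property and hence contains a member
    -- of the base.
    artinRees := fun k M _ _ _ N => by
      obtain ⟨m, -, hm⟩ := hJAR k M N
      obtain ⟨l, hl⟩ := hJbasis _ (hG.pow_mem_nhds (hJnhds k) m)
      refine ⟨l, ?_⟩
      rw [hcomap, hcomap]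
      exact (inf_le_inf_right N (Submodule.smul_mono_left hl)).trans hm }⟩

end Filtration

/-! ### Flat contramodules as direct limits of finitely generated free ones. -/

noncomputable section Contramodules

open MulOpposite

variable {S T : Type u} [Ring S] [Ring T] [TopologicalSpace T] [IsCompleteSeparated T]
  [IsTopologicalRing T] [IsLinearTopology T T] {σ : S →+* T}

theorem directLimits_mono {B : Type (u + 1)} [Category.{u} B] {P Q : B → Prop}
    (h : ∀ X, P X → Q X) {X : B} (hX : DirectLimits P X) : DirectLimits Q X := by
  obtain ⟨I, i1, i2, i3, D, c, hP, hc⟩ := hX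
  exact ⟨I, i1, i2, i3, D, c, fun i => h _ (hP i), hc⟩

namespace Contramodule

variable (σ) in
/-- The functor of restriction of scalars from contramodules to modules over a dense subring. -/
def restrictFunctor : Contramodule T ⥤ ModuleCat.{u} Sᵐᵒᵖ where
  obj C := C.restrict σ
  map f := (ModuleCat.restrictScalars σ.op).map (ModuleCat.ofHom (homLinear f))

/-- Homomorphisms from a finitely generated free contramodule. -/
def freeFinEquiv (n : ℕ) (C : Contramodule T) :
    (freeContramodule T (ULift.{u} (Fin n)) ⟶ C) ≃ (Fin n → C.A) where
  toFun f i := f.f (freeEquiv _ (zeroUnit ⟨i⟩))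
  invFun c := freeLift fun i => c i.down
  left_inv _ := free_hom_ext fun i => freeLift_unit _ i
  right_inv _ := funext fun _ => freeLift_unit _ _

/-- The abstract theorem is applied with `N = F` and the identity map: the required universal
property is the full faithfulness of restriction to `S`, given by `map_act_of_map_smul`. -/
theorem directLimits_isFGProjective_of_isFlat (Φ : ArtinReesFiltration σ) {F : Contramodule T}
    (hF : IsFlat F) : DirectLimits (fun P : Contramodule T => IsFGProjective P) F := by
  refine directLimits_of_isEquationallyFlat (restrictFunctor σ)
    (fun n => freeContramodule T (ULift.{u} (Fin n))) (fun n C => freeFinEquiv n C)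
    (fun _ _ _ _ _ _ => rfl) (isEquationallyFlat_of_isFlat Φ hF)
    (LinearMap.id : F.restrict σ →ₗ[Sᵐᵒᵖ] F.restrict σ) (fun C g => ?_)
    (fun n => ⟨_, inferInstance, ⟨Retract.refl _⟩⟩)
  let g' : F.A →+ C.A := g.toAddMonoidHom
  have hg' : ∀ (a : S) (x : F.A), g' (op (σ a) • x) = op (σ a) • g' x := fun a x =>
    g.map_smul (op a) x
  exact ⟨homMk g' fun s => map_act_of_map_smul F Φ g' hg' s, fun x => rfl, fun h hh => hom_ext hh⟩

theorem isFlat_of_directLimits_projective {F : Contramodule T}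
    (hF : DirectLimits (fun P : Contramodule T => Projective P) F) : IsFlat F :=
  isFlat_of_directLimits (fun C hC => by
    have : Projective C := hC
    exact isFlat_of_projective C) hF

theorem directLimits_projective_of_isFGProjective {F : Contramodule T}
    (hF : DirectLimits (fun P : Contramodule T => IsFGProjective P) F) :
    DirectLimits (fun P : Contramodule T => Projective P) F :=
  directLimits_mono (fun _ h => projective_of_isFGProjective h) hF

end Contramodule

end Contramodules

/-! ### Direct limits on which a functor is fully faithful stage by stage. -/

noncomputable section FlatColimit

open MulOpposite

variable {S : Type u} [Ring S]

section

variable {I : Type u} [PartialOrder I] [IsDirectedOrder I] [Nonempty I] {D : I ⥤ ModuleCat.{u} Sᵐᵒᵖ}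
  {c : Cocone D} (hc : IsColimit c)
include hc

theorem colimit_exists_rep_row {m : ℕ} (x : Fin m → c.pt) :
    ∃ (i : I) (y : Fin m → D.obj i), ∀ k, c.ι.app i (y k) = x k := by
  choose i y hy using fun k => Concrete.isColimit_exists_rep D hc (x k)
  obtain ⟨j, hj⟩ := Finite.exists_le i
  refine ⟨j, fun k => D.map (homOfLE (hj k)) (y k), fun k => ?_⟩
  exact (ConcreteCategory.congr_hom (c.w (homOfLE (hj k))) (y k)).trans (hy k)

theorem colimit_exists_map_eq_zero {i : I} {n : ℕ} {y : Fin n → D.obj i}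
    (h : ∀ k, c.ι.app i (y k) = 0) : ∃ (j : I) (g : i ⟶ j), ∀ k, D.map g (y k) = 0 := by
  choose j g g' hg using fun k =>
    (Concrete.isColimit_rep_eq_iff_exists D hc (y k) (0 : D.obj i)).1
      ((h k).trans (map_zero (c.ι.app i).hom).symm)
  obtain ⟨l, hl⟩ := Finite.exists_le j
  obtain ⟨l', hil, hll⟩ := exists_ge_ge i l
  refine ⟨l', homOfLE hil, fun k => ?_⟩
  have h1 : homOfLE hil = g k ≫ homOfLE ((hl k).trans hll) := Subsingleton.elim _ _
  rw [h1, D.map_comp]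
  refine (congrArg (D.map (homOfLE ((hl k).trans hll))) (hg k)).trans ?_
  exact (congrArg (D.map (homOfLE ((hl k).trans hll))) (map_zero (D.map (g' k)).hom)).trans
    (map_zero (D.map (homOfLE ((hl k).trans hll))).hom)

/-- A row and the equations imposed on it are finite data, so they already live at one stage of the
direct limit. -/
theorem IsEquationallyFlat.of_isColimit (hD : ∀ i, IsEquationallyFlat S (D.obj i)) :
    IsEquationallyFlat S c.pt := by
  intro m n C x hx
  obtain ⟨i, y, hy⟩ := colimit_exists_rep_row hc x
  have hx' : ∀ k, c.ι.app i (rowMul y C k) = 0 := fun k => by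
    refine (congrFun (map_rowMul (c.ι.app i).hom y C) k).trans ?_
    exact (congrArg (fun z => rowMul z C k) (funext hy)).trans (congrFun hx k)
  obtain ⟨j, g, hg⟩ := colimit_exists_map_eq_zero hc hx'
  obtain ⟨q, B, w, hB, hw⟩ := hD j m n C (fun k => D.map g (y k))
    ((map_rowMul (D.map g).hom y C).symm.trans (funext hg))
  refine ⟨q, B, fun k => c.ι.app j (w k), hB, ?_⟩
  refine Eq.trans ?_ (map_rowMul (c.ι.app j).hom w B)
  funext k
  refine (hy k).symm.trans ?_
  exact (ConcreteCategory.congr_hom (c.w g) (y k)).symm.trans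
    (congrArg (c.ι.app j) (congrFun hw k))

end

variable {B : Type (u + 1)} [Category.{u} B] (H : B ⥤ ModuleCat.{u} Sᵐᵒᵖ)

theorem bijective_map_of_retract {X X' : B} (r : Retract X X')
    (h : ∀ Y, Function.Bijective fun f : X' ⟶ Y => H.map f) (Y : B) :
    Function.Bijective fun f : X ⟶ Y => H.map f := by
  constructor
  · intro f g hfg
    have : r.r ≫ f = r.r ≫ g := (h Y).1 (by
      change H.map (r.r ≫ f) = H.map (r.r ≫ g)
      rw [H.map_comp, H.map_comp]
      exact congrArg (H.map r.r ≫ ·) hfg)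
    rw [← Category.id_comp f, ← Category.id_comp g, ← r.retract, Category.assoc, this,
      Category.assoc]
  · intro g
    obtain ⟨f, hf⟩ := (h Y).2 (H.map r.r ≫ g)
    have hf : H.map f = H.map r.r ≫ g := hf
    refine ⟨r.i ≫ f, ?_⟩
    change H.map (r.i ≫ f) = g
    rw [H.map_comp, hf, ← H.map_comp_assoc, r.retract, H.map_id, Category.id_comp]

theorem DirectLimits.exists_isColimit {P : B → Prop} {N : B} (hN : DirectLimits P N) :
    ∃ (I : Type u) (_ : PartialOrder I) (_ : IsDirectedOrder I) (_ : Nonempty I) (D : I ⥤ B)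
      (ι : D ⟶ (Functor.const I).obj N), (∀ i, P (D.obj i)) ∧ Nonempty (IsColimit (Cocone.mk N ι)) := by
  obtain ⟨I, i1, i2, i3, D, c, hP, ⟨hc⟩, ⟨e⟩⟩ := hN
  exact ⟨I, i1, i2, i3, D, (c.extend e.hom).ι, hP, ⟨hc.extendIso e.hom⟩⟩

variable (K : ℕ → B) (e : ∀ n Y, (K n ⟶ Y) ≃ (Fin n → H.obj Y))
  (he : ∀ n Y Z (f : K n ⟶ Y) (g : Y ⟶ Z) i, e n Z (f ≫ g) i = H.map g (e n Y f i))
include he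

/-- A direct limit of objects that a functor sends to flat modules, and on which it is fully
faithful, is a direct limit of the objects representing the free modules. -/
theorem directLimits_of_bijective_map {P Q : B → Prop} (hP : ∀ n, P (K n))
    (hQ : ∀ X, Q X → IsEquationallyFlat S (H.obj X))
    (hQ' : ∀ X, Q X → ∀ Y, Function.Bijective fun f : X ⟶ Y => H.map f) {N : B}
    (hN : DirectLimits Q N) : DirectLimits P N := by
  obtain ⟨I, _, _, _, D, ι, hD, ⟨hc⟩⟩ := hN.exists_isColimit
  -- The functor `H` need not preserve the direct limit, so the flat module is the colimit of the
  -- values of `H`, with only a comparison map `u` to `H N`.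
  let F := colimit (D ⋙ H)
  have hF : IsEquationallyFlat S F :=
    IsEquationallyFlat.of_isColimit (colimit.isColimit (D ⋙ H)) fun i => hQ _ (hD i)
  let u : F ⟶ H.obj N := colimit.desc (D ⋙ H) (H.mapCocone (Cocone.mk N ι))
  have hu : ∀ i, colimit.ι (D ⋙ H) i ≫ u = H.map (ι.app i) := fun i => colimit.ι_desc _ i
  refine directLimits_of_isEquationallyFlat H K e he hF u.hom (fun Y g => ?_) hP
  let g' : F ⟶ H.obj Y := ModuleCat.ofHom g
  choose t ht using fun i => (hQ' _ (hD i) Y).2 (colimit.ι (D ⋙ H) i ≫ g')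
  have ht : ∀ i, H.map (t i) = colimit.ι (D ⋙ H) i ≫ g' := ht
  have htn : ∀ {i j : I} (f : i ⟶ j), D.map f ≫ t j = t i := fun {i j} f => by
    refine (hQ' _ (hD i) Y).1 ?_
    change H.map (D.map f ≫ t j) = H.map (t i)
    rw [H.map_comp, ht, ht]
    exact colimit.w_assoc (D ⋙ H) f g'
  let s : Cocone D := Cocone.mk Y
    { app := t
      naturality := fun i j f => (htn f).trans (Category.comp_id _).symm }
  -- Compatibility with `u` is tested on the stages of `F`, where full faithfulness turns it into
  -- compatibility with the cocone `t` on `D`.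
  have key : ∀ h : N ⟶ Y, (∀ x, H.map h (u x) = g x) ↔ ∀ i, ι.app i ≫ h = t i := by
    intro h
    have h1 : (∀ x, H.map h (u x) = g x) ↔ u ≫ H.map h = g' :=
      ⟨fun h => ModuleCat.hom_ext (LinearMap.ext h), fun h x => ConcreteCategory.congr_hom h x⟩
    rw [h1]
    constructor
    · intro h' i
      refine (hQ' _ (hD i) Y).1 ?_
      change H.map (ι.app i ≫ h) = H.map (t i)
      rw [H.map_comp, ht, ← h', ← hu]
      exact Category.assoc _ _ _
    · intro h'
      refine colimit.hom_ext fun i => ?_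
      rw [← ht, ← h' i, H.map_comp, ← hu]
      exact (Category.assoc _ _ _).symm
  refine ⟨hc.desc s, (key _).2 fun i => hc.fac s i, fun h hh => ?_⟩
  exact hc.uniq s h ((key h).1 hh)

end FlatColimit

/-! ### The endomorphism ring in the finite topology. -/

noncomputable section FiniteTopology

variable (R : Type u) [Ring R] (M : Type u) [AddCommGroup M] [Module Rᵐᵒᵖ M]

attribute [local instance] finiteTopology

theorem continuous_finiteTopology_iff {Y : Type*} [TopologicalSpace Y]
    (φ : Y → Module.End Rᵐᵒᵖ M) : Continuous φ ↔ ∀ x y, ∀ᶠ z in 𝓝 y, φ z x = φ y x := by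
  letI : TopologicalSpace M := ⊥
  haveI : DiscreteTopology M := ⟨rfl⟩
  have h : Continuous φ ↔ ∀ x, Continuous fun y => φ y x :=
    continuous_induced_rng.trans continuous_pi_iff
  simp only [h, continuous_iff_continuousAt, ContinuousAt, nhds_discrete, Filter.tendsto_pure]

theorem eventually_apply_eq (f : Module.End Rᵐᵒᵖ M) (x : M) : ∀ᶠ g in 𝓝 f, g x = f x :=
  (continuous_finiteTopology_iff R M id).1 continuous_id x f

theorem isTopologicalRing_finiteTopology : IsTopologicalRing (Module.End Rᵐᵒᵖ M) where
  continuous_add := (continuous_finiteTopology_iff R M _).2 fun x ⟨f, g⟩ => by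
    filter_upwards [continuousAt_fst.eventually (eventually_apply_eq R M f x),
      continuousAt_snd.eventually (eventually_apply_eq R M g x)] with p h1 h2
    rw [LinearMap.add_apply, LinearMap.add_apply, h1, h2]
  continuous_neg := (continuous_finiteTopology_iff R M _).2 fun x f => by
    filter_upwards [eventually_apply_eq R M f x] with g h
    rw [LinearMap.neg_apply, LinearMap.neg_apply, h]
  continuous_mul := (continuous_finiteTopology_iff R M _).2 fun x ⟨f, g⟩ => by
    filter_upwards [continuousAt_fst.eventually (eventually_apply_eq R M f (g x)),
      continuousAt_snd.eventually (eventually_apply_eq R M g x)] with p h1 h2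
    rw [Module.End.mul_apply, Module.End.mul_apply, h2, h1]

attribute [local instance] isTopologicalRing_finiteTopology

variable {R M} in
/-- The endomorphisms annihilating a submodule. -/
def annihilatorIdeal (N : Submodule Rᵐᵒᵖ M) : Ideal (Module.End Rᵐᵒᵖ M) where
  carrier := {f | ∀ x ∈ N, f x = 0}
  zero_mem' _ _ := rfl
  add_mem' hf hg x hx := by rw [LinearMap.add_apply, hf x hx, hg x hx, add_zero]
  smul_mem' r f hf x hx := by rw [smul_eq_mul, Module.End.mul_apply, hf x hx, map_zero]

theorem isLinearTopology_finiteTopology :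
    IsLinearTopology (Module.End Rᵐᵒᵖ M) (Module.End Rᵐᵒᵖ M) :=
  IsLinearTopology.mk_of_hasBasis _ (s := fun N : Submodule Rᵐᵒᵖ M => annihilatorIdeal N)
    (finiteTopology_hasBasis R M)

attribute [local instance] isLinearTopology_finiteTopology

theorem isOpen_annihilatorIdeal {N : Submodule Rᵐᵒᵖ M} (hN : N.FG) :
    IsOpen (annihilatorIdeal N : Set (Module.End Rᵐᵒᵖ M)) :=
  isOpen_of_mem_nhds ((finiteTopology_hasBasis R M).mem_of_mem hN)

theorem exists_annihilatorIdeal_le (I : OpenLeftIdeal (Module.End Rᵐᵒᵖ M)) :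
    ∃ N : Submodule Rᵐᵒᵖ M, N.FG ∧ annihilatorIdeal N ≤ I.1 :=
  (finiteTopology_hasBasis R M).mem_iff.1 (I.2.mem_nhds I.1.zero_mem)

/-- A coherent system of classes determines an endomorphism pointwise: its value at `x` is read off
modulo the annihilator of the submodule spanned by `x`. Additivity is checked on a submodule
containing both summands. -/
theorem isCompleteSeparated_finiteTopology : IsCompleteSeparated (Module.End Rᵐᵒᵖ M) where
  separated f g h := by
    ext x
    have h1 := congrFun (congrArg Subtype.val h) ⟨annihilatorIdeal (Submodule.span Rᵐᵒᵖ {x}),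
      isOpen_annihilatorIdeal R M (Submodule.fg_span_singleton x)⟩
    exact sub_eq_zero.1
      ((Submodule.Quotient.eq _).1 h1 x (Submodule.mem_span_singleton_self x))
  complete z := by
    let J : {N : Submodule Rᵐᵒᵖ M // N.FG} → OpenLeftIdeal (Module.End Rᵐᵒᵖ M) := fun N =>
      ⟨annihilatorIdeal N.1, isOpen_annihilatorIdeal R M N.2⟩
    choose t ht using fun N => (J N).1.mkQ_surjective (z.1 (J N))
    let L : M → {N : Submodule Rᵐᵒᵖ M // N.FG} := fun x =>
      ⟨Submodule.span Rᵐᵒᵖ {x}, Submodule.fg_span_singleton x⟩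
    have key : ∀ N x, x ∈ N.1 → t N x = t (L x) x := fun N x hx => by
      have hle : (J N).1 ≤ (J (L x)).1 := fun f hf y hy =>
        hf y ((Submodule.span_singleton_le_iff_mem x N.1).2 hx hy)
      have h := z.2 (J N) (J (L x)) hle
      rw [← ht, ← ht] at h
      exact sub_eq_zero.1
        ((Submodule.Quotient.eq _).1 h x (Submodule.mem_span_singleton_self x))
    refine ⟨{ toFun := fun x => t (L x) x, map_add' := fun x y => ?_, map_smul' := fun r x => ?_ }, ?_⟩
    · let N : {N : Submodule Rᵐᵒᵖ M // N.FG} := ⟨(L x).1 ⊔ (L y).1, (L x).2.sup (L y).2⟩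
      have hx : x ∈ N.1 := Submodule.mem_sup_left (Submodule.mem_span_singleton_self x)
      have hy : y ∈ N.1 := Submodule.mem_sup_right (Submodule.mem_span_singleton_self y)
      rw [← key N _ hx, ← key N _ hy, ← key N _ (add_mem hx hy), map_add]
    · have hx : x ∈ (L x).1 := Submodule.mem_span_singleton_self x
      rw [← key (L x) _ (Submodule.smul_mem _ r hx), map_smul]
      rfl
    · apply Subtype.ext
      funext I
      obtain ⟨N, hN, hI⟩ := exists_annihilatorIdeal_le R M I
      have h := z.2 (J ⟨N, hN⟩) I hI
      rw [← ht] at h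
      refine Eq.trans ?_ h
      refine (Submodule.Quotient.eq I.1).2 (hI fun x hx => ?_)
      exact sub_eq_zero.2 (key ⟨N, hN⟩ x hx).symm

theorem isDiscreteModule_finiteTopology : IsDiscreteModule (Module.End Rᵐᵒᵖ M) M :=
  isDiscreteModule_of_forall_exists fun x =>
    ⟨annihilatorIdeal (Submodule.span Rᵐᵒᵖ {x}),
      isOpen_annihilatorIdeal R M (Submodule.fg_span_singleton x),
      fun _ hf => hf x (Submodule.mem_span_singleton_self x)⟩

attribute [local instance] isCompleteSeparated_finiteTopology isDiscreteModule_finiteTopology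

variable (X : Type u)

variable {R M X} in
/-- The homomorphism to a direct sum of copies of a module given by a zero-convergent family of
endomorphisms. -/
def familyHom (s : ZeroFamilies (Module.End Rᵐᵒᵖ M) X) : M →ₗ[Rᵐᵒᵖ] (X →₀ M) :=
  { zeroSmul s with
    map_smul' := fun r m => by
      ext x
      exact map_smul (s.1 x) r m }

variable {R M X} in
/-- The zero-convergent family of components of a homomorphism to a direct sum of copies of a
module. -/
def homFamily (f : M →ₗ[Rᵐᵒᵖ] (X →₀ M)) : ZeroFamilies (Module.End Rᵐᵒᵖ M) X :=
  ⟨fun x => Finsupp.lapply x ∘ₗ f, fun I => by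
    classical
    obtain ⟨N, ⟨A, rfl⟩, hI⟩ := exists_annihilatorIdeal_le R M I
    refine (A.biUnion fun m => (f m).support).finite_toSet.subset fun x hx => ?_
    by_contra h
    refine hx (hI fun y hy => ?_)
    have hle : Submodule.span Rᵐᵒᵖ (A : Set M) ≤ LinearMap.ker (Finsupp.lapply x ∘ₗ f) := by
      refine Submodule.span_le.2 fun m hm => ?_
      by_contra h'
      exact h (Finset.mem_coe.2 (Finset.mem_biUnion.2 ⟨m, hm, Finsupp.mem_support_iff.2 h'⟩))
    exact hle hy⟩

theorem familyHom_homFamily (f : M →ₗ[Rᵐᵒᵖ] (X →₀ M)) : familyHom (homFamily f) = f := by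
  ext m x
  rfl

end FiniteTopology

/-! ### Direct sums of copies of a module and the proof of part (2). -/

noncomputable section DirectSums

open MulOpposite

variable {R : Type u} [Ring R] {M : Type u} [AddCommGroup M] [Module Rᵐᵒᵖ M] {S : Type u} [Ring S]

attribute [local instance] finiteTopology isTopologicalRing_finiteTopology
  isLinearTopology_finiteTopology isCompleteSeparated_finiteTopology
  isDiscreteModule_finiteTopology

variable (σ : S →+* Module.End Rᵐᵒᵖ M)

/-- The functor of homomorphisms out of a right module, as right modules over a ring acting on
it. -/
def homFunctor : ModuleCat.{u} Rᵐᵒᵖ ⥤ ModuleCat.{u} Sᵐᵒᵖ :=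
  preadditiveCoyonedaObj (ModuleCat.of Rᵐᵒᵖ M) ⋙ ModuleCat.restrictScalars
    (((ModuleCat.endRingEquiv (ModuleCat.of Rᵐᵒᵖ M)).symm.toRingHom.comp σ).op)

/-- The elements of the values of the functor `homFunctor`. -/
def homFunctorEquiv (N : ModuleCat.{u} Rᵐᵒᵖ) : (homFunctor σ).obj N ≃+ (M →ₗ[Rᵐᵒᵖ] N) where
  toFun f := ModuleCat.Hom.hom (show ModuleCat.of Rᵐᵒᵖ M ⟶ N from f)
  invFun f := (show ModuleCat.of Rᵐᵒᵖ M ⟶ N from ModuleCat.ofHom f)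
  left_inv _ := rfl
  right_inv _ := rfl
  map_add' _ _ := rfl

theorem homFunctorEquiv_smul {N : ModuleCat.{u} Rᵐᵒᵖ} (s : S) (f : (homFunctor σ).obj N) :
    homFunctorEquiv σ N (op s • f) = homFunctorEquiv σ N f ∘ₗ σ s := rfl

variable (M) in
/-- Homomorphisms from a finite direct sum of copies of a module. -/
def finiteSumEquiv (n : ℕ) (N : ModuleCat.{u} Rᵐᵒᵖ) :
    (ModuleCat.of Rᵐᵒᵖ (ULift.{u} (Fin n) →₀ M) ⟶ N) ≃ (Fin n → (homFunctor σ).obj N) :=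
  ModuleCat.homEquiv.trans <| (Finsupp.lsum ℕ).symm.toEquiv.trans <|
    Equiv.arrowCongr Equiv.ulift (homFunctorEquiv σ N).symm.toEquiv

theorem finiteSumEquiv_comp (n : ℕ) (N N' : ModuleCat.{u} Rᵐᵒᵖ)
    (f : ModuleCat.of Rᵐᵒᵖ (ULift.{u} (Fin n) →₀ M) ⟶ N) (g : N ⟶ N') (i : Fin n) :
    finiteSumEquiv M σ n N' (f ≫ g) i = (homFunctor σ).map g (finiteSumEquiv M σ n N f i) := rfl

section

variable {X : Type u}

theorem homFamily_add (f g : M →ₗ[Rᵐᵒᵖ] (X →₀ M)) :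
    homFamily (f + g) = homFamily f + homFamily g := rfl

theorem homFamily_comp (f : M →ₗ[Rᵐᵒᵖ] (X →₀ M)) (t : Module.End Rᵐᵒᵖ M) :
    homFamily (f ∘ₗ t) = zeroMulRight (homFamily f) t :=
  Subtype.ext (funext fun x => (zeroMulRight_apply (homFamily f) t x).symm)

theorem familyHom_add (s t : ZeroFamilies (Module.End Rᵐᵒᵖ M) X) :
    familyHom (s + t) = familyHom s + familyHom t :=
  LinearMap.ext fun m => zeroSmul_add s t m

theorem familyHom_mulRight (s : ZeroFamilies (Module.End Rᵐᵒᵖ M) X) (t : Module.End Rᵐᵒᵖ M) :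
    familyHom (zeroMulRight s t) = familyHom s ∘ₗ t :=
  LinearMap.ext fun m => Finsupp.ext fun x => LinearMap.congr_fun (zeroMulRight_apply s t x) m

theorem familyHom_unit (x : X) :
    familyHom (zeroUnit (S := Module.End Rᵐᵒᵖ M) x) = Finsupp.lsingle x :=
  LinearMap.ext fun m => zeroSmul_unit x m

end

variable (X : Type u)

/-- The components of the homomorphisms to a direct sum of copies of a module. -/
def toFree : (homFunctor σ).obj (ModuleCat.of Rᵐᵒᵖ (X →₀ M)) →ₗ[Sᵐᵒᵖ]
    (freeContramodule (Module.End Rᵐᵒᵖ M) X).restrict σ where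
  toFun f := Contramodule.freeEquiv X (homFamily (homFunctorEquiv σ _ f))
  map_add' _ _ := (congrArg (Contramodule.freeEquiv X) (homFamily_add _ _)).trans
    (map_add (Contramodule.freeEquiv X) _ _)
  map_smul' _ _ := congrArg (Contramodule.freeEquiv X) (homFamily_comp _ _)

/-- The homomorphisms to a direct sum of copies of a module given by their components. -/
def ofFree : (freeContramodule (Module.End Rᵐᵒᵖ M) X).restrict σ →ₗ[Sᵐᵒᵖ]
    (homFunctor σ).obj (ModuleCat.of Rᵐᵒᵖ (X →₀ M)) where
  toFun s := (homFunctorEquiv σ (ModuleCat.of Rᵐᵒᵖ (X →₀ M))).symm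
    (familyHom ((Contramodule.freeEquiv X).symm s))
  map_add' s t := congrArg (homFunctorEquiv σ (ModuleCat.of Rᵐᵒᵖ (X →₀ M))).symm <|
    (congrArg familyHom (map_add (Contramodule.freeEquiv X).symm s t)).trans (familyHom_add _ _)
  map_smul' a s := congrArg (homFunctorEquiv σ (ModuleCat.of Rᵐᵒᵖ (X →₀ M))).symm
    (familyHom_mulRight ((Contramodule.freeEquiv X).symm s) (σ a.unop))

/-- This one-sided identity suffices: it makes the homomorphisms into the direct sum a retract of
the free contramodule over `S`, whence flatness, and it transports the decomposition of elements. -/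
theorem ofFree_toFree (f : (homFunctor σ).obj (ModuleCat.of Rᵐᵒᵖ (X →₀ M))) :
    ofFree σ X (toFree σ X f) = f :=
  congrArg (homFunctorEquiv σ (ModuleCat.of Rᵐᵒᵖ (X →₀ M))).symm (familyHom_homFamily R M X _)

variable {σ}

theorem isEquationallyFlat_homFunctor_finsupp (Φ : ArtinReesFiltration σ) :
    IsEquationallyFlat S ((homFunctor σ).obj (ModuleCat.of Rᵐᵒᵖ (X →₀ M))) :=
  (Contramodule.isEquationallyFlat_of_isFlat Φ (isFlat_free X)).of_retract (toFree σ X) (ofFree σ X)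
    (ofFree_toFree σ X)

theorem familyHom_eq_sum (Φ : ArtinReesFiltration σ) (n : ℕ) :
    ∃ (r : ℕ) (a : Fin r → S), (∀ j, a j ∈ Φ.base n) ∧
      ∀ f : (homFunctor σ).obj (ModuleCat.of Rᵐᵒᵖ (X →₀ M)), ∃ (A : Finset X) (u : X → S)
        (y : Fin r → (homFunctor σ).obj (ModuleCat.of Rᵐᵒᵖ (X →₀ M))),
        f = ∑ x ∈ A, op (u x) • (homFunctorEquiv σ (ModuleCat.of Rᵐᵒᵖ (X →₀ M))).symm
          (Finsupp.lsingle x) + ∑ j, op (a j) • y j := by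
  obtain ⟨r, a, ha, h⟩ := Contramodule.free_exists_decomposition Φ n
  refine ⟨r, a, ha, fun f => ?_⟩
  obtain ⟨A, u, y, h⟩ := h X (toFree σ X f)
  refine ⟨A, u, fun j => ofFree σ X (y j), ?_⟩
  refine (ofFree_toFree σ X f).symm.trans ((congrArg (ofFree σ X) h).trans ?_)
  refine (map_add (ofFree σ X) _ _).trans ?_
  refine congrArg₂ (· + ·) ((map_sum (ofFree σ X) _ _).trans (Finset.sum_congr rfl fun x _ => ?_))
    ((map_sum (ofFree σ X) _ _).trans (Finset.sum_congr rfl fun j _ => ?_))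
  · refine ((ofFree σ X).map_smul (op (u x)) _).trans (congrArg (op (u x) • ·) ?_)
    exact congrArg (homFunctorEquiv σ (ModuleCat.of Rᵐᵒᵖ (X →₀ M))).symm (familyHom_unit x)
  · exact (ofFree σ X).map_smul (op (a j)) _

/-- An `S`-linear map out of `Hom(M, M^(X))` is determined by the coordinate inclusions: evaluated
at a given `m`, the infinite part of the decomposition disappears. The values at these inclusions
also assemble into a homomorphism out of the direct sum. -/
theorem bijective_homFunctor_map_finsupp (Φ : ArtinReesFiltration σ) (N : ModuleCat.{u} Rᵐᵒᵖ) :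
    Function.Bijective fun f : ModuleCat.of Rᵐᵒᵖ (X →₀ M) ⟶ N => (homFunctor σ).map f := by
  let ε : X → (homFunctor σ).obj (ModuleCat.of Rᵐᵒᵖ (X →₀ M)) := fun x =>
    (homFunctorEquiv σ (ModuleCat.of Rᵐᵒᵖ (X →₀ M))).symm (Finsupp.lsingle x)
  have hzero : ∀ g : (homFunctor σ).obj (ModuleCat.of Rᵐᵒᵖ (X →₀ M)) →ₗ[Sᵐᵒᵖ]
      (homFunctor σ).obj N, (∀ x, g (ε x) = 0) → ∀ f, g f = 0 := by
    intro g hg f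
    apply (homFunctorEquiv σ N).injective
    rw [map_zero]
    ext m
    -- The index is chosen so that the ideal annihilates `m`; the multiples of the `a j` then vanish
    -- at `m`.
    obtain ⟨n, hn⟩ := Φ.basis
      ⟨Ideal.torsionOf _ M m, IsDiscreteModule.isOpen_annihilator m⟩
    obtain ⟨r, a, ha, h⟩ := familyHom_eq_sum X Φ n
    obtain ⟨A, u, y, rfl⟩ := h f
    have h1 : g (∑ x ∈ A, op (u x) • ε x + ∑ j, op (a j) • y j) = ∑ j, op (a j) • g (y j) := by
      rw [map_add, map_sum, map_sum, Finset.sum_eq_zero, zero_add]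
      · exact Finset.sum_congr rfl fun j _ => map_smul g _ _
      · intro x _
        rw [map_smul, hg, smul_zero]
    refine (congrArg (fun z => homFunctorEquiv σ N z m) h1).trans ?_
    rw [map_sum, LinearMap.sum_apply]
    refine Finset.sum_eq_zero fun j _ => ?_
    have h2 : σ (a j) m = 0 := hn (ha j)
    rw [homFunctorEquiv_smul, LinearMap.comp_apply, h2, map_zero]
  constructor
  · intro f g hfg
    have hfg : (homFunctor σ).map f = (homFunctor σ).map g := hfg
    refine ModuleCat.hom_ext (Finsupp.lhom_ext fun x m => ?_)
    have h := congrArg (homFunctorEquiv σ N) (ConcreteCategory.congr_hom hfg (ε x))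
    exact LinearMap.congr_fun h m
  · intro g
    let h : (X →₀ M) →ₗ[Rᵐᵒᵖ] N := Finsupp.lsum ℕ fun x => homFunctorEquiv σ N (g (ε x))
    refine ⟨ModuleCat.ofHom h, ?_⟩
    ext f
    refine sub_eq_zero.1 (hzero (((homFunctor σ).map (ModuleCat.ofHom h)).hom - g.hom) ?_ f)
    intro x
    refine sub_eq_zero.2 ((homFunctorEquiv σ N).injective (LinearMap.ext fun m => ?_))
    exact Finsupp.lsum_single ℕ (fun x => homFunctorEquiv σ N (g (ε x))) x m

/-- Flatness of the values and full faithfulness of `Hom(M, -)` both pass from direct sums of copies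
of `M` to their summands. -/
theorem directLimits_isFinAdd_of_isAdd (Φ : ArtinReesFiltration σ) {N : ModuleCat.{u} Rᵐᵒᵖ}
    (hN : DirectLimits (IsAdd R M) N) : DirectLimits (IsFinAdd R M) N := by
  refine directLimits_of_bijective_map (homFunctor σ)
    (fun n => ModuleCat.of Rᵐᵒᵖ (ULift.{u} (Fin n) →₀ M)) (finiteSumEquiv M σ)
    (finiteSumEquiv_comp σ) (fun n => ⟨_, inferInstance, ⟨Retract.refl _⟩⟩) ?_ ?_ hN
  · rintro N ⟨X, ⟨r⟩⟩
    refine (isEquationallyFlat_homFunctor_finsupp X Φ).of_retract ((homFunctor σ).map r.i).hom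
      ((homFunctor σ).map r.r).hom fun x => ?_
    exact ConcreteCategory.congr_hom (r.map (homFunctor σ)).retract x
  · rintro N ⟨X, ⟨r⟩⟩
    exact bijective_map_of_retract (homFunctor σ) r (bijective_homFunctor_map_finsupp X Φ)

end DirectSums

end Contra

/-! ### Assembly of the two statements. -/

theorem mainTheorem8 :
    (∀ (𝔖 : Type u) [Ring 𝔖] [TopologicalSpace 𝔖] [IsTopologicalRing 𝔖] [IsLinearTopology 𝔖 𝔖]
        [Contra.IsCompleteSeparated 𝔖]
        (S : Type u) [Ring S] [TopologicalSpace S] (σ : S →+* 𝔖),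
        IsInducing σ → DenseRange σ → IsNoetherianRing S → Contra.IsGabriel S →
        Contra.HasCountableArtinReesBase S →
          Contra.CGL1 𝔖 ∧ Contra.CGL2 𝔖 ∧
          ∀ F : Contra.Contramodule 𝔖, Contra.IsFlat F →
            Contra.DirectLimits (fun P : Contra.Contramodule 𝔖 => Contra.IsFGProjective P) F) ∧
    (∀ (R : Type u) [Ring R] (M : Type u) [AddCommGroup M] [Module Rᵐᵒᵖ M]
        (S : Type u) [Ring S] [TopologicalSpace S] (σ : S →+* Module.End Rᵐᵒᵖ M),
        @IsInducing _ _ _ (Contra.finiteTopology R M) σ →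
        @DenseRange _ (Contra.finiteTopology R M) _ σ →
        IsNoetherianRing S → Contra.IsGabriel S → Contra.HasCountableArtinReesBase S →
          ∀ N : ModuleCat.{u} Rᵐᵒᵖ,
            Contra.DirectLimits (Contra.IsFinAdd R M) N ↔
              Contra.DirectLimits (Contra.IsAdd R M) N) := by
  refine ⟨fun 𝔖 _ _ _ _ _ S _ _ σ hσ hd hn hG hB => ?_,
    fun R _ M _ _ S _ _ σ hσ hd hn hG hB N => ?_⟩
  · obtain ⟨Φ⟩ := Contra.nonempty_artinReesFiltration hσ hd hn hG hB
    -- A cycle of inclusions: flat contramodules are direct limits of finitely generated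
    -- projectives, hence of projectives, and these are flat.
    have h := fun F : Contra.Contramodule 𝔖 =>
      Contra.Contramodule.directLimits_isFGProjective_of_isFlat Φ (F := F)
    refine ⟨fun F => ⟨fun hF => ?_, fun hF => ?_⟩, fun F => ⟨fun hF => ?_, fun hF => ?_⟩, h⟩
    · exact Contra.Contramodule.directLimits_projective_of_isFGProjective (h F hF)
    · exact Contra.Contramodule.isFlat_of_directLimits_projective hF
    · exact h F (Contra.Contramodule.isFlat_of_directLimits_projective hF)
    · exact Contra.Contramodule.directLimits_projective_of_isFGProjective hF
  · letI := Contra.finiteTopology R M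
    haveI := Contra.isTopologicalRing_finiteTopology R M
    haveI := Contra.isLinearTopology_finiteTopology R M
    haveI := Contra.isCompleteSeparated_finiteTopology R M
    refine ⟨fun hN => ?_, fun hN => ?_⟩
    · exact Contra.directLimits_mono (fun _ ⟨X, _, r⟩ => ⟨X, r⟩) hN
    · obtain ⟨Φ⟩ := Contra.nonempty_artinReesFiltration hσ hd hn hG hB
      exact Contra.directLimits_isFinAdd_of_isAdd Φ hN
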